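/- Let $d(x,y)=\frac{|X\wedge Y|}{\|X\|\,\|Y\|}$ be the spherical distance on $\mathbb{P}^1(\mathbb{C})$, where $X,Y\in\mathbb{C}^2\setminus\{0\}$ represent $x,y$, $X\wedge Y=X_1Y_2-X_2Y_1$ and $\|\cdot\|$ is the Hermitian norm. Let $\omega$ be the Fubini--Study probability measure, and normalize $\mathrm{dd}^c$ by $\mathrm{dd}^c\log|z|=\delta_0$ on $\mathbb{C}$. For a continuous $g:\mathbb{P}^1(\mathbb{C})\to\mathbb{R}$ put $\Phi_g(x,y)=\log d(x,y)-g(x)-g(y)\in\mathbb{R}\cup\{-\infty\}$. The function $g$ is the good potential of a probability measure $\mu$ if $\mu=\omega+\mathrm{dd}^c g$ and $\iint\Phi_g\,\mathrm{d}\mu\,\mathrm{d}\mu=0$. For $0<\alpha\le 1$ let $\|f\|_{\mathscr{C}^{0,\alpha}}=\sup_{x\neq y}|f(x)-f(y)|/d(x,y)^\alpha$, and call $f$ $\alpha$-Hölder ($f\in\mathscr{C}^\alpha$) if this is finite. A finite set $F\subset\mathbb{P}^1(\mathbb{C})$ of cardinality $n\ge 2$ is a quasi-$g$-Fekete configuration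 with constant $C'$ if $\sum_{x\ne y\in F}\Phi_g(x,y)\ge -C'\,n\log n$ (sum over ordered pairs). For $\varphi\in W^{1,2}\cap\mathscr{C}^\gamma$ put $\|\varphi\|_\gamma=\|\varphi\|_{\mathscr{C}^{0,\gamma}}+\|\nabla\varphi\|_{L^2}$, where $\|\nabla\varphi\|_{L^2}^2=\int \mathrm{d}\varphi\wedge \mathrm{d}^c\varphi=\frac{1}{2\pi}\int_{\mathbb{C}}|\nabla\varphi|^2\,\mathrm{d}x\,\mathrm{d}y$ in the affine chart. **Theorem.** Let $\alpha\in(0,1]$, let $\mu$ be a probability measure on $\mathbb{P}^1(\mathbb{C})$ with $\alpha$-Hölder good potential $g$, and let $C'>0$. Then for every $\gamma\in[\min(1/4,2\alpha),1]$, every $\varphi\in W^{1,2}(\mathbb{P}^1(\mathbb{C}),\mathbb{R})\cap\mathscr{C}^\gamma(\mathbb{P}^1(\mathbb{C}),\mathbb{R})$ and every quasi-$g$-Fekete configuration $F$ of cardinality $n\ge2$ with constant $C'$, $$\left|\int_{\mathbb{P}^1(\mathbb{C})}\varphi\,\mathrm{d}\mu-\frac1n\sum_{z\in F}\varphi(z)\right|\le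 C_1\left(\frac{\log n}{n}\right)^{1/2}\|\varphi\|_\gamma,\qquad C_1=\sqrt{2\|g\|_{\mathscr{C}^{0,\alpha}}+1+C'+\max(2,1/\alpha)}.$$ -/

import Mathlib

open MeasureTheory
open scoped LinearAlgebra.Projectivization ContDiff

noncomputable section

namespace QuasiFekete

/-! ### The complex projective line, its spherical distance, topology and charts -/

/-- The complex projective line: lines in the Hermitian space `ℂ²`. -/
abbrev P1 : Type := ℙ ℂ (EuclideanSpace ℂ (Fin 2))

/-- The usual (quotient) topology on the projective line. -/
instance : TopologicalSpace P1 :=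
  TopologicalSpace.coinduced
    (fun v : {v : EuclideanSpace ℂ (Fin 2) // v ≠ 0} => Projectivization.mk ℂ v.1 v.2) inferInstance

/-- The Borel `σ`-algebra on the projective line. -/
instance : MeasurableSpace P1 := borel P1

instance : BorelSpace P1 := ⟨rfl⟩

/-- `|X₀ Y₁ - X₁ Y₀| / (‖X‖ ‖Y‖)` for two vectors of `ℂ²`. -/
def chordal (X Y : EuclideanSpace ℂ (Fin 2)) : ℝ :=
  ‖X 0 * Y 1 - X 1 * Y 0‖ / (‖X‖ * ‖Y‖)

/-- The spherical distance `d(x,y) = |X ∧ Y| / (‖X‖ ‖Y‖)`, for any representatives `X`, `Y` of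
`x`, `y` (the choice does not matter, see `sphDist_mk`). -/
def sphDist (x y : P1) : ℝ := chordal x.rep y.rep

lemma chordal_smul (a b : ℂ) (ha : a ≠ 0) (hb : b ≠ 0) (X Y : EuclideanSpace ℂ (Fin 2)) :
    chordal (a • X) (b • Y) = chordal X Y := by
  have ha' : ‖a‖ ≠ 0 := norm_ne_zero_iff.mpr ha
  have hb' : ‖b‖ ≠ 0 := norm_ne_zero_iff.mpr hb
  have h : (a • X) 0 * (b • Y) 1 - (a • X) 1 * (b • Y) 0
      = (a * b) * (X 0 * Y 1 - X 1 * Y 0) := by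
    simp only [PiLp.smul_apply, smul_eq_mul]
    ring
  unfold chordal
  rw [h, norm_mul, norm_mul, norm_smul, norm_smul,
    show ‖a‖ * ‖X‖ * (‖b‖ * ‖Y‖) = (‖a‖ * ‖b‖) * (‖X‖ * ‖Y‖) by ring,
    mul_div_mul_left _ _ (mul_ne_zero ha' hb')]

lemma sphDist_mk (X Y : EuclideanSpace ℂ (Fin 2)) (hX : X ≠ 0) (hY : Y ≠ 0) :
    sphDist (Projectivization.mk ℂ X hX) (Projectivization.mk ℂ Y hY) = chordal X Y := by
  obtain ⟨a, ha⟩ := Projectivization.exists_smul_eq_mk_rep ℂ X hX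
  obtain ⟨b, hb⟩ := Projectivization.exists_smul_eq_mk_rep ℂ Y hY
  unfold sphDist
  rw [← ha, ← hb]
  exact chordal_smul (a : ℂ) (b : ℂ) a.ne_zero b.ne_zero X Y

lemma vec_fst_ne_zero (z : ℂ) : (!₂[(1 : ℂ), z] : EuclideanSpace ℂ (Fin 2)) ≠ 0 := fun h => by
  simpa using congrArg (fun v : EuclideanSpace ℂ (Fin 2) => v 0) h

lemma vec_snd_ne_zero (z : ℂ) : (!₂[z, (1 : ℂ)] : EuclideanSpace ℂ (Fin 2)) ≠ 0 := fun h => by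
  simpa using congrArg (fun v : EuclideanSpace ℂ (Fin 2) => v 1) h

/-- The affine chart `z ↦ [z : 1]`, onto the complement of `[1 : 0]`. -/
def affine (z : ℂ) : P1 := Projectivization.mk ℂ !₂[z, (1 : ℂ)] (vec_snd_ne_zero z)

/-- The chart at infinity `w ↦ [1 : w]`, onto the complement of `[0 : 1]`. -/
def atInfty (w : ℂ) : P1 := Projectivization.mk ℂ !₂[(1 : ℂ), w] (vec_fst_ne_zero w)

/-- Smooth real functions on the projective line: smooth in both charts. -/
def IsSmooth (ψ : P1 → ℝ) : Prop :=
  ContDiff ℝ ∞ (fun z => ψ (affine z)) ∧ ContDiff ℝ ∞ (fun w => ψ (atInfty w))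

/-! ### Potentials -/

/-- The Fubini--Study probability measure `ω`, with density `1 / (π (1 + |z|²)²)` in the affine
chart (the point at infinity is a null set). -/
def fubiniStudy : Measure P1 :=
  Measure.map affine
    ((volume : Measure ℂ).withDensity
      fun z => ENNReal.ofReal (1 / (Real.pi * (1 + ‖z‖ ^ 2) ^ 2)))

/-- `μ = ω + ddᶜ g` as distributions (currents of top degree) on the projective line, i.e.
`∫ ψ dμ = ∫ ψ dω + ∫ g ddᶜψ` for every smooth `ψ`. The operator `ddᶜ` is normalized by
`ddᶜ log |z| = δ₀`, that is `ddᶜψ = (2π)⁻¹ Δψ dx dy` in the affine chart; the smooth form `ddᶜψ`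
does not charge the point at infinity. -/
def HasPotential (μ : Measure P1) (g : P1 → ℝ) : Prop :=
  ∀ ψ : P1 → ℝ, IsSmooth ψ →
    ∫ x, ψ x ∂μ = (∫ x, ψ x ∂fubiniStudy) +
      (1 / (2 * Real.pi)) *
        ∫ z : ℂ, g (affine z) * Laplacian.laplacian (fun t => ψ (affine t)) z

/-- The Hsia kernel `Φ_g(x,y) = log d(x,y) - g(x) - g(y) ∈ ℝ ∪ {-∞}`; it is `-∞` exactly on the
diagonal. -/
def hsia (g : P1 → ℝ) (x y : P1) : EReal :=
  ENNReal.log (ENNReal.ofReal (sphDist x y)) - (g x : EReal) - (g y : EReal)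

/-- `g` is the good potential of `μ`: it is continuous, `μ = ω + ddᶜ g`, and `∬ Φ_g dμ dμ = 0`.
The last condition, on the integral of a function with values in `ℝ ∪ {-∞}`, means that the
function is almost everywhere finite, integrable, and of integral zero. -/
structure IsGoodPotential (μ : Measure P1) (g : P1 → ℝ) : Prop where
  continuous : Continuous g
  hasPotential : HasPotential μ g
  finite_ae : ∀ᵐ p ∂(μ.prod μ), hsia g p.1 p.2 ≠ ⊥
  integrable : Integrable (fun p : P1 × P1 => (hsia g p.1 p.2).toReal) (μ.prod μ)
  energy_eq_zero : ∫ p : P1 × P1, (hsia g p.1 p.2).toReal ∂(μ.prod μ) = 0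

open Classical in
/-- A finite set `F` with `n ≥ 2` points is a quasi-`g`-Fekete configuration with constant `C` if
`∑_{x ≠ y ∈ F} Φ_g(x,y) ≥ - C n log n` (sum over ordered pairs of distinct points). -/
def IsQuasiFekete (g : P1 → ℝ) (C : ℝ) (F : Finset P1) : Prop :=
  2 ≤ F.card ∧
    ((-C * (F.card : ℝ) * Real.log (F.card : ℝ) : ℝ) : EReal) ≤ ∑ p ∈ F.offDiag, hsia g p.1 p.2

/-! ### Hölder functions -/

/-- `f` is `α`-Hölder continuous for the spherical distance. -/
def IsHolder (α : ℝ) (f : P1 → ℝ) : Prop :=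
  ∃ C : ℝ, 0 < C ∧ ∀ z w : P1, |f z - f w| ≤ C * sphDist z w ^ α

/-- The `C^{0,α}` semi-norm `sup_{x ≠ y} |f x - f y| / d(x,y)^α`. -/
def holderSeminorm (α : ℝ) (f : P1 → ℝ) : ℝ :=
  sSup {t : ℝ | ∃ x y : P1, x ≠ y ∧ t = |f x - f y| / sphDist x y ^ α}

/-! ### The Sobolev space `W^{1,2}` -/

/-- `G = ∂ₓu + i ∂ᵧu` is the weak gradient of `u` on the plane `ℂ = ℝ²`. -/
structure IsWeakGradient (u : ℂ → ℝ) (G : ℂ → ℂ) : Prop where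
  locallyIntegrable : LocallyIntegrable u
  locallyIntegrable_grad : LocallyIntegrable G
  integral_eq : ∀ ψ : ℂ → ℝ, ContDiff ℝ ∞ ψ → HasCompactSupport ψ → ∀ v : ℂ,
    ∫ z : ℂ, u z * fderiv ℝ ψ z v = - ∫ z : ℂ, inner ℝ (G z) v * ψ z

/-- `φ ∈ W^{1,2}`: `φ` is square-integrable, and in each of the two charts it has a weak gradient
that is square-integrable. (By conformal invariance of the Dirichlet integral in dimension two,
square-integrability of the gradient for the metric of the sphere is square-integrability for
Lebesgue measure in a chart.) -/
def MemW12 (φ : P1 → ℝ) : Prop :=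
  MemLp φ 2 fubiniStudy ∧
    (∃ G : ℂ → ℂ, IsWeakGradient (fun z => φ (affine z)) G ∧ MemLp G 2 volume) ∧
    (∃ G : ℂ → ℂ, IsWeakGradient (fun w => φ (atInfty w)) G ∧ MemLp G 2 volume)

open Classical in
/-- The weak gradient of `u` if it has one (unique almost everywhere, see
`IsWeakGradient.ae_eq`), and zero otherwise. -/
def weakGradient (u : ℂ → ℝ) : ℂ → ℂ :=
  if h : ∃ G : ℂ → ℂ, IsWeakGradient u G then h.choose else 0

/-- `‖∇φ‖_{L²} = (∫ dφ ∧ dᶜφ)^{1/2}`, where `dφ ∧ dᶜφ = (2π)⁻¹ |∇φ|² dx dy` in the affine chart. -/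
def gradNorm (φ : P1 → ℝ) : ℝ :=
  Real.sqrt ((1 / (2 * Real.pi)) * ∫ z : ℂ, ‖weakGradient (fun t => φ (affine t)) z‖ ^ 2)

/-- The semi-norm `‖φ‖_γ = ‖φ‖_{C^{0,γ}} + ‖∇φ‖_{L²}` on `W^{1,2} ∩ C^γ`. -/
def seminormW (γ : ℝ) (φ : P1 → ℝ) : ℝ := holderSeminorm γ φ + gradNorm φ

lemma IsWeakGradient.ae_eq {u : ℂ → ℝ} {G H : ℂ → ℂ} (hG : IsWeakGradient u G)
    (hH : IsWeakGradient u H) : G =ᵐ[volume] H := by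
  have key : ∀ v : ℂ, (fun z => inner ℝ (G z) v) =ᵐ[volume] fun z => inner ℝ (H z) v := by
    intro v
    have hGv : LocallyIntegrable (fun z => inner ℝ (G z) v) := fun x => by
      obtain ⟨s, hs, h⟩ := hG.locallyIntegrable_grad x
      exact ⟨s, hs, h.inner_const v⟩
    have hHv : LocallyIntegrable (fun z => inner ℝ (H z) v) := fun x => by
      obtain ⟨s, hs, h⟩ := hH.locallyIntegrable_grad x
      exact ⟨s, hs, h.inner_const v⟩
    refine ae_eq_of_integral_contDiff_smul_eq hGv hHv fun ψ hψ hc => ?_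
    have h := (hG.integral_eq ψ hψ hc v).symm.trans (hH.integral_eq ψ hψ hc v)
    simpa only [smul_eq_mul, mul_comm] using neg_injective h
  filter_upwards [key 1, key Complex.I] with z h1 h2
  apply Complex.ext
  · simpa using h1
  · simpa using h2

end QuasiFekete

end

/-! The statement is an energy estimate. If two probability measures `ν`, `μ` on the plane satisfy
`ν - μ = ddᶜ h` with `h` continuous up to infinity, then integration by parts and Cauchy–Schwarz
bound the square of `∫ φ dν - ∫ φ dμ` by the squared Dirichlet norm of `φ` times `-∫ h d(ν - μ)`
(`IsPlanarPotential.energy_inequality`). Mollification and a cut-off at large scale justify the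
integration by parts, because `φ` is only weakly differentiable and `h` only continuous.

The empirical measure of `F` has infinite energy, so each point is smeared at a scale `a`: its Dirac
mass is replaced by the image of Fubini–Study under the dilation of ratio `a` followed by a unitary
Möbius map (`chi`, `blob`). Relative to Fubini–Study this measure has the explicit smooth potential
`1/2 log((1 - a²) d² + a²)` (`laplacian_regLog`). Smearing is cheap. It moves the mean of a
`γ`-Hölder function by at most `2 a^γ` times its seminorm (`IsHolder.abs_integral_blob_sub_le`). The
self-energy of a smeared point is at least `log a`. The mutual energy of two smeared points is at
least `log d(x,y) - a`, by Jensen's formula (`le_integral_regLog_chi`).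

On the side of `μ`, testing `μ = ω + ddᶜ g` against the regularized kernel and letting `a` tend to
`0` turns the normalization of the good potential into `∫ g dμ = -1/2 - ∫ g dω`
(`IsGoodPotential.integral_eq`). When the energy of the smeared configuration minus `μ` is expanded,
these constants cancel, and the quasi-Fekete inequality leaves `(C' log n - log a) / n` plus Hölder
errors (`IsQuasiFekete.energy_le`).

The scale is `a = n^(-M)` with `M = max 2 (1/α)`. Then `-log a = M log n`, which accounts for the
last term of the constant, while the remaining errors have order `1/n` and fit in `(2‖g‖ + 1) log n
/ n` once `n` is large compared with `log n` (`error_le_log`). For the other `n` the oscillation of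
`φ` already gives the bound.

All the analysis takes place in the affine chart: the energy condition excludes atoms, so `μ` does
not charge the point at infinity. -/

noncomputable section

namespace QuasiFekete

open Filter Topology InnerProductSpace

/-! ### Planar calculus -/

/-- The derivative of `f` in the direction `v`. -/
def pd (v : ℂ) (f : ℂ → ℝ) (z : ℂ) : ℝ := fderiv ℝ f z v

lemma contDiff_pd {f : ℂ → ℝ} (hf : ContDiff ℝ ∞ f) (v : ℂ) : ContDiff ℝ ∞ (pd v f) :=
  (hf.fderiv_right (m := ∞) (by simp)).clm_apply contDiff_const

lemma hasCompactSupport_pd {f : ℂ → ℝ} (hf : HasCompactSupport f) (v : ℂ) :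
    HasCompactSupport (pd v f) :=
  hf.fderiv_apply (𝕜 := ℝ) v

lemma differentiable_of_smooth {f : ℂ → ℝ} (hf : ContDiff ℝ ∞ f) : Differentiable ℝ f :=
  hf.differentiable (by simp)

lemma pd_mul {f g : ℂ → ℝ} (hf : ContDiff ℝ ∞ f) (hg : ContDiff ℝ ∞ g) (v z : ℂ) :
    pd v (fun t => f t * g t) z = f z * pd v g z + pd v f z * g z := by
  unfold pd
  rw [fderiv_fun_mul (differentiable_of_smooth hf z) (differentiable_of_smooth hg z)]
  simp [mul_comm]

lemma pd_sub {f g : ℂ → ℝ} (hf : ContDiff ℝ ∞ f) (hg : ContDiff ℝ ∞ g) (v z : ℂ) :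
    pd v (fun t => f t - g t) z = pd v f z - pd v g z := by
  unfold pd
  rw [fderiv_fun_sub (differentiable_of_smooth hf z) (differentiable_of_smooth hg z)]
  simp

lemma laplacian_eq_pd {f : ℂ → ℝ} (hf : ContDiff ℝ ∞ f) (z : ℂ) :
    Laplacian.laplacian f z = pd 1 (pd 1 f) z + pd Complex.I (pd Complex.I f) z := by
  have h : ∀ v : ℂ, iteratedFDeriv ℝ 2 f z ![v, v] = pd v (pd v f) z := by
    intro v
    rw [iteratedFDeriv_two_apply]
    have hd : DifferentiableAt ℝ (fderiv ℝ f) z :=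
      ((hf.fderiv_right (m := ∞) (by simp)).differentiable (by simp)) z
    change _ = fderiv ℝ (fun t => fderiv ℝ f t v) z v
    rw [fderiv_clm_apply hd (differentiableAt_const v)]
    simp
  rw [laplacian_eq_iteratedFDeriv_complexPlane]
  simp [h]

lemma continuous_laplacian {f : ℂ → ℝ} (hf : ContDiff ℝ ∞ f) :
    Continuous (fun z => Laplacian.laplacian f z) := by
  simp only [laplacian_eq_pd hf]
  exact ((contDiff_pd (contDiff_pd hf _) _).add (contDiff_pd (contDiff_pd hf _) _)).continuous

lemma hasCompactSupport_laplacian {f : ℂ → ℝ} (hf : ContDiff ℝ ∞ f) (hc : HasCompactSupport f) :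
    HasCompactSupport (fun z => Laplacian.laplacian f z) := by
  simp only [laplacian_eq_pd hf]
  exact (hasCompactSupport_pd (hasCompactSupport_pd hc _) _).add
    (hasCompactSupport_pd (hasCompactSupport_pd hc _) _)

lemma inner_one_right (G : ℂ) : inner ℝ G (1 : ℂ) = G.re := by
  simp

lemma inner_I_right (G : ℂ) : inner ℝ G Complex.I = G.im := by
  simp

lemma LocallyIntegrable.re {G : ℂ → ℂ} (hG : LocallyIntegrable G) :
    LocallyIntegrable (fun z => (G z).re) := fun x => by
  obtain ⟨s, hs, h⟩ := hG x
  exact ⟨s, hs, h.re⟩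

lemma LocallyIntegrable.im {G : ℂ → ℂ} (hG : LocallyIntegrable G) :
    LocallyIntegrable (fun z => (G z).im) := fun x => by
  obtain ⟨s, hs, h⟩ := hG x
  exact ⟨s, hs, h.im⟩

lemma integrable_mul_of_hasCompactSupport {u f : ℂ → ℝ} (hu : LocallyIntegrable u)
    (hf : Continuous f) (hc : HasCompactSupport f) : Integrable (fun z => u z * f z) := by
  simpa only [smul_eq_mul, mul_comm] using
    hu.integrable_smul_left_of_hasCompactSupport hf hc

/-- The divergence form of the definition of a weak gradient. -/
lemma IsWeakGradient.integral_div {u : ℂ → ℝ} {G : ℂ → ℂ} (h : IsWeakGradient u G)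
    {a b : ℂ → ℝ} (ha : ContDiff ℝ ∞ a) (hb : ContDiff ℝ ∞ b) (hac : HasCompactSupport a)
    (hbc : HasCompactSupport b) :
    ∫ z, u z * (pd 1 a z + pd Complex.I b z) = -∫ z, ((G z).re * a z + (G z).im * b z) := by
  have h1 := h.integral_eq a ha hac 1
  have h2 := h.integral_eq b hb hbc Complex.I
  simp only [inner_one_right, inner_I_right] at h1 h2
  have i1 := integrable_mul_of_hasCompactSupport h.locallyIntegrable
    (contDiff_pd ha 1).continuous (hasCompactSupport_pd hac 1)
  have i2 := integrable_mul_of_hasCompactSupport h.locallyIntegrable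
    (contDiff_pd hb Complex.I).continuous (hasCompactSupport_pd hbc Complex.I)
  have j1 := integrable_mul_of_hasCompactSupport (LocallyIntegrable.re h.locallyIntegrable_grad)
    ha.continuous hac
  have j2 := integrable_mul_of_hasCompactSupport (LocallyIntegrable.im h.locallyIntegrable_grad)
    hb.continuous hbc
  simp only [mul_add]
  rw [integral_add i1 i2, integral_add j1 j2]
  unfold pd
  linarith

/-- The gradient of a smooth function as a complex valued function. -/
def grad (f : ℂ → ℝ) (z : ℂ) : ℂ := ⟨pd 1 f z, pd Complex.I f z⟩

lemma continuous_grad {f : ℂ → ℝ} (hf : ContDiff ℝ ∞ f) : Continuous (grad f) := by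
  have : grad f = fun z => ((pd 1 f z : ℝ) : ℂ) + ((pd Complex.I f z : ℝ) : ℂ) * Complex.I := by
    ext z
    exact Complex.mk_eq_add_mul_I _ _
  rw [this]
  have h1 := (contDiff_pd hf 1).continuous
  have h2 := (contDiff_pd hf Complex.I).continuous
  fun_prop

lemma inner_grad (f : ℂ → ℝ) (z v : ℂ) : inner ℝ (grad f z) v = fderiv ℝ f z v := by
  have hv : v = v.re • (1 : ℂ) + v.im • Complex.I := by
    simp [Complex.re_add_im]
  conv_rhs => rw [hv, map_add, map_smul, map_smul]
  conv_lhs => rw [hv, inner_add_right, inner_smul_right, inner_smul_right, inner_one_right,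
    inner_I_right]
  rfl

/-- With this, the identities for weak gradients also serve when both functions are smooth. -/
lemma isWeakGradient_grad {f : ℂ → ℝ} (hf : ContDiff ℝ ∞ f) : IsWeakGradient f (grad f) where
  locallyIntegrable := hf.continuous.locallyIntegrable
  locallyIntegrable_grad := (continuous_grad hf).locallyIntegrable
  integral_eq ψ hψ hc v := by
    simp only [inner_grad]
    refine integral_mul_fderiv_eq_neg_fderiv_mul_of_integrable ?_ ?_ ?_
      (fun x _ => differentiable_of_smooth hf x) (fun x _ => differentiable_of_smooth hψ x)
    · exact integrable_mul_of_hasCompactSupport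
        (contDiff_pd hf v).continuous.locallyIntegrable hψ.continuous hc
    · exact integrable_mul_of_hasCompactSupport hf.continuous.locallyIntegrable
        (contDiff_pd hψ v).continuous (hasCompactSupport_pd hc v)
    · exact integrable_mul_of_hasCompactSupport hf.continuous.locallyIntegrable hψ.continuous hc

/-- Green's formula with a cut-off `η`, one of the functions being only weakly differentiable. -/
lemma IsWeakGradient.green {u : ℂ → ℝ} {G : ℂ → ℂ} (h : IsWeakGradient u G) {k η : ℂ → ℝ}
    (hk : ContDiff ℝ ∞ k) (hη : ContDiff ℝ ∞ η) (hc : HasCompactSupport η) :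
    ∫ z, η z * ((G z).re * pd 1 k z + (G z).im * pd Complex.I k z) =
      -(∫ z, u z * η z * Laplacian.laplacian k z) + (∫ z, u z * k z * Laplacian.laplacian η z)
      + ∫ z, k z * ((G z).re * pd 1 η z + (G z).im * pd Complex.I η z) := by
  -- The field `η ∇k - k ∇η` is used because the terms `∇η · ∇k` cancel in its divergence, which is
  -- `η Δk - k Δη`.
  have hA : ∀ v, ContDiff ℝ ∞ (fun t => η t * pd v k t - k t * pd v η t) := fun v =>
    (hη.mul (contDiff_pd hk v)).sub (hk.mul (contDiff_pd hη v))
  have hAc : ∀ v, HasCompactSupport (fun t => η t * pd v k t - k t * pd v η t) := fun v =>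
    (hc.mul_right).sub ((hasCompactSupport_pd hc v).mul_left)
  have key := h.integral_div (hA 1) (hA Complex.I) (hAc 1) (hAc Complex.I)
  have hdiv : ∀ z, pd 1 (fun t => η t * pd 1 k t - k t * pd 1 η t) z
      + pd Complex.I (fun t => η t * pd Complex.I k t - k t * pd Complex.I η t) z
      = η z * Laplacian.laplacian k z - k z * Laplacian.laplacian η z := by
    intro z
    rw [pd_sub (hη.mul (contDiff_pd hk _)) (hk.mul (contDiff_pd hη _)),
      pd_sub (hη.mul (contDiff_pd hk _)) (hk.mul (contDiff_pd hη _)),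
      pd_mul hη (contDiff_pd hk _), pd_mul hη (contDiff_pd hk _), pd_mul hk (contDiff_pd hη _),
      pd_mul hk (contDiff_pd hη _), laplacian_eq_pd hk, laplacian_eq_pd hη]
    ring
  simp only [hdiv] at key
  have lre := LocallyIntegrable.re h.locallyIntegrable_grad
  have lim := LocallyIntegrable.im h.locallyIntegrable_grad
  have hpk := fun v => (contDiff_pd hk v).continuous
  have hpη := fun v => (contDiff_pd hη v).continuous
  have i1 : Integrable (fun z => u z * η z * Laplacian.laplacian k z) := by
    simp only [mul_assoc]
    exact integrable_mul_of_hasCompactSupport h.locallyIntegrable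
      (hη.continuous.mul (continuous_laplacian hk)) hc.mul_right
  have i2 : Integrable (fun z => u z * k z * Laplacian.laplacian η z) := by
    simp only [mul_assoc]
    exact integrable_mul_of_hasCompactSupport h.locallyIntegrable
      (hk.continuous.mul (continuous_laplacian hη)) (hasCompactSupport_laplacian hη hc).mul_left
  have j1 : Integrable
      (fun z => η z * ((G z).re * pd 1 k z + (G z).im * pd Complex.I k z)) := by
    have := (integrable_mul_of_hasCompactSupport lre (hη.continuous.mul (hpk 1)) hc.mul_right).add
      (integrable_mul_of_hasCompactSupport lim (hη.continuous.mul (hpk Complex.I)) hc.mul_right)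
    refine this.congr (ae_of_all _ fun z => ?_)
    simp only [Pi.add_apply, Pi.mul_apply]
    ring
  have j2 : Integrable
      (fun z => k z * ((G z).re * pd 1 η z + (G z).im * pd Complex.I η z)) := by
    have := (integrable_mul_of_hasCompactSupport lre (hk.continuous.mul (hpη 1))
        (hasCompactSupport_pd hc 1).mul_left).add
      (integrable_mul_of_hasCompactSupport lim (hk.continuous.mul (hpη Complex.I))
        (hasCompactSupport_pd hc Complex.I).mul_left)
    refine this.congr (ae_of_all _ fun z => ?_)
    simp only [Pi.add_apply, Pi.mul_apply]
    ring
  have e1 : ∫ z, u z * (η z * Laplacian.laplacian k z - k z * Laplacian.laplacian η z)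
      = (∫ z, u z * η z * Laplacian.laplacian k z) - ∫ z, u z * k z * Laplacian.laplacian η z := by
    rw [← integral_sub i1 i2]
    congr 1 with z
    ring
  have e2 : ∫ z, ((G z).re * (η z * pd 1 k z - k z * pd 1 η z)
        + (G z).im * (η z * pd Complex.I k z - k z * pd Complex.I η z))
      = (∫ z, η z * ((G z).re * pd 1 k z + (G z).im * pd Complex.I k z))
        - ∫ z, k z * ((G z).re * pd 1 η z + (G z).im * pd Complex.I η z) := by
    rw [← integral_sub j1 j2]
    congr 1 with z
    ring
  rw [e1, e2] at key
  linarith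

/-- The localized Dirichlet integral of a smooth function. -/
lemma integral_cutoff_grad_sq {k η : ℂ → ℝ} (hk : ContDiff ℝ ∞ k) (hη : ContDiff ℝ ∞ η)
    (hc : HasCompactSupport η) :
    ∫ z, η z * (pd 1 k z ^ 2 + pd Complex.I k z ^ 2) =
      -(∫ z, k z * η z * Laplacian.laplacian k z)
      + (1 / 2) * ∫ z, k z ^ 2 * Laplacian.laplacian η z := by
  have h1 := (isWeakGradient_grad hk).green hk hη hc
  -- Testing `k²` against the field `∇η` rewrites the cross term `∫ k ∇k · ∇η` as `-1/2 ∫ k² Δη`.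
  have h2 := (isWeakGradient_grad (hk.mul hk)).integral_div (contDiff_pd hη 1)
    (contDiff_pd hη Complex.I) (hasCompactSupport_pd hc 1) (hasCompactSupport_pd hc Complex.I)
  simp only [← laplacian_eq_pd hη] at h2
  simp only [grad, pd_mul hk hk] at h1 h2
  have e : ∫ z, ((k z * pd 1 k z + pd 1 k z * k z) * pd 1 η z
      + (k z * pd Complex.I k z + pd Complex.I k z * k z) * pd Complex.I η z)
      = 2 * ∫ z, k z * (pd 1 k z * pd 1 η z + pd Complex.I k z * pd Complex.I η z) := by
    rw [← integral_const_mul]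
    congr 1 with z
    ring
  rw [e] at h2
  simp only [← sq] at h1 h2
  linarith

/-- Green's formula for a smooth and a test function. -/
lemma integral_mul_laplacian_comm {k η : ℂ → ℝ} (hk : ContDiff ℝ ∞ k) (hη : ContDiff ℝ ∞ η)
    (hc : HasCompactSupport η) :
    ∫ z, k z * Laplacian.laplacian η z = ∫ z, η z * Laplacian.laplacian k z := by
  have h1 := (isWeakGradient_grad (contDiff_const (c := (1 : ℝ)))).green hk hη hc
  have h0 : ∀ v z, pd v (fun _ : ℂ => (1 : ℝ)) z = 0 := fun v z => by simp [pd]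
  simp only [grad, h0, one_mul, zero_mul, add_zero, mul_zero, integral_zero] at h1
  linarith

end QuasiFekete

end

noncomputable section

namespace QuasiFekete

open Filter Topology InnerProductSpace
open scoped Convolution

/-! ### Mollification -/

/-- The standard mollifiers. -/
def bump (j : ℕ) : ContDiffBump (0 : ℂ) :=
  ⟨1 / (2 * ((j : ℝ) + 1)), 1 / ((j : ℝ) + 1), by positivity,
    one_div_lt_one_div_of_lt (by positivity) (by linarith [(Nat.cast_nonneg j : (0 : ℝ) ≤ j)])⟩

lemma tendsto_bump_rOut : Tendsto (fun j => (bump j).rOut) atTop (𝓝 0) :=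
  tendsto_one_div_add_atTop_nhds_zero_nat

/-- The density of the standard mollifier. -/
def rho (j : ℕ) : ℂ → ℝ := (bump j).normed volume

lemma contDiff_rho (j : ℕ) : ContDiff ℝ ∞ (rho j) := (bump j).contDiff_normed

lemma hasCompactSupport_rho (j : ℕ) : HasCompactSupport (rho j) :=
  (bump j).hasCompactSupport_normed

lemma rho_neg (j : ℕ) (z : ℂ) : rho j (-z) = rho j z := (bump j).normed_neg z

/-- Mollification of a function. -/
def moll (j : ℕ) (h : ℂ → ℝ) : ℂ → ℝ := rho j ⋆[ContinuousLinearMap.lsmul ℝ ℝ, volume] h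

lemma moll_apply (j : ℕ) (h : ℂ → ℝ) (z : ℂ) : moll j h z = ∫ w, h w * rho j (z - w) := by
  unfold moll
  rw [convolution_lsmul_swap]
  simp [mul_comm]

lemma moll_eq (j : ℕ) (h : ℂ → ℝ) :
    moll j h = h ⋆[ContinuousLinearMap.mul ℝ ℝ, volume] rho j := by
  ext z
  rw [moll_apply]
  rfl

lemma pd_convolution {h r : ℂ → ℝ} (hh : Continuous h) (hr : ContDiff ℝ ∞ r)
    (hc : HasCompactSupport r) (v z : ℂ) :
    pd v (h ⋆[ContinuousLinearMap.mul ℝ ℝ, volume] r) z =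
      (h ⋆[ContinuousLinearMap.mul ℝ ℝ, volume] (pd v r)) z := by
  unfold pd
  rw [(hc.hasFDerivAt_convolution_right (ContinuousLinearMap.mul ℝ ℝ) hh.locallyIntegrable
    (hr.of_le (by simp)) z).fderiv]
  exact convolution_precompR_apply (L := ContinuousLinearMap.mul ℝ ℝ) hh.locallyIntegrable
    (hc.fderiv (𝕜 := ℝ)) (hr.continuous_fderiv (by simp)) z v

lemma contDiff_moll (j : ℕ) {h : ℂ → ℝ} (hh : Continuous h) : ContDiff ℝ ∞ (moll j h) := by
  rw [moll_eq]
  exact (hasCompactSupport_rho j).contDiff_convolution_right _ hh.locallyIntegrable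
    (contDiff_rho j)

lemma pd_comp_const_sub {r : ℂ → ℝ} (hr : ContDiff ℝ ∞ r) (v a z : ℂ) :
    pd v (fun w => r (a - w)) z = -pd v r (a - z) := by
  unfold pd
  have h1 : HasFDerivAt (fun w : ℂ => a - w) (-(ContinuousLinearMap.id ℝ ℂ)) z :=
    (hasFDerivAt_id z).const_sub a
  have h2 : HasFDerivAt (fun w => r (a - w)) _ z :=
    (differentiable_of_smooth hr (a - z)).hasFDerivAt.comp z h1
  rw [h2.fderiv]
  simp

lemma laplacian_comp_const_sub {r : ℂ → ℝ} (hr : ContDiff ℝ ∞ r) (a z : ℂ) :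
    Laplacian.laplacian (fun w => r (a - w)) z =
      pd 1 (pd 1 r) (a - z) + pd Complex.I (pd Complex.I r) (a - z) := by
  have hs : ContDiff ℝ ∞ (fun w => r (a - w)) := hr.comp (contDiff_const.sub contDiff_id)
  have h : ∀ v, pd v (pd v (fun w => r (a - w))) z = pd v (pd v r) (a - z) := by
    intro v
    have e : pd v (fun w => r (a - w)) = fun w => (fun t => -pd v r t) (a - w) := by
      ext w
      exact pd_comp_const_sub hr v a w
    rw [e, pd_comp_const_sub (contDiff_pd hr v).neg, pd, fderiv_fun_neg]
    simp only [neg_apply, neg_neg]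
    rfl
  rw [laplacian_eq_pd hs, h, h]

/-- All derivatives fall on the mollifier, so `h` need only be continuous. The right side has the
form in which the distributional equation for `h` can be tested against a translate of `rho j`. -/
lemma laplacian_moll (j : ℕ) {h : ℂ → ℝ} (hh : Continuous h) (z : ℂ) :
    Laplacian.laplacian (moll j h) z =
      ∫ w, h w * Laplacian.laplacian (fun t => rho j (z - t)) w := by
  have hr := contDiff_rho j
  have hc := hasCompactSupport_rho j
  have h2 : ∀ v, pd v (pd v (moll j h)) z =
      ∫ w, h w * pd v (pd v (rho j)) (z - w) := by
    intro v
    have e : pd v (moll j h) = h ⋆[ContinuousLinearMap.mul ℝ ℝ, volume] (pd v (rho j)) := by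
      ext w
      rw [moll_eq]
      exact pd_convolution hh hr hc v w
    rw [e, pd_convolution hh (contDiff_pd hr v) (hasCompactSupport_pd hc v)]
    rfl
  have hi : ∀ v, Integrable (fun w => h w * pd v (pd v (rho j)) (z - w)) := fun v =>
    integrable_mul_of_hasCompactSupport hh.locallyIntegrable
      ((contDiff_pd (contDiff_pd hr v) v).continuous.comp (continuous_const.sub continuous_id))
      ((hasCompactSupport_pd (hasCompactSupport_pd hc v) v).comp_homeomorph
        (Homeomorph.subLeft z))
  rw [laplacian_eq_pd (contDiff_moll j hh), h2, h2, ← integral_add (hi _) (hi _)]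
  simp only [laplacian_comp_const_sub hr, mul_add]

lemma dist_moll_le (j : ℕ) {h : ℂ → ℝ} (hh : Continuous h) {z : ℂ} {ε : ℝ}
    (H : ∀ x ∈ Metric.ball z (bump j).rOut, dist (h x) (h z) ≤ ε) :
    dist (moll j h z) (h z) ≤ ε :=
  ContDiffBump.dist_normed_convolution_le hh.aestronglyMeasurable H

lemma tendstoUniformly_moll {h : ℂ → ℝ} (hh : UniformContinuous h) :
    TendstoUniformly (fun j => moll j h) h atTop := by
  rw [Metric.tendstoUniformly_iff]
  intro ε hε
  obtain ⟨δ, hδ, H⟩ := Metric.uniformContinuous_iff.mp hh (ε / 2) (by positivity)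
  filter_upwards [tendsto_bump_rOut.eventually (gt_mem_nhds hδ)] with j hj z
  rw [dist_comm]
  refine (dist_moll_le j hh.continuous (ε := ε / 2) fun x hx => ?_).trans_lt (by linarith)
  exact (H ((Metric.mem_ball.mp hx).trans hj)).le

lemma abs_moll_le (j : ℕ) {h : ℂ → ℝ} {M : ℝ} (hh : Continuous h) (hM : ∀ z, |h z| ≤ M) (z : ℂ) :
    |moll j h z| ≤ M := by
  have hM0 : 0 ≤ M := (abs_nonneg _).trans (hM 0)
  have := dist_convolution_le (f := rho j) (g := h) (x₀ := z) (z₀ := (0 : ℝ)) (μ := volume)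
    (R := (bump j).rOut) hM0 (bump j).support_normed_eq.subset (bump j).nonneg_normed
    (bump j).integral_normed hh.aestronglyMeasurable (fun x _ => by simpa using hM x)
  simpa [moll] using this

/-- The mollified and cut-off functions, integrated against a probability measure. -/
lemma tendsto_integral_moll (χ : Measure ℂ) [IsProbabilityMeasure χ] {u : ℕ → ℂ → ℝ} {u₀ : ℂ → ℝ}
    {M : ℝ} (hc : ∀ j, Continuous (u j)) (hM : ∀ j z, |u j z| ≤ M)
    (hl : ∀ x, Tendsto (Function.uncurry u) (atTop ×ˢ 𝓝 x) (𝓝 (u₀ x))) :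
    Tendsto (fun j => ∫ x, moll j (u j) x ∂χ) atTop (𝓝 (∫ x, u₀ x ∂χ)) := by
  refine tendsto_integral_of_dominated_convergence (fun _ => M)
    (fun j => (contDiff_moll j (hc j)).continuous.aestronglyMeasurable) (integrable_const _)
    (fun j => ae_of_all _ fun z => abs_moll_le j (hc j) (hM j) z) (ae_of_all _ fun z => ?_)
  exact ContDiffBump.convolution_tendsto_right tendsto_bump_rOut
    (Eventually.of_forall fun j => (hc j).aestronglyMeasurable) (hl z) tendsto_const_nhds

/-! ### Cut-off functions -/

/-- The cut-off at scale one. -/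
def cutoffOne : ContDiffBump (0 : ℂ) := ⟨1, 2, one_pos, one_lt_two⟩

/-- The cut-off at scale `j + 1`. -/
def cutoff (j : ℕ) (z : ℂ) : ℝ := cutoffOne ((((j : ℝ) + 1)⁻¹) • z)

lemma contDiff_cutoff (j : ℕ) : ContDiff ℝ ∞ (cutoff j) :=
  cutoffOne.contDiff.comp (contDiff_const_smul _)

lemma hasCompactSupport_cutoff (j : ℕ) : HasCompactSupport (cutoff j) :=
  cutoffOne.hasCompactSupport.comp_homeomorph
    (Homeomorph.smulOfNeZero (((j : ℝ) + 1)⁻¹) (by positivity))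

lemma cutoff_nonneg (j : ℕ) (z : ℂ) : 0 ≤ cutoff j z := cutoffOne.nonneg

lemma cutoff_le_one (j : ℕ) (z : ℂ) : cutoff j z ≤ 1 := cutoffOne.le_one

lemma cutoff_eq_one {j : ℕ} {z : ℂ} (h : ‖z‖ ≤ j + 1) : cutoff j z = 1 := by
  refine cutoffOne.one_of_mem_closedBall ?_
  have hj : (0 : ℝ) < (j : ℝ) + 1 := by positivity
  rw [mem_closedBall_zero_iff, norm_smul, Real.norm_of_nonneg (by positivity)]
  change _ ≤ (1 : ℝ)
  rw [inv_mul_le_iff₀ hj]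
  linarith

lemma pd_comp_smul (f : ℂ → ℝ) (c : ℝ) (hf : Differentiable ℝ f) (v z : ℂ) :
    pd v (fun t => f (c • t)) z = c * pd v f (c • z) := by
  unfold pd
  have h1 : HasFDerivAt (fun w : ℂ => c • w) (c • (ContinuousLinearMap.id ℝ ℂ)) z :=
    (hasFDerivAt_id z).const_smul c
  have h2 : HasFDerivAt (fun w => f (c • w)) _ z := (hf (c • z)).hasFDerivAt.comp z h1
  rw [h2.fderiv]
  simp

lemma pd_cutoff (j : ℕ) (v z : ℂ) :
    pd v (cutoff j) z = ((j : ℝ) + 1)⁻¹ * pd v cutoffOne ((((j : ℝ) + 1)⁻¹) • z) :=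
  pd_comp_smul cutoffOne _ (differentiable_of_smooth cutoffOne.contDiff) v z

lemma laplacian_cutoff (j : ℕ) (z : ℂ) :
    Laplacian.laplacian (cutoff j) z =
      (((j : ℝ) + 1)⁻¹) ^ 2 * Laplacian.laplacian (cutoffOne : ℂ → ℝ) ((((j : ℝ) + 1)⁻¹) • z) := by
  have hs : ContDiff ℝ ∞ (cutoffOne : ℂ → ℝ) := cutoffOne.contDiff
  have h : ∀ v, pd v (pd v (cutoff j)) z =
      (((j : ℝ) + 1)⁻¹) ^ 2 * pd v (pd v cutoffOne) ((((j : ℝ) + 1)⁻¹) • z) := by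
    intro v
    have e : pd v (cutoff j) =
        fun z => (fun t => ((j : ℝ) + 1)⁻¹ * pd v cutoffOne t) ((((j : ℝ) + 1)⁻¹) • z) := by
      ext w
      exact pd_cutoff j v w
    have hd := differentiable_of_smooth (contDiff_pd hs v)
    rw [e, pd_comp_smul _ _ (hd.const_mul _)]
    have : pd v (fun t => ((j : ℝ) + 1)⁻¹ * pd v cutoffOne t) ((((j : ℝ) + 1)⁻¹) • z) =
        ((j : ℝ) + 1)⁻¹ * pd v (pd v cutoffOne) ((((j : ℝ) + 1)⁻¹) • z) := by
      rw [pd, fderiv_const_mul (hd _)]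
      rfl
    rw [this]
    ring
  rw [laplacian_eq_pd (contDiff_cutoff j), h, h, laplacian_eq_pd hs]
  ring

/-- Rescaled integrals of functions that vanish at infinity. -/
lemma tendsto_integral_rescale {F : ℕ → ℂ → ℝ} {ζ : ℂ → ℝ} {M : ℝ}
    (hF : ∀ j, Continuous (F j)) (hM : ∀ j z, |F j z| ≤ M)
    (hl : ∀ z ≠ 0, Tendsto (fun j : ℕ => F j (((j : ℝ) + 1) • z)) atTop (𝓝 0))
    (hζ : Continuous ζ) (hc : HasCompactSupport ζ) :
    Tendsto (fun j : ℕ => ∫ z, F j z * ((((j : ℝ) + 1)⁻¹) ^ 2 * ζ ((((j : ℝ) + 1)⁻¹) • z)))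
      atTop (𝓝 0) := by
  have e : ∀ j : ℕ, ∫ z, F j z * ((((j : ℝ) + 1)⁻¹) ^ 2 * ζ ((((j : ℝ) + 1)⁻¹) • z))
      = ∫ z, F j (((j : ℝ) + 1) • z) * ζ z := by
    intro j
    have hj : ((j : ℝ) + 1) ≠ 0 := by positivity
    -- In dimension two the factor `(j + 1)⁻²` is exactly the Jacobian, so scaling alone yields no
    -- decay; the limit is zero only because `F` vanishes along dilated points.
    have := Measure.integral_comp_smul (volume : Measure ℂ)
      (fun z => F j (((j : ℝ) + 1) • z) * ζ z) (((j : ℝ) + 1)⁻¹)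
    simp only [smul_smul, mul_inv_cancel₀ hj, one_smul, Complex.finrank_real_complex,
      smul_eq_mul] at this
    have h2 : ∫ z, F j z * ((((j : ℝ) + 1)⁻¹) ^ 2 * ζ ((((j : ℝ) + 1)⁻¹) • z)) =
        (((j : ℝ) + 1)⁻¹) ^ 2 * ∫ z, F j z * ζ ((((j : ℝ) + 1)⁻¹) • z) := by
      rw [← integral_const_mul]
      congr 1 with z
      ring
    rw [h2, this, abs_of_pos (by positivity), ← mul_assoc]
    field_simp
  simp only [e]
  have hi : Integrable ζ := hζ.integrable_of_hasCompactSupport hc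
  have h0 : ∫ _ : ℂ, (0 : ℝ) = 0 := integral_zero _ _
  rw [← h0]
  refine tendsto_integral_of_dominated_convergence (fun z => M * |ζ z|) (fun j => ?_)
    (hi.abs.const_mul M) (fun j => ae_of_all _ fun z => ?_) ?_
  · exact (((hF j).comp (continuous_const_smul _)).mul hζ).aestronglyMeasurable
  · rw [norm_mul]
    exact mul_le_mul_of_nonneg_right (hM j _) (norm_nonneg _)
  · have h1 : ∀ᵐ z : ℂ, z ≠ 0 := by
      simp [ae_iff]
    filter_upwards [h1] with z hz
    simpa using (hl z hz).mul_const (ζ z)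

lemma tendsto_smul_cocompact {z : ℂ} (hz : z ≠ 0) :
    Tendsto (fun j : ℕ => ((j : ℝ) + 1) • z) atTop (cocompact ℂ) := by
  refine tendsto_cocompact_of_tendsto_dist_comp_atTop 0 ?_
  simp only [dist_zero_right, norm_smul]
  refine Tendsto.atTop_mul_const (norm_pos_iff.mpr hz) ?_
  refine Tendsto.congr (f₁ := fun j : ℕ => (j : ℝ) + 1) (fun j => ?_)
    (tendsto_atTop_add_const_right _ _ tendsto_natCast_atTop_atTop)
  rw [Real.norm_of_nonneg (by positivity)]

/-- On a fixed neighbourhood of `x` the cut-off is identically one for large `j`. The joint form of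
the limit is what mollification of a varying sequence requires. -/
lemma tendsto_cutoff (x : ℂ) :
    Tendsto (Function.uncurry cutoff) (atTop ×ˢ 𝓝 x) (𝓝 1) := by
  refine tendsto_nhds_of_eventually_eq ?_
  obtain ⟨N, hN⟩ := exists_nat_gt (‖x‖ + 1)
  have h1 : ∀ᶠ y in 𝓝 x, ‖y‖ < ‖x‖ + 1 :=
    continuous_norm.continuousAt.eventually (gt_mem_nhds (by simp))
  filter_upwards [(eventually_ge_atTop N).prod_mk h1] with p hp
  refine cutoff_eq_one ?_
  have : (N : ℝ) ≤ p.1 := by exact_mod_cast hp.1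
  linarith [hp.2]

end QuasiFekete

end

noncomputable section

namespace QuasiFekete

open Filter Topology InnerProductSpace

/-! ### The energy inequality -/

/-- `2π` times the difference of two measures is the Laplacian of the function `h` on the plane. -/
def IsPlanarPotential (χ m : Measure ℂ) (h : ℂ → ℝ) : Prop :=
  ∀ ψ : ℂ → ℝ, ContDiff ℝ ∞ ψ → HasCompactSupport ψ →
    (∫ z, ψ z ∂χ) - ∫ z, ψ z ∂m = 1 / (2 * Real.pi) * ∫ z, h z * Laplacian.laplacian ψ z

/-- Testing the defining equation with `rho j (z - ·)` shows that the Laplacian of the mollified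
potential is the density of the mollified measure. -/
lemma IsPlanarPotential.laplacian_moll {χ m : Measure ℂ} {h : ℂ → ℝ}
    (H : IsPlanarPotential χ m h) (hh : Continuous h) (j : ℕ) (z : ℂ) :
    Laplacian.laplacian (moll j h) z =
      2 * Real.pi * ((∫ x, rho j (z - x) ∂χ) - ∫ x, rho j (z - x) ∂m) := by
  have hs : ContDiff ℝ ∞ (fun w => rho j (z - w)) :=
    (contDiff_rho j).comp (contDiff_const.sub contDiff_id)
  rw [QuasiFekete.laplacian_moll j hh, H _ hs
    ((hasCompactSupport_rho j).comp_homeomorph (Homeomorph.subLeft z))]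
  have := Real.pi_pos
  field_simp

/-- By Fubini and the evenness of `rho j`, mollification passes from the measure to the test
function. This makes sense for every probability measure, singular or not. -/
lemma integral_mul_integral_rho (χ : Measure ℂ) [IsProbabilityMeasure χ] {u : ℂ → ℝ}
    (hu : Continuous u) (hc : HasCompactSupport u) (j : ℕ) :
    Integrable (fun z => u z * ∫ x, rho j (z - x) ∂χ) ∧
    ∫ z, u z * ∫ x, rho j (z - x) ∂χ = ∫ x, moll j u x ∂χ := by
  obtain ⟨C, hC⟩ := (hasCompactSupport_rho j).exists_bound_of_continuous
    (contDiff_rho j).continuous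
  have hi : Integrable (fun p : ℂ × ℂ => u p.1 * rho j (p.1 - p.2))
      ((volume : Measure ℂ).prod χ) := by
    have h1 : Integrable (fun p : ℂ × ℂ => u p.1 * (1 : ℝ)) ((volume : Measure ℂ).prod χ) :=
      (hu.integrable_of_hasCompactSupport hc).mul_prod (integrable_const (1 : ℝ))
    have h2 := h1.bdd_mul (c := C) (f := fun p : ℂ × ℂ => rho j (p.1 - p.2))
      ((contDiff_rho j).continuous.comp
        (continuous_fst.sub continuous_snd)).aestronglyMeasurable
      (ae_of_all _ fun p => hC _)
    refine h2.congr (ae_of_all _ fun p => ?_)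
    simp [mul_comm]
  constructor
  · have := hi.integral_prod_left
    simpa only [integral_const_mul] using this
  · have := integral_integral_swap (f := fun z x => u z * rho j (z - x)) hi
    simp only [integral_const_mul] at this
    rw [this]
    congr 1 with x
    rw [moll_apply]
    congr 1 with z
    rw [← rho_neg j (z - x), neg_sub]

lemma IsPlanarPotential.integral_mul_laplacian_moll {χ m : Measure ℂ} [IsProbabilityMeasure χ]
    [IsProbabilityMeasure m] {h : ℂ → ℝ} (H : IsPlanarPotential χ m h) (hh : Continuous h)
    {u : ℂ → ℝ} (hu : Continuous u) (hc : HasCompactSupport u) (j : ℕ) :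
    ∫ z, u z * Laplacian.laplacian (moll j h) z =
      2 * Real.pi * ((∫ x, moll j u x ∂χ) - ∫ x, moll j u x ∂m) := by
  obtain ⟨i1, e1⟩ := integral_mul_integral_rho χ hu hc j
  obtain ⟨i2, e2⟩ := integral_mul_integral_rho m hu hc j
  rw [← e1, ← e2, ← integral_sub i1 i2, ← integral_const_mul]
  congr 1 with z
  rw [H.laplacian_moll hh]
  ring

lemma tendsto_uncurry_of_tendstoUniformly {k : ℕ → ℂ → ℝ} {h : ℂ → ℝ} (hh : Continuous h)
    (hk : TendstoUniformly k h atTop) (x : ℂ) :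
    Tendsto (Function.uncurry k) (atTop ×ˢ 𝓝 x) (𝓝 (h x)) := by
  rw [Metric.tendsto_nhds]
  intro ε hε
  have h1 := Metric.tendstoUniformly_iff.mp hk (ε / 2) (by positivity)
  have h2 := Metric.tendsto_nhds.mp (hh.tendsto x) (ε / 2) (by positivity)
  filter_upwards [h1.prod_mk h2] with p hp
  calc dist (k p.1 p.2) (h x) ≤ dist (k p.1 p.2) (h p.2) + dist (h p.2) (h x) :=
        dist_triangle _ _ _
    _ < ε / 2 + ε / 2 := by
        refine add_lt_add ?_ hp.2
        rw [dist_comm]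
        exact hp.1 p.2
    _ = ε := by ring

lemma tendsto_of_tendstoUniformly_of_cocompact {k : ℕ → ℂ → ℝ} {h : ℂ → ℝ}
    (h0 : Tendsto h (cocompact ℂ) (𝓝 0)) (hk : TendstoUniformly k h atTop) {w : ℕ → ℂ}
    (hw : Tendsto w atTop (cocompact ℂ)) : Tendsto (fun j => k j (w j)) atTop (𝓝 0) := by
  rw [Metric.tendsto_nhds]
  intro ε hε
  have h1 := Metric.tendstoUniformly_iff.mp hk (ε / 2) (by positivity)
  have h2 := Metric.tendsto_nhds.mp (h0.comp hw) (ε / 2) (by positivity)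
  filter_upwards [h1, h2] with j hj1 hj2
  calc dist (k j (w j)) 0 ≤ dist (k j (w j)) (h (w j)) + dist (h (w j)) 0 :=
        dist_triangle _ _ _
    _ < ε / 2 + ε / 2 := by
        refine add_lt_add ?_ hj2
        rw [dist_comm]
        exact hj1 _
    _ = ε := by ring

/-- An elementary form of the Cauchy–Schwarz inequality. -/
lemma abs_integral_mul_inner_le {k : ℂ → ℝ} {G : ℂ → ℂ} {p q : ℂ → ℝ}
    (hG : Integrable (fun z => ‖G z‖ ^ 2))
    (hkp : Integrable (fun z => k z ^ 2 * (p z ^ 2 + q z ^ 2))) {s : ℝ} (hs : 0 < s) :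
    |∫ z, k z * ((G z).re * p z + (G z).im * q z)| ≤
      s / 2 * (∫ z, ‖G z‖ ^ 2) + 1 / (2 * s) * ∫ z, k z ^ 2 * (p z ^ 2 + q z ^ 2) := by
  rw [← integral_const_mul, ← integral_const_mul,
    ← integral_add (hG.const_mul _) (hkp.const_mul _)]
  refine norm_integral_le_of_norm_le (f := fun z => k z * ((G z).re * p z + (G z).im * q z))
    ((hG.const_mul _).add (hkp.const_mul _)) (ae_of_all _ fun z => ?_)
  have e : ‖G z‖ ^ 2 = (G z).re ^ 2 + (G z).im ^ 2 := by
    rw [Complex.sq_norm, Complex.normSq_apply]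
    ring
  simp only [Real.norm_eq_abs, e]
  set a := (G z).re
  set b := (G z).im
  have h1 : s / 2 * (a ^ 2 + b ^ 2) + 1 / (2 * s) * (k z ^ 2 * (p z ^ 2 + q z ^ 2))
      - k z * (a * p z + b * q z)
      = 1 / (2 * s) * ((s * a - k z * p z) ^ 2 + (s * b - k z * q z) ^ 2) := by
    field_simp
    ring
  have h2 : s / 2 * (a ^ 2 + b ^ 2) + 1 / (2 * s) * (k z ^ 2 * (p z ^ 2 + q z ^ 2))
      + k z * (a * p z + b * q z)
      = 1 / (2 * s) * ((s * a + k z * p z) ^ 2 + (s * b + k z * q z) ^ 2) := by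
    field_simp
    ring
  have h3 : 0 ≤ 1 / (2 * s) * ((s * a - k z * p z) ^ 2 + (s * b - k z * q z) ^ 2) := by positivity
  have h4 : 0 ≤ 1 / (2 * s) * ((s * a + k z * p z) ^ 2 + (s * b + k z * q z) ^ 2) := by positivity
  rw [abs_le]
  constructor <;> linarith

/-- The optimal weight is comparable to `√D`; adding `1 / (j + 1)` keeps it positive where `D`
vanishes. -/
lemma tendsto_zero_of_forall_le {E D : ℕ → ℝ} {A : ℝ} (hD0 : ∀ j, 0 ≤ D j)
    (hD : Tendsto D atTop (𝓝 0))
    (h : ∀ j s, 0 < s → |E j| ≤ s / 2 * A + 1 / (2 * s) * D j) : Tendsto E atTop (𝓝 0) := by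
  have hc : Tendsto (fun j : ℕ => 1 / ((j : ℝ) + 1)) atTop (𝓝 0) :=
    tendsto_one_div_add_atTop_nhds_zero_nat
  have hq : Tendsto (fun j => Real.sqrt (D j)) atTop (𝓝 0) := by
    simpa using hD.sqrt
  have hlim : Tendsto (fun j : ℕ => (Real.sqrt (D j) + 1 / ((j : ℝ) + 1)) / 2 * A +
      Real.sqrt (D j) / 2) atTop (𝓝 0) := by
    simpa using (((hq.add hc).div_const 2).mul_const A).add (hq.div_const 2)
  refine squeeze_zero_norm (fun j => (h j (Real.sqrt (D j) + 1 / ((j : ℝ) + 1))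
    (by positivity)).trans ?_) hlim
  refine add_le_add le_rfl ?_
  have hs : 0 < Real.sqrt (D j) + 1 / ((j : ℝ) + 1) := by positivity
  rw [div_mul_eq_mul_div, one_mul, div_le_div_iff₀ (by positivity) two_pos]
  have h1 : D j = Real.sqrt (D j) * Real.sqrt (D j) := (Real.mul_self_sqrt (hD0 j)).symm
  have h2 : 0 ≤ Real.sqrt (D j) * (1 / ((j : ℝ) + 1)) := by positivity
  nlinarith

lemma integrable_mul_inner {η : ℂ → ℝ} (hη : Continuous η) (hc : HasCompactSupport η)
    {G : ℂ → ℂ} (hG : LocallyIntegrable G) {p q : ℂ → ℝ} (hp : Continuous p) (hq : Continuous q) :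
    Integrable (fun z => η z * ((G z).re * p z + (G z).im * q z)) := by
  have := (integrable_mul_of_hasCompactSupport (LocallyIntegrable.re hG) (hη.mul hp)
    hc.mul_right).add (integrable_mul_of_hasCompactSupport (LocallyIntegrable.im hG) (hη.mul hq)
    hc.mul_right)
  refine this.congr (ae_of_all _ fun z => ?_)
  simp only [Pi.add_apply, Pi.mul_apply]
  ring

/-- The energy inequality, for a potential vanishing at infinity. -/
theorem IsPlanarPotential.energy_inequality_of_zero {χ m : Measure ℂ} [IsProbabilityMeasure χ]
    [IsProbabilityMeasure m] {h φ : ℂ → ℝ} (H : IsPlanarPotential χ m h) (hh : Continuous h)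
    (hφ : Continuous φ) (h0 : Tendsto h (cocompact ℂ) (𝓝 0))
    {M : ℝ} (hM : ∀ z, |h z| ≤ M) (hφM : ∀ z, |φ z| ≤ M)
    {G : ℂ → ℂ} (hG : IsWeakGradient φ G) (hG2 : Integrable (fun z => ‖G z‖ ^ 2)) :
    ((∫ z, φ z ∂χ) - ∫ z, φ z ∂m) ^ 2 ≤
      1 / (2 * Real.pi) * (∫ z, ‖G z‖ ^ 2) * -((∫ z, h z ∂χ) - ∫ z, h z ∂m) := by
  have hM0 : 0 ≤ M := (abs_nonneg _).trans (hM 0)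
  set k : ℕ → ℂ → ℝ := fun j => moll j h with hkdef
  have hk : ∀ j, ContDiff ℝ ∞ (k j) := fun j => contDiff_moll j hh
  have hkM : ∀ j z, |k j z| ≤ M := fun j z => abs_moll_le j hh hM z
  have hkU : TendstoUniformly k h atTop :=
    tendstoUniformly_moll (hh.uniformContinuous_of_tendsto_cocompact h0)
  have hη : ∀ j, ContDiff ℝ ∞ (cutoff j) := contDiff_cutoff
  have hηc : ∀ j, HasCompactSupport (cutoff j) := hasCompactSupport_cutoff
  have habs : ∀ j z, |cutoff j z| ≤ 1 := fun j z => by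
    rw [abs_of_nonneg (cutoff_nonneg j z)]
    exact cutoff_le_one j z
  -- Once `Δ(k j)` is written through the mollified measures, this term becomes the difference of
  -- the integrals of `u₀`.
  have main : ∀ (u : ℕ → ℂ → ℝ) (u₀ : ℂ → ℝ), (∀ j, Continuous (u j)) → (∀ j z, |u j z| ≤ M) →
      (∀ x, Tendsto (Function.uncurry u) (atTop ×ˢ 𝓝 x) (𝓝 (u₀ x))) →
      Tendsto (fun j => ∫ z, u j z * cutoff j z * Laplacian.laplacian (k j) z) atTop
        (𝓝 (2 * Real.pi * ((∫ x, u₀ x ∂χ) - ∫ x, u₀ x ∂m))) := by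
    intro u u₀ huc huM hul
    have e : ∀ j, ∫ z, u j z * cutoff j z * Laplacian.laplacian (k j) z =
        2 * Real.pi * ((∫ x, moll j (fun z => u j z * cutoff j z) x ∂χ)
          - ∫ x, moll j (fun z => u j z * cutoff j z) x ∂m) := fun j =>
      H.integral_mul_laplacian_moll hh ((huc j).mul (hη j).continuous) (hηc j).mul_left j
    simp only [e]
    have hb : ∀ j z, |u j z * cutoff j z| ≤ M := fun j z => by
      rw [abs_mul]
      exact (mul_le_mul (huM j z) (habs j z) (abs_nonneg _) hM0).trans_eq (mul_one M)
    have hl : ∀ x, Tendsto (Function.uncurry fun j z => u j z * cutoff j z) (atTop ×ˢ 𝓝 x)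
        (𝓝 (u₀ x)) := fun x => by
      have h1 := (hul x).mul (tendsto_cutoff x)
      rw [mul_one] at h1
      exact h1
    exact ((tendsto_integral_moll χ (fun j => (huc j).mul (hη j).continuous) hb hl).sub
      (tendsto_integral_moll m (fun j => (huc j).mul (hη j).continuous) hb hl)).const_mul _
  -- The cut-off error lives at scale `j + 1`, where `k j` is small because `h` vanishes at infinity
  -- and the mollification converges uniformly.
  have err : ∀ (u : ℕ → ℂ → ℝ), (∀ j, Continuous (u j)) → (∀ j z, |u j z| ≤ M) →
      Tendsto (fun j => ∫ z, u j z * k j z * Laplacian.laplacian (cutoff j) z) atTop (𝓝 0) := by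
    intro u huc huM
    simp only [laplacian_cutoff]
    refine tendsto_integral_rescale (M := M * M) (F := fun j z => u j z * k j z)
      (fun j => (huc j).mul (hk j).continuous) (fun j z => ?_) (fun z hz => ?_)
      (continuous_laplacian cutoffOne.contDiff)
      (hasCompactSupport_laplacian cutoffOne.contDiff cutoffOne.hasCompactSupport)
    · rw [abs_mul]
      exact mul_le_mul (huM j z) (hkM j z) (abs_nonneg _) hM0
    · have h1 := tendsto_of_tendstoUniformly_of_cocompact h0 hkU (tendsto_smul_cocompact hz)
      have h2 : Tendsto (fun j : ℕ => M * |k j (((j : ℝ) + 1) • z)|) atTop (𝓝 0) := by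
        simpa using h1.abs.const_mul M
      refine squeeze_zero_norm (fun j => ?_) h2
      rw [norm_mul]
      exact mul_le_mul_of_nonneg_right (huM j _) (norm_nonneg _)
  have hpη : ∀ j v, Continuous (pd v (cutoff j)) := fun j v => (contDiff_pd (hη j) v).continuous
  have hpηc : ∀ j v, HasCompactSupport (pd v (cutoff j)) := fun j v =>
    hasCompactSupport_pd (hηc j) v
  have hD : Tendsto (fun j => ∫ z, k j z ^ 2 *
      (pd 1 (cutoff j) z ^ 2 + pd Complex.I (cutoff j) z ^ 2)) atTop (𝓝 0) := by
    have e : ∀ j z, pd 1 (cutoff j) z ^ 2 + pd Complex.I (cutoff j) z ^ 2 =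
        (((j : ℝ) + 1)⁻¹) ^ 2 * (fun t => pd 1 cutoffOne t ^ 2 + pd Complex.I cutoffOne t ^ 2)
          ((((j : ℝ) + 1)⁻¹) • z) := by
      intro j z
      simp only [pd_cutoff]
      ring
    simp only [e]
    have hs : ContDiff ℝ ∞ (cutoffOne : ℂ → ℝ) := cutoffOne.contDiff
    have hc1 := fun v => hasCompactSupport_pd cutoffOne.hasCompactSupport v
    refine tendsto_integral_rescale (M := M ^ 2) (F := fun j z => k j z ^ 2)
      (fun j => (hk j).continuous.pow 2) (fun j z => ?_) (fun z hz => ?_)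
      (((contDiff_pd hs 1).continuous.pow 2).add ((contDiff_pd hs Complex.I).continuous.pow 2)) ?_
    · rw [abs_pow]
      exact pow_le_pow_left₀ (abs_nonneg _) (hkM j z) 2
    · simpa using
        (tendsto_of_tendstoUniformly_of_cocompact h0 hkU (tendsto_smul_cocompact hz)).pow 2
    · simp only [sq]
      exact (hc1 1).mul_left.add (hc1 Complex.I).mul_left
  have hE : Tendsto (fun j => ∫ z, k j z *
      ((G z).re * pd 1 (cutoff j) z + (G z).im * pd Complex.I (cutoff j) z)) atTop (𝓝 0) := by
    refine tendsto_zero_of_forall_le (A := ∫ z, ‖G z‖ ^ 2) (fun j => ?_) hD fun j s hs => ?_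
    · exact integral_nonneg fun z => by positivity
    · refine abs_integral_mul_inner_le hG2 ?_ hs
      refine (Continuous.integrable_of_hasCompactSupport ?_ ?_)
      · exact ((hk j).continuous.pow 2).mul (((hpη j 1).pow 2).add ((hpη j Complex.I).pow 2))
      · simp only [sq]
        exact ((hpηc j 1).mul_left.add (hpηc j Complex.I).mul_left).mul_left
  set eh := (∫ z, h z ∂χ) - ∫ z, h z ∂m with heh
  set eφ := (∫ z, φ z ∂χ) - ∫ z, φ z ∂m with heφ
  have lim1 : Tendsto (fun j => ∫ z, cutoff j z * (pd 1 (k j) z ^ 2 + pd Complex.I (k j) z ^ 2))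
      atTop (𝓝 (-(2 * Real.pi * eh))) := by
    simp only [fun j => integral_cutoff_grad_sq (hk j) (hη j) (hηc j)]
    have h2 := err k (fun j => (hk j).continuous) hkM
    simp only [← sq] at h2
    have h3 := (main k h (fun j => (hk j).continuous) hkM
      (tendsto_uncurry_of_tendstoUniformly hh hkU)).neg.add (h2.const_mul (1 / 2))
    rw [mul_zero, add_zero] at h3
    exact h3
  have lim2 : Tendsto (fun j => ∫ z, cutoff j z *
      ((G z).re * pd 1 (k j) z + (G z).im * pd Complex.I (k j) z))
      atTop (𝓝 (-(2 * Real.pi * eφ))) := by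
    simp only [fun j => hG.green (hk j) (hη j) (hηc j)]
    have h3 := ((main (fun _ => φ) φ (fun _ => hφ) (fun _ => hφM)
      (fun x => (hφ.tendsto x).comp tendsto_snd)).neg.add
      (err (fun _ => φ) (fun _ => hφ) (fun _ => hφM))).add hE
    rw [add_zero, add_zero] at h3
    exact h3
  -- This is the limit of `∫ η |∇k + tG|² + t² ∫ (1 - η) |G|²`, a sum of two nonnegative terms. As a
  -- quadratic in `t` it has nonpositive discriminant, which is Cauchy–Schwarz in the limit.
  have key : ∀ t : ℝ, 0 ≤ (∫ z, ‖G z‖ ^ 2) * (t * t) + (-(4 * Real.pi * eφ)) * t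
      + (-(2 * Real.pi * eh)) := by
    intro t
    have hl := (lim1.add (lim2.const_mul (2 * t))).add_const ((∫ z, ‖G z‖ ^ 2) * (t * t))
    refine (ge_of_tendsto' hl fun j => ?_).trans_eq (by ring)
    have hpk : ∀ v, Continuous (pd v (k j)) := fun v => (contDiff_pd (hk j) v).continuous
    have i1 : Integrable (fun z => cutoff j z * (pd 1 (k j) z ^ 2 + pd Complex.I (k j) z ^ 2)) :=
      ((hη j).continuous.mul (((hpk 1).pow 2).add
        ((hpk Complex.I).pow 2))).integrable_of_hasCompactSupport (hηc j).mul_right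
    have i2 := integrable_mul_inner (hη j).continuous (hηc j) hG.locallyIntegrable_grad
      (hpk 1) (hpk Complex.I)
    have i3 : Integrable (fun z => cutoff j z * (pd 1 (k j) z ^ 2 + pd Complex.I (k j) z ^ 2) +
        2 * t * (cutoff j z * ((G z).re * pd 1 (k j) z + (G z).im * pd Complex.I (k j) z))) :=
      i1.add (i2.const_mul _)
    rw [← integral_const_mul, ← integral_mul_const, ← integral_add i1 (i2.const_mul _),
      ← integral_add i3 (hG2.mul_const _)]
    refine integral_nonneg fun z => ?_
    have e : ‖G z‖ ^ 2 = (G z).re ^ 2 + (G z).im ^ 2 := by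
      rw [Complex.sq_norm, Complex.normSq_apply]
      ring
    simp only [Pi.zero_apply, e]
    have h1 := cutoff_nonneg j z
    have h2 := cutoff_le_one j z
    have h3 : 0 ≤ (1 - cutoff j z) * (t ^ 2 * ((G z).re ^ 2 + (G z).im ^ 2)) :=
      mul_nonneg (by linarith) (by positivity)
    have h4 : 0 ≤ cutoff j z * ((pd 1 (k j) z + t * (G z).re) ^ 2
        + (pd Complex.I (k j) z + t * (G z).im) ^ 2) := mul_nonneg h1 (by positivity)
    nlinarith
  have hd := discrim_le_zero key
  rw [discrim] at hd
  have hπ := Real.pi_pos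
  have h5 : 8 * Real.pi * (2 * Real.pi * eφ ^ 2 + (∫ z, ‖G z‖ ^ 2) * eh) ≤ 0 := by
    nlinarith
  have h6 : 2 * Real.pi * eφ ^ 2 + (∫ z, ‖G z‖ ^ 2) * eh ≤ 0 := by
    by_contra! h7
    have : 0 < 8 * Real.pi * (2 * Real.pi * eφ ^ 2 + (∫ z, ‖G z‖ ^ 2) * eh) := by positivity
    linarith
  rw [div_mul_eq_mul_div, one_mul, div_mul_eq_mul_div, le_div_iff₀ (by positivity)]
  linarith

/-- Green's formula against the constant one; it makes a planar potential free up to an additive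
constant. -/
lemma integral_laplacian_eq_zero {ψ : ℂ → ℝ} (hψ : ContDiff ℝ ∞ ψ) (hc : HasCompactSupport ψ) :
    ∫ z, Laplacian.laplacian ψ z = 0 := by
  have h := integral_mul_laplacian_comm (contDiff_const (c := (1 : ℝ))) hψ hc
  have h0 : ∀ z, Laplacian.laplacian (fun _ : ℂ => (1 : ℝ)) z = 0 := fun z => by
    rw [laplacian_eq_pd contDiff_const]
    have h1 : ∀ v, pd v (fun _ : ℂ => (1 : ℝ)) = fun _ => 0 := fun v => by
      ext z
      simp [pd]
    simp only [h1]
    simp [pd]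
  simpa [h0] using h

lemma exists_bound_of_tendsto_cocompact {h : ℂ → ℝ} {c : ℝ} (hh : Continuous h)
    (h0 : Tendsto h (cocompact ℂ) (𝓝 c)) : ∃ M, ∀ z, |h z| ≤ M := by
  have h1 : ∀ᶠ z in cocompact ℂ, |h z| < |c| + 1 := h0.abs.eventually (gt_mem_nhds (by simp))
  obtain ⟨K, hK, hKs⟩ := mem_cocompact.mp h1
  obtain ⟨C, hC⟩ := hK.exists_bound_of_continuousOn hh.continuousOn
  refine ⟨max C (|c| + 1), fun z => ?_⟩
  by_cases hz : z ∈ K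
  · exact (hC z hz).trans (le_max_left _ _)
  · exact (hKs hz).le.trans (le_max_right _ _)

/-- The energy inequality: a function with square integrable gradient is controlled by its
Dirichlet norm and the energy of a difference of probability measures with continuous potential. -/
theorem IsPlanarPotential.energy_inequality {χ m : Measure ℂ} [IsProbabilityMeasure χ]
    [IsProbabilityMeasure m] {h φ : ℂ → ℝ} (H : IsPlanarPotential χ m h) (hh : Continuous h)
    (hφ : Continuous φ) {c M : ℝ} (h0 : Tendsto h (cocompact ℂ) (𝓝 c))
    (hφM : ∀ z, |φ z| ≤ M) {G : ℂ → ℂ} (hG : IsWeakGradient φ G)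
    (hG2 : Integrable (fun z => ‖G z‖ ^ 2)) :
    ((∫ z, φ z ∂χ) - ∫ z, φ z ∂m) ^ 2 ≤
      1 / (2 * Real.pi) * (∫ z, ‖G z‖ ^ 2) * -((∫ z, h z ∂χ) - ∫ z, h z ∂m) := by
  have h0' : Tendsto (fun z => h z - c) (cocompact ℂ) (𝓝 0) := by simpa using h0.sub_const c
  obtain ⟨M₁, hM₁⟩ := exists_bound_of_tendsto_cocompact (hh.sub continuous_const) h0'
  have H' : IsPlanarPotential χ m (fun z => h z - c) := by
    intro ψ hψ hc
    have i1 := integrable_mul_of_hasCompactSupport hh.locallyIntegrable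
      (continuous_laplacian hψ) (hasCompactSupport_laplacian hψ hc)
    have i2 := (continuous_laplacian hψ).integrable_of_hasCompactSupport
      (μ := volume) (hasCompactSupport_laplacian hψ hc)
    simp only [sub_mul]
    rw [integral_sub i1 (i2.const_mul c), integral_const_mul, integral_laplacian_eq_zero hψ hc,
      mul_zero, sub_zero]
    exact H ψ hψ hc
  have key := H'.energy_inequality_of_zero (hh.sub continuous_const) hφ h0'
    (fun z => (hM₁ z).trans (le_max_left M₁ M)) (fun z => (hφM z).trans (le_max_right M₁ M)) hG hG2
  -- Both measures have mass one, so the constant subtracted from `h` disappears from the difference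
  -- of integrals.
  have hint : ∀ (ν : Measure ℂ) [IsProbabilityMeasure ν] (f : ℂ → ℝ) (b M : ℝ), Continuous f →
      (∀ z, |f z - b| ≤ M) → ∫ z, (f z - b) ∂ν = (∫ z, f z ∂ν) - b := by
    intro ν _ f b M hf hM
    have i0 : Integrable (fun z => f z - b) ν :=
      (integrable_const M).mono' (hf.sub continuous_const).aestronglyMeasurable
        (ae_of_all _ hM)
    have i1 : Integrable f ν :=
      (i0.add (integrable_const b)).congr (ae_of_all _ fun z => sub_add_cancel (f z) b)
    rw [integral_sub i1 (integrable_const b)]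
    simp
  rw [hint χ h c M₁ hh hM₁, hint m h c M₁ hh hM₁] at key
  simpa using key

end QuasiFekete

end

noncomputable section

namespace QuasiFekete

open Filter Topology

/-! ### The Fubini–Study measure on the plane -/

/-- The density of the Fubini–Study measure. -/
def fsDensity (z : ℂ) : ℝ := 1 / (Real.pi * (1 + ‖z‖ ^ 2) ^ 2)

/-- The Fubini–Study measure in the affine chart. -/
def fs : Measure ℂ := (volume : Measure ℂ).withDensity fun z => ENNReal.ofReal (fsDensity z)

lemma fsDensity_nonneg (z : ℂ) : 0 ≤ fsDensity z := by
  have := Real.pi_pos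
  unfold fsDensity
  positivity

lemma continuous_fsDensity : Continuous fsDensity := by
  unfold fsDensity
  refine continuous_const.div (by fun_prop) fun z => ?_
  have := Real.pi_pos
  positivity

lemma integral_fs (F : ℂ → ℝ) : ∫ z, F z ∂fs = ∫ z, fsDensity z * F z := by
  have h := integral_withDensity_eq_integral_toReal_smul (μ := (volume : Measure ℂ))
    (f := fun z => ENNReal.ofReal (fsDensity z))
    continuous_fsDensity.measurable.ennreal_ofReal (ae_of_all _ fun z => ENNReal.ofReal_lt_top) F
  simp only [ENNReal.toReal_ofReal (fsDensity_nonneg _), smul_eq_mul] at h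
  exact h

/-- The square of the spherical distance to the origin. -/
def distSqZero (z : ℂ) : ℝ := ‖z‖ ^ 2 / (1 + ‖z‖ ^ 2)

lemma continuous_distSqZero : Continuous distSqZero := by
  unfold distSqZero
  exact (by fun_prop : Continuous fun z : ℂ => ‖z‖ ^ 2).div (by fun_prop)
    fun z => by positivity

lemma image_sq_div : (fun r : ℝ => r ^ 2 / (1 + r ^ 2)) '' Set.Ioi 0 = Set.Ioo 0 1 := by
  ext t
  constructor
  · rintro ⟨r, hr, rfl⟩
    have hr' : 0 < r := hr
    refine ⟨by positivity, ?_⟩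
    rw [div_lt_one (by positivity)]
    linarith
  · rintro ⟨h0, h1⟩
    refine ⟨Real.sqrt (t / (1 - t)), Real.sqrt_pos.mpr (div_pos h0 (by linarith)), ?_⟩
    have h2 : (1 - t) ≠ 0 := by linarith
    simp only [Real.sq_sqrt (div_nonneg h0.le (by linarith : 0 ≤ 1 - t))]
    field_simp
    ring

lemma hasDerivAt_sq_div (r : ℝ) :
    HasDerivAt (fun r : ℝ => r ^ 2 / (1 + r ^ 2)) (2 * r / (1 + r ^ 2) ^ 2) r := by
  have h1 : HasDerivAt (fun r : ℝ => r ^ 2) (2 * r) r := by simpa using hasDerivAt_pow 2 r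
  refine (h1.div (h1.const_add 1) (by positivity)).congr_deriv ?_
  have : (1 + r ^ 2) ≠ 0 := by positivity
  field_simp
  ring

lemma injOn_sq_div : Set.InjOn (fun r : ℝ => r ^ 2 / (1 + r ^ 2)) (Set.Ioi 0) := by
  intro r hr s hs h
  have hr' : 0 < r := hr
  have hs' : 0 < s := hs
  simp only at h
  rw [div_eq_div_iff (by positivity) (by positivity)] at h
  have : r ^ 2 = s ^ 2 := by linarith
  exact (sq_eq_sq₀ hr'.le hs'.le).mp this

/-- The square of the distance to the origin is uniformly distributed. -/
lemma map_distSqZero_fs : Measure.map distSqZero fs = volume.restrict (Set.Ioo 0 1) := by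
  refine Measure.ext_of_lintegral _ fun f hf => ?_
  rw [lintegral_map hf continuous_distSqZero.measurable, fs,
    lintegral_withDensity_eq_lintegral_mul _
      continuous_fsDensity.measurable.ennreal_ofReal (g := fun z => f (distSqZero z))
      (hf.comp continuous_distSqZero.measurable),
    ← Complex.lintegral_comp_polarCoord_symm, ← image_sq_div,
    lintegral_image_eq_lintegral_abs_deriv_mul measurableSet_Ioi
      (fun r _ => (hasDerivAt_sq_div r).hasDerivWithinAt) injOn_sq_div]
  have e : ∀ p ∈ polarCoord.target, ENNReal.ofReal p.1 •
      ((fun z => ENNReal.ofReal (fsDensity z)) * fun z => f (distSqZero z))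
        (Complex.polarCoord.symm p) =
      (fun r : ℝ => ENNReal.ofReal (r * (1 / (Real.pi * (1 + r ^ 2) ^ 2))) *
        f (r ^ 2 / (1 + r ^ 2))) p.1 := by
    intro p hp
    have hp1 : 0 < p.1 := hp.1
    simp only [Pi.mul_apply, fsDensity, distSqZero, Complex.norm_polarCoord_symm, sq_abs,
      smul_eq_mul]
    rw [← mul_assoc, ← ENNReal.ofReal_mul hp1.le]
  have hmeas : Measurable (fun r : ℝ => ENNReal.ofReal (r * (1 / (Real.pi * (1 + r ^ 2) ^ 2))) *
      f (r ^ 2 / (1 + r ^ 2))) := by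
    refine Measurable.mul (by fun_prop) (hf.comp (by fun_prop))
  rw [setLIntegral_congr_fun polarCoord.open_target.measurableSet e, polarCoord_target,
    Measure.volume_eq_prod, ← Measure.prod_restrict]
  refine (lintegral_prod _ (hmeas.comp measurable_fst).aemeasurable).trans ?_
  simp only [Function.comp_apply, lintegral_const, Measure.restrict_apply MeasurableSet.univ,
    Set.univ_inter, Real.volume_Ioo]
  -- The angle contributes `2π`, and `2π r / (π (1 + r²)²)` is the derivative of `r² / (1 + r²)`.
  refine setLIntegral_congr_fun measurableSet_Ioi fun r hr => ?_
  have hr' : 0 < r := hr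
  have hπ := Real.pi_pos
  rw [mul_right_comm, ← ENNReal.ofReal_mul (by positivity), abs_of_pos (by positivity)]
  congr 2
  field_simp
  ring

instance : IsProbabilityMeasure fs := by
  constructor
  have h := congrArg (fun ν : Measure ℝ => ν Set.univ) map_distSqZero_fs
  simp only [Measure.map_apply continuous_distSqZero.measurable MeasurableSet.univ,
    Set.preimage_univ, Measure.restrict_apply MeasurableSet.univ, Set.univ_inter,
    Real.volume_Ioo] at h
  simpa using h

lemma integrable_comp_distSqZero {F : ℝ → ℝ} (hF : Measurable F)
    (hi : IntervalIntegrable F volume 0 1) : Integrable (fun z => F (distSqZero z)) fs := by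
  rw [intervalIntegrable_iff_integrableOn_Ioo_of_le zero_le_one, IntegrableOn,
    ← map_distSqZero_fs] at hi
  exact (integrable_map_measure hF.aestronglyMeasurable
    continuous_distSqZero.aemeasurable).mp hi

lemma integral_comp_distSqZero {F : ℝ → ℝ} (hF : Measurable F) :
    ∫ z, F (distSqZero z) ∂fs = ∫ t in (0 : ℝ)..1, F t := by
  rw [intervalIntegral.integral_of_le zero_le_one, integral_Ioc_eq_integral_Ioo,
    ← map_distSqZero_fs,
    integral_map continuous_distSqZero.aemeasurable hF.aestronglyMeasurable]

lemma one_sub_distSqZero (z : ℂ) : 1 - distSqZero z = 1 / (1 + ‖z‖ ^ 2) := by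
  unfold distSqZero
  have : (1 + ‖z‖ ^ 2) ≠ 0 := by positivity
  field_simp
  ring

/-- With `t` the uniformly distributed squared distance to the origin, `‖z‖ ≤ √(1 + ‖z‖²) = (1 -
t)^(-1/2)`, whose integral over the unit interval is `2`. -/
lemma integrable_norm_fs_and_integral_le : Integrable (fun z : ℂ => ‖z‖) fs ∧
    ∫ z, ‖z‖ ∂fs ≤ 2 := by
  have hi : IntervalIntegrable (fun t : ℝ => (1 - t) ^ (-(1 / 2) : ℝ)) volume 0 1 := by
    have h := (intervalIntegral.intervalIntegrable_rpow' (a := 1) (b := 0) (r := -(1 / 2))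
      (by norm_num)).comp_sub_left 1
    simpa using h
  have hm : Measurable (fun t : ℝ => (1 - t) ^ (-(1 / 2) : ℝ)) := by fun_prop
  have hI := integrable_comp_distSqZero hm hi
  have hle : ∀ z : ℂ, ‖z‖ ≤ (1 - distSqZero z) ^ (-(1 / 2) : ℝ) := by
    intro z
    rw [one_sub_distSqZero, one_div, Real.inv_rpow (by positivity), Real.rpow_neg (by positivity),
      inv_inv, ← Real.sqrt_eq_rpow]
    exact Real.le_sqrt_of_sq_le (by linarith)
  have hn : Integrable (fun z : ℂ => ‖z‖) fs :=
    hI.mono' continuous_norm.aestronglyMeasurable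
      (ae_of_all _ fun z => by simpa using hle z)
  refine ⟨hn, (integral_mono hn hI hle).trans ?_⟩
  rw [integral_comp_distSqZero hm,
    intervalIntegral.integral_comp_sub_left (fun t : ℝ => t ^ (-(1 / 2) : ℝ)) 1, sub_self,
    sub_zero, integral_rpow (Or.inl (by norm_num))]
  norm_num

/-- Truncating the exponential series at degree three suffices: `s - s²/2 + s³/6` is `s/6` times `s²
- 3s + 6`, which has no real root. -/
lemma log_one_add_sq_le {s : ℝ} (hs : 0 ≤ s) : Real.log (1 + s ^ 2) ≤ s := by
  rw [Real.log_le_iff_le_exp (by positivity)]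
  refine le_trans ?_ (Real.sum_le_exp_of_nonneg hs 4)
  simp only [Finset.sum_range_succ, Finset.sum_range_zero, Nat.factorial]
  norm_num
  nlinarith [mul_nonneg hs (sq_nonneg (s - 3 / 2)), mul_nonneg hs hs]

lemma integral_log_one_add_le {a : ℝ} (ha : 0 ≤ a) :
    Integrable (fun z : ℂ => 1 / 2 * Real.log (1 + a ^ 2 * ‖z‖ ^ 2)) fs ∧
    ∫ z : ℂ, 1 / 2 * Real.log (1 + a ^ 2 * ‖z‖ ^ 2) ∂fs ≤ a := by
  obtain ⟨hn, hb⟩ := integrable_norm_fs_and_integral_le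
  have hle : ∀ z : ℂ, 1 / 2 * Real.log (1 + a ^ 2 * ‖z‖ ^ 2) ≤ a / 2 * ‖z‖ := fun z => by
    have := log_one_add_sq_le (mul_nonneg ha (norm_nonneg z))
    rw [mul_pow] at this
    linarith
  have h0 : ∀ z : ℂ, 0 ≤ 1 / 2 * Real.log (1 + a ^ 2 * ‖z‖ ^ 2) := fun z => by
    have := Real.log_nonneg (x := 1 + a ^ 2 * ‖z‖ ^ 2) (by nlinarith [sq_nonneg (a * ‖z‖)])
    positivity
  have hi : Integrable (fun z : ℂ => 1 / 2 * Real.log (1 + a ^ 2 * ‖z‖ ^ 2)) fs := by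
    refine (hn.const_mul (a / 2)).mono' ?_ (ae_of_all _ fun z => ?_)
    · exact (Measurable.const_mul (Real.measurable_log.comp (by fun_prop)) _).aestronglyMeasurable
    · rw [Real.norm_of_nonneg (h0 z)]
      exact hle z
  refine ⟨hi, (integral_mono hi (hn.const_mul (a / 2)) hle).trans ?_⟩
  rw [integral_const_mul]
  nlinarith

/-- The mean of the regularized logarithm of the distance to the origin. -/
lemma integral_half_log_bounds {a : ℝ} (ha : 0 ≤ a) (ha1 : a ≤ 1) :
    -(1 / 2) ≤ ∫ z, 1 / 2 * Real.log ((1 - a ^ 2) * distSqZero z + a ^ 2) ∂fs ∧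
    ∫ z, 1 / 2 * Real.log ((1 - a ^ 2) * distSqZero z + a ^ 2) ∂fs ≤ -(1 / 2) + a := by
  have hm : Measurable (fun t : ℝ => 1 / 2 * Real.log ((1 - a ^ 2) * t + a ^ 2)) := by fun_prop
  have ha2 : a ^ 2 ≤ 1 := pow_le_one₀ ha ha1
  have hI1 : IntervalIntegrable (fun t : ℝ => 1 / 2 * Real.log t) volume 0 1 :=
    intervalIntegral.intervalIntegrable_log'.const_mul _
  have hr : IntervalIntegrable (fun t : ℝ => t ^ (-(1 / 2) : ℝ)) volume 0 1 :=
    intervalIntegral.intervalIntegrable_rpow' (by norm_num)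
  have hI2 : IntervalIntegrable (fun t : ℝ => 1 / 2 * Real.log t + a / 2 * t ^ (-(1 / 2) : ℝ))
      volume 0 1 := hI1.add (hr.const_mul _)
  have low : ∀ t ∈ Set.Ioo (0 : ℝ) 1,
      1 / 2 * Real.log t ≤ 1 / 2 * Real.log ((1 - a ^ 2) * t + a ^ 2) := by
    intro t ht
    have : Real.log t ≤ Real.log ((1 - a ^ 2) * t + a ^ 2) :=
      Real.log_le_log ht.1 (by nlinarith [ht.2, sq_nonneg a])
    linarith
  -- Drop `-a² t`, factor out `t`, and apply `log (1 + s²) ≤ s` with `s = a / √t`.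
  have up : ∀ t ∈ Set.Ioo (0 : ℝ) 1,
      1 / 2 * Real.log ((1 - a ^ 2) * t + a ^ 2) ≤
        1 / 2 * Real.log t + a / 2 * t ^ (-(1 / 2) : ℝ) := by
    intro t ht
    have hs : t ^ (-(1 / 2) : ℝ) = (Real.sqrt t)⁻¹ := by
      rw [Real.rpow_neg ht.1.le, Real.sqrt_eq_rpow]
    have hst := Real.sqrt_pos.mpr ht.1
    have h1 := log_one_add_sq_le (div_nonneg ha hst.le)
    have h2 : Real.log ((1 - a ^ 2) * t + a ^ 2) ≤ Real.log (t * (1 + (a / Real.sqrt t) ^ 2)) := by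
      refine Real.log_le_log ?_ ?_
      · have := ht.1
        have := ht.2
        rcases eq_or_lt_of_le ha with h | h
        · rw [← h]
          linarith
        · nlinarith [sq_pos_of_pos h]
      · rw [div_pow, Real.sq_sqrt ht.1.le, mul_add, mul_one, mul_div_cancel₀ _ ht.1.ne']
        nlinarith [ht.1, sq_nonneg a, mul_nonneg (sq_nonneg a) ht.1.le]
    rw [Real.log_mul ht.1.ne' (by positivity)] at h2
    rw [hs]
    have h3 : a / 2 * (Real.sqrt t)⁻¹ = 1 / 2 * (a / Real.sqrt t) := by ring
    rw [h3]
    linarith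
  have hI : IntervalIntegrable (fun t : ℝ => 1 / 2 * Real.log ((1 - a ^ 2) * t + a ^ 2))
      volume 0 1 := by
    have hA := hI1.abs.add hI2.abs
    rw [intervalIntegrable_iff_integrableOn_Ioo_of_le zero_le_one] at hA ⊢
    refine hA.mono' hm.aestronglyMeasurable ?_
    refine (ae_restrict_iff' measurableSet_Ioo).mpr (ae_of_all _ fun t ht => ?_)
    rw [Real.norm_eq_abs]
    refine (abs_le_max_abs_abs (low t ht) (up t ht)).trans ?_
    exact max_le (le_add_of_nonneg_right (abs_nonneg _)) (le_add_of_nonneg_left (abs_nonneg _))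
  have e1 : ∫ t in (0 : ℝ)..1, 1 / 2 * Real.log t = -(1 / 2) := by
    rw [intervalIntegral.integral_const_mul, integral_log_from_zero]
    norm_num
  have e2 : ∫ t in (0 : ℝ)..1, (1 / 2 * Real.log t + a / 2 * t ^ (-(1 / 2) : ℝ)) =
      -(1 / 2) + a := by
    rw [intervalIntegral.integral_add hI1 (hr.const_mul _), e1,
      intervalIntegral.integral_const_mul, integral_rpow (Or.inl (by norm_num))]
    norm_num
  rw [integral_comp_distSqZero (F := fun t => 1 / 2 * Real.log ((1 - a ^ 2) * t + a ^ 2)) hm]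
  constructor
  · rw [← e1]
    exact intervalIntegral.integral_mono_on_of_le_Ioo zero_le_one hI1 hI low
  · rw [← e2]
    exact intervalIntegral.integral_mono_on_of_le_Ioo zero_le_one hI hI2 up

end QuasiFekete

end

noncomputable section

namespace QuasiFekete

open Filter Topology ComplexConjugate

/-! ### Regularized point masses -/

/-- The Möbius map sending the origin to `p / q`, composed with the dilation of ratio `a`. -/
def mob (p q : ℂ) (a : ℝ) (w : ℂ) : ℂ := (p - a * conj q * w) / (q + a * conj p * w)

/-- The quadratic form attached to the inverse of `mob p q a`. -/
def quad (p q : ℂ) (a : ℝ) (z : ℂ) : ℝ := ‖p - q * z‖ ^ 2 + a ^ 2 * ‖conj p * z + conj q‖ ^ 2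

/-- The square of the spherical distance between `[p : q]` and `[z : 1]`, for a unit vector. -/
def distSq (p q z : ℂ) : ℝ := ‖p - q * z‖ ^ 2 / (1 + ‖z‖ ^ 2)

/-- The regularized logarithm of the spherical distance. -/
def regLog (p q : ℂ) (a : ℝ) (z : ℂ) : ℝ := 1 / 2 * Real.log ((1 - a ^ 2) * distSq p q z + a ^ 2)

/-- The regularized point mass. -/
def chi (p q : ℂ) (a : ℝ) : Measure ℂ := Measure.map (mob p q a) fs

lemma measurable_mob (p q : ℂ) (a : ℝ) : Measurable (mob p q a) := by
  unfold mob
  fun_prop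

instance (p q : ℂ) (a : ℝ) : IsProbabilityMeasure (chi p q a) :=
  Measure.isProbabilityMeasure_map (measurable_mob p q a).aemeasurable

/-- For a unit vector this is unitarity: the two terms are the squared moduli of the coordinates of
`(z, 1)` in an orthonormal basis adapted to `(p, q)`. -/
lemma norm_sq_add_norm_sq (p q z : ℂ) :
    ‖p - q * z‖ ^ 2 + ‖conj p * z + conj q‖ ^ 2 = (‖p‖ ^ 2 + ‖q‖ ^ 2) * (1 + ‖z‖ ^ 2) := by
  simp only [Complex.sq_norm, Complex.normSq_apply, Complex.sub_re, Complex.sub_im, Complex.mul_re,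
    Complex.mul_im, Complex.add_re, Complex.add_im, Complex.conj_re, Complex.conj_im]
  ring

lemma distSq_nonneg (p q z : ℂ) : 0 ≤ distSq p q z := by
  unfold distSq
  positivity

lemma distSq_le_one {p q : ℂ} (h : ‖p‖ ^ 2 + ‖q‖ ^ 2 = 1) (z : ℂ) : distSq p q z ≤ 1 := by
  unfold distSq
  rw [div_le_one (by positivity)]
  have := norm_sq_add_norm_sq p q z
  rw [h] at this
  nlinarith [sq_nonneg ‖conj p * z + conj q‖]

/-- By unitarity `1 - d²` is `‖conj p * z + conj q‖² / (1 + ‖z‖²)`. The regularized kernel is thus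
half the logarithm of a quotient of positive quadratic polynomials. -/
lemma reg_eq_quad {p q : ℂ} (h : ‖p‖ ^ 2 + ‖q‖ ^ 2 = 1) (a : ℝ) (z : ℂ) :
    (1 - a ^ 2) * distSq p q z + a ^ 2 = quad p q a z / (1 + ‖z‖ ^ 2) := by
  have := norm_sq_add_norm_sq p q z
  rw [h, one_mul] at this
  have h2 : (1 + ‖z‖ ^ 2) ≠ 0 := by positivity
  unfold distSq quad
  rw [eq_div_iff h2, add_mul, mul_assoc, div_mul_cancel₀ _ h2, ← this]
  ring

lemma quad_pos {p q : ℂ} (h : ‖p‖ ^ 2 + ‖q‖ ^ 2 = 1) {a : ℝ} (ha : 0 < a) (z : ℂ) :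
    0 < quad p q a z := by
  have := norm_sq_add_norm_sq p q z
  rw [h, one_mul] at this
  unfold quad
  by_contra! hn
  have h1 : ‖p - q * z‖ ^ 2 = 0 := le_antisymm (by
    nlinarith [mul_nonneg (sq_nonneg a) (sq_nonneg ‖conj p * z + conj q‖)]) (sq_nonneg _)
  rw [h1, zero_add] at this hn
  rw [this] at hn
  have : 0 < a ^ 2 * (1 + ‖z‖ ^ 2) := by positivity
  linarith

lemma quad_one {p q : ℂ} (h : ‖p‖ ^ 2 + ‖q‖ ^ 2 = 1) (z : ℂ) : quad p q 1 z = 1 + ‖z‖ ^ 2 := by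
  have := norm_sq_add_norm_sq p q z
  rw [h, one_mul] at this
  unfold quad
  linarith

lemma conj_mul_add_mul_conj {p q : ℂ} (h : ‖p‖ ^ 2 + ‖q‖ ^ 2 = 1) :
    p * conj p + q * conj q = 1 := by
  rw [Complex.mul_conj, Complex.mul_conj, Complex.normSq_eq_norm_sq, Complex.normSq_eq_norm_sq]
  exact_mod_cast h

/-- The affine form `z ↦ c + b * z` vanishes at most once. -/
lemma subsingleton_affine_zero {b c : ℂ} (h : ¬ (b = 0 ∧ c = 0)) :
    {z : ℂ | c + b * z = 0}.Subsingleton := by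
  intro z hz w hw
  simp only [Set.mem_ofPred_eq] at hz hw
  have hb : b ≠ 0 := by
    rintro rfl
    exact h ⟨rfl, by simpa using hz⟩
  have : b * (z - w) = 0 := by linear_combination hz - hw
  rcases mul_eq_zero.mp this with h1 | h1
  · exact absurd h1 hb
  · exact sub_eq_zero.mp h1

lemma fs_absolutelyContinuous : fs ≪ volume := withDensity_absolutelyContinuous _ _

/-- At its pole `mob` takes the default value of division by zero; almost everywhere statements may
ignore that point. -/
lemma ae_pole {p q : ℂ} (h : ‖p‖ ^ 2 + ‖q‖ ^ 2 = 1) {a : ℝ} (ha : 0 < a) :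
    ∀ᵐ w : ℂ, q + a * conj p * w ≠ 0 := by
  rw [ae_iff]
  simp only [not_not]
  refine Set.Subsingleton.measure_zero (subsingleton_affine_zero ?_) _
  rintro ⟨h1, h2⟩
  have : p = 0 := by
    rcases mul_eq_zero.mp h1 with h3 | h3
    · exact absurd h3 (by exact_mod_cast ha.ne')
    · simpa using h3
  simp [this, h2] at h

lemma sub_mul_mob {p q : ℂ} (h : ‖p‖ ^ 2 + ‖q‖ ^ 2 = 1) {a : ℝ} {w : ℂ}
    (hw : q + a * conj p * w ≠ 0) :
    p - q * mob p q a w = a * w / (q + a * conj p * w) := by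
  have h1 := conj_mul_add_mul_conj h
  unfold mob
  rw [eq_div_iff hw, sub_mul, mul_assoc q, div_mul_cancel₀ _ hw]
  linear_combination (a * w : ℂ) * h1

lemma conj_mul_mob_add {p q : ℂ} (h : ‖p‖ ^ 2 + ‖q‖ ^ 2 = 1) {a : ℝ} {w : ℂ}
    (hw : q + a * conj p * w ≠ 0) :
    conj p * mob p q a w + conj q = 1 / (q + a * conj p * w) := by
  have h1 := conj_mul_add_mul_conj h
  unfold mob
  rw [eq_div_iff hw, add_mul, mul_assoc (conj p), div_mul_cancel₀ _ hw]
  linear_combination h1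

lemma quad_mob {p q : ℂ} (h : ‖p‖ ^ 2 + ‖q‖ ^ 2 = 1) {a : ℝ} {w : ℂ}
    (hw : q + a * conj p * w ≠ 0) :
    quad p q a (mob p q a w) = a ^ 2 * (1 + ‖w‖ ^ 2) / ‖q + a * conj p * w‖ ^ 2 := by
  unfold quad
  rw [sub_mul_mob h hw, conj_mul_mob_add h hw, norm_div, norm_div, norm_mul, Complex.norm_real,
    div_pow, div_pow, mul_pow, Real.norm_eq_abs, sq_abs, norm_one]
  ring

lemma one_add_norm_mob_sq {p q : ℂ} (h : ‖p‖ ^ 2 + ‖q‖ ^ 2 = 1) {a : ℝ} {w : ℂ}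
    (hw : q + a * conj p * w ≠ 0) :
    1 + ‖mob p q a w‖ ^ 2 = (1 + a ^ 2 * ‖w‖ ^ 2) / ‖q + a * conj p * w‖ ^ 2 := by
  have h0 := norm_sq_add_norm_sq p q (mob p q a w)
  rw [h, one_mul] at h0
  rw [← h0, sub_mul_mob h hw, conj_mul_mob_add h hw, norm_div, norm_div, norm_mul,
    Complex.norm_real, div_pow, div_pow, mul_pow, Real.norm_eq_abs, sq_abs, norm_one]
  ring

lemma distSq_mob {p q : ℂ} (h : ‖p‖ ^ 2 + ‖q‖ ^ 2 = 1) {a : ℝ} {w : ℂ}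
    (hw : q + a * conj p * w ≠ 0) :
    distSq p q (mob p q a w) = a ^ 2 * ‖w‖ ^ 2 / (1 + a ^ 2 * ‖w‖ ^ 2) := by
  have hn : ‖q + a * conj p * w‖ ≠ 0 := norm_ne_zero_iff.mpr hw
  have h2 : (1 + a ^ 2 * ‖w‖ ^ 2) ≠ 0 := by positivity
  unfold distSq
  rw [one_add_norm_mob_sq h hw, sub_mul_mob h hw, norm_div, norm_mul, Complex.norm_real, div_pow,
    mul_pow, Real.norm_eq_abs, sq_abs]
  field_simp

lemma abs_det_smulRight (c : ℂ) :
    |((ContinuousLinearMap.toSpanSingleton ℂ c).restrictScalars ℝ).det| = ‖c‖ ^ 2 := by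
  simp [ContinuousLinearMap.det, LinearMap.det_restrictScalars, Algebra.norm_complex_eq,
    Complex.normSq_eq_norm_sq]

lemma hasDerivAt_mob {p q : ℂ} (h : ‖p‖ ^ 2 + ‖q‖ ^ 2 = 1) {a : ℝ} {w : ℂ}
    (hw : q + a * conj p * w ≠ 0) :
    HasDerivAt (mob p q a) (-a / (q + a * conj p * w) ^ 2) w := by
  have h1 := conj_mul_add_mul_conj h
  have d1 : HasDerivAt (fun w : ℂ => p - a * conj q * w) (-(a * conj q)) w := by
    simpa using ((hasDerivAt_id w).const_mul (a * conj q)).const_sub p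
  have d2 : HasDerivAt (fun w : ℂ => q + a * conj p * w) (a * conj p) w := by
    simpa using ((hasDerivAt_id w).const_mul (a * conj p)).const_add q
  refine (d1.div d2 hw).congr_deriv ?_
  congr 1
  linear_combination (-a : ℂ) * h1

/-- The density of the regularized point mass. -/
def chiDensity (p q : ℂ) (a : ℝ) (z : ℂ) : ℝ := a ^ 2 / (Real.pi * quad p q a z ^ 2)

/-- Change of variables off the pole, where `mob` is injective with conull image. Its real Jacobian
is the squared modulus of the complex derivative. -/
lemma integral_fs_comp_mob {p q : ℂ} (h : ‖p‖ ^ 2 + ‖q‖ ^ 2 = 1) {a : ℝ} (ha : 0 < a)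
    (F : ℂ → ℝ) : ∫ w, F (mob p q a w) ∂fs = ∫ z, chiDensity p q a z * F z := by
  set s : Set ℂ := {w | q + a * conj p * w ≠ 0} with hs
  have h1 := conj_mul_add_mul_conj h
  have haC : (a : ℂ) ≠ 0 := by exact_mod_cast ha.ne'
  have hsm : MeasurableSet s :=
    (isOpen_ne_fun (by fun_prop) continuous_const).measurableSet
  have hsu : s =ᵐ[volume] (Set.univ : Set ℂ) := by
    rw [eventuallyEq_univ]
    exact ae_pole h ha
  have hinj : Set.InjOn (mob p q a) s := by
    intro w hw v hv hwv
    have e1 := conj_mul_mob_add h (show q + a * conj p * w ≠ 0 from hw)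
    have e2 := conj_mul_mob_add h (show q + a * conj p * v ≠ 0 from hv)
    have f1 := sub_mul_mob h (show q + a * conj p * w ≠ 0 from hw)
    have f2 := sub_mul_mob h (show q + a * conj p * v ≠ 0 from hv)
    rw [hwv, e2] at e1
    rw [hwv, f2] at f1
    have e3 : q + a * conj p * v = q + a * conj p * w := by
      have := congrArg (fun t : ℂ => t⁻¹) e1
      simpa using this
    rw [e3, div_left_inj' (show q + a * conj p * w ≠ 0 from hw)] at f1
    exact (mul_left_cancel₀ haC f1).symm
  have himg : mob p q a '' s =ᵐ[volume] (Set.univ : Set ℂ) := by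
    rw [eventuallyEq_univ]
    have hz : ∀ᵐ z : ℂ, conj q + conj p * z ≠ 0 := by
      have := ae_pole (p := p) (q := conj q) (by simpa using h) one_pos
      simpa using this
    filter_upwards [hz] with z hz
    -- The preimage comes from dividing `sub_mul_mob` by `conj_mul_mob_add`: the quotient is `a *
    -- w`.
    have hd : q + a * conj p * ((p - q * z) / (a * (conj q + conj p * z))) =
        1 / (conj q + conj p * z) := by
      field_simp
      linear_combination h1
    refine ⟨(p - q * z) / (a * (conj q + conj p * z)), ?_, ?_⟩
    · rw [hs, Set.mem_ofPred_eq, hd]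
      exact one_div_ne_zero hz
    · have hm : p - a * conj q * ((p - q * z) / (a * (conj q + conj p * z))) =
          z / (conj q + conj p * z) := by
        have h4 : p * (conj q + conj p * z) - conj q * (p - q * z) = z := by
          linear_combination z * h1
        generalize conj q + conj p * z = D at hz h4
        field_simp
        exact h4
      unfold mob
      rw [hd, hm, div_div_div_cancel_right₀ hz, div_one]
  have hf' : ∀ w ∈ s, HasFDerivWithinAt (mob p q a)
      ((ContinuousLinearMap.toSpanSingleton ℂ
        (-a / (q + a * conj p * w) ^ 2)).restrictScalars ℝ) s w := fun w hw =>
    ((hasDerivAt_mob h hw).hasFDerivAt.restrictScalars ℝ).hasFDerivWithinAt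
  have key := integral_image_eq_integral_abs_det_fderiv_smul volume hsm hf' hinj
    (fun z => chiDensity p q a z * F z)
  rw [setIntegral_congr_set himg, setIntegral_univ] at key
  rw [key, integral_fs, ← setIntegral_univ, ← setIntegral_congr_set hsu]
  refine setIntegral_congr_fun hsm fun w hw => ?_
  have hw' : q + a * conj p * w ≠ 0 := hw
  have hn : ‖q + a * conj p * w‖ ≠ 0 := norm_ne_zero_iff.mpr hw'
  have hπ := Real.pi_ne_zero
  have h3 : (1 + ‖w‖ ^ 2) ≠ 0 := by positivity
  simp only [smul_eq_mul, abs_det_smulRight, chiDensity, quad_mob h hw', fsDensity]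
  rw [norm_div, norm_neg, Complex.norm_real, norm_pow, Real.norm_eq_abs, abs_of_pos ha]
  field_simp

lemma integral_chi {p q : ℂ} (h : ‖p‖ ^ 2 + ‖q‖ ^ 2 = 1) {a : ℝ} (ha : 0 < a)
    {F : ℂ → ℝ} (hF : Measurable F) : ∫ z, F z ∂chi p q a = ∫ z, chiDensity p q a z * F z := by
  rw [chi, integral_map (measurable_mob p q a).aemeasurable hF.aestronglyMeasurable,
    integral_fs_comp_mob h ha]

/-- At scale one the map is unitary and the density reduces to that of Fubini–Study, which is
therefore invariant. -/
lemma integral_fs_eq_comp_mob {p q : ℂ} (h : ‖p‖ ^ 2 + ‖q‖ ^ 2 = 1) (F : ℂ → ℝ) :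
    ∫ w, F w ∂fs = ∫ w, F (mob p q 1 w) ∂fs := by
  rw [integral_fs_comp_mob h one_pos, integral_fs]
  congr 1 with z
  rw [chiDensity, quad_one h, fsDensity, one_pow]

lemma integral_regLog_fs {p q : ℂ} (h : ‖p‖ ^ 2 + ‖q‖ ^ 2 = 1) (a : ℝ) :
    ∫ z, regLog p q a z ∂fs =
      ∫ z, 1 / 2 * Real.log ((1 - a ^ 2) * distSqZero z + a ^ 2) ∂fs := by
  rw [integral_fs_eq_comp_mob h]
  refine integral_congr_ae ?_
  filter_upwards [fs_absolutelyContinuous.ae_le (ae_pole h one_pos)] with w hw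
  unfold regLog
  rw [distSq_mob h hw]
  simp [distSqZero]

lemma continuous_distSq (p q : ℂ) : Continuous (distSq p q) := by
  unfold distSq
  exact (by fun_prop : Continuous fun z : ℂ => ‖p - q * z‖ ^ 2).div (by fun_prop)
    fun z => by positivity

lemma reg_mem {p q : ℂ} (h : ‖p‖ ^ 2 + ‖q‖ ^ 2 = 1) {a : ℝ} (ha1 : a ≤ 1) (ha : 0 < a) (z : ℂ) :
    a ^ 2 ≤ (1 - a ^ 2) * distSq p q z + a ^ 2 ∧ distSq p q z ≤ (1 - a ^ 2) * distSq p q z + a ^ 2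
      ∧ (1 - a ^ 2) * distSq p q z + a ^ 2 ≤ 1 := by
  have h0 := distSq_nonneg p q z
  have h1 := distSq_le_one h z
  have h2 : a ^ 2 ≤ 1 := pow_le_one₀ ha.le ha1
  refine ⟨?_, ?_, ?_⟩ <;> nlinarith [sq_nonneg a]

lemma log_le_regLog {p q : ℂ} (h : ‖p‖ ^ 2 + ‖q‖ ^ 2 = 1) {a : ℝ} (ha1 : a ≤ 1) (ha : 0 < a)
    (z : ℂ) : Real.log a ≤ regLog p q a z := by
  have := Real.log_le_log (by positivity) (reg_mem h ha1 ha z).1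
  rw [Real.log_pow] at this
  unfold regLog
  push_cast at this
  linarith

lemma regLog_nonpos {p q : ℂ} (h : ‖p‖ ^ 2 + ‖q‖ ^ 2 = 1) {a : ℝ} (ha1 : a ≤ 1) (ha : 0 < a)
    (z : ℂ) : regLog p q a z ≤ 0 := by
  have h1 := reg_mem h ha1 ha z
  have := Real.log_nonpos (by nlinarith [h1.1, sq_nonneg a]) h1.2.2
  unfold regLog
  linarith

lemma log_distSq_le_regLog {p q : ℂ} (h : ‖p‖ ^ 2 + ‖q‖ ^ 2 = 1) {a : ℝ} (ha1 : a ≤ 1)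
    (ha : 0 < a) {z : ℂ} (hz : 0 < distSq p q z) :
    1 / 2 * Real.log (distSq p q z) ≤ regLog p q a z := by
  have := Real.log_le_log hz (reg_mem h ha1 ha z).2.1
  unfold regLog
  linarith

lemma continuous_regLog {p q : ℂ} (h : ‖p‖ ^ 2 + ‖q‖ ^ 2 = 1) {a : ℝ} (ha1 : a ≤ 1) (ha : 0 < a) :
    Continuous (regLog p q a) := by
  unfold regLog
  refine continuous_const.mul (Continuous.log ?_ fun z => ?_)
  · exact (continuous_const.mul (continuous_distSq p q)).add continuous_const
  · have := (reg_mem h ha1 ha z).1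
    have : 0 < a ^ 2 := by positivity
    linarith

lemma integrable_regLog {p q : ℂ} (h : ‖p‖ ^ 2 + ‖q‖ ^ 2 = 1) {a : ℝ} (ha1 : a ≤ 1) (ha : 0 < a)
    (ν : Measure ℂ) [IsProbabilityMeasure ν] : Integrable (regLog p q a) ν := by
  refine (integrable_const (-Real.log a)).mono' (continuous_regLog h ha1 ha).aestronglyMeasurable
    (ae_of_all _ fun z => ?_)
  rw [Real.norm_eq_abs, abs_of_nonpos (regLog_nonpos h ha1 ha z)]
  linarith [log_le_regLog h ha1 ha z]

/-- Moments of the distance to the centre of the regularized point mass. -/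
lemma integral_chi_rpow_le {p q : ℂ} (h : ‖p‖ ^ 2 + ‖q‖ ^ 2 = 1) {a : ℝ} (ha : 0 < a) {γ : ℝ}
    (hγ0 : 0 < γ) (hγ1 : γ ≤ 1) :
    Integrable (fun z => Real.sqrt (distSq p q z) ^ γ) (chi p q a) ∧
    ∫ z, Real.sqrt (distSq p q z) ^ γ ∂chi p q a ≤ 2 * a ^ γ := by
  obtain ⟨hn, hb⟩ := integrable_norm_fs_and_integral_le
  have hm : Measurable (fun z => Real.sqrt (distSq p q z) ^ γ) :=
    (continuous_distSq p q).measurable.sqrt.pow_const γ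
  have hle1 : ∀ z, Real.sqrt (distSq p q z) ^ γ ≤ 1 := fun z =>
    Real.rpow_le_one (Real.sqrt_nonneg _)
      (Real.sqrt_le_one.mpr (distSq_le_one h z)) hγ0.le
  have hi : Integrable (fun z => Real.sqrt (distSq p q z) ^ γ) (chi p q a) := by
    refine (integrable_const (1 : ℝ)).mono' hm.aestronglyMeasurable (ae_of_all _ fun z => ?_)
    rw [Real.norm_of_nonneg (by positivity)]
    exact hle1 z
  refine ⟨hi, ?_⟩
  have hmob := (measurable_mob p q a).aemeasurable (μ := fs)
  rw [chi, integral_map hmob hm.aestronglyMeasurable]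
  have hi' : Integrable (fun w => Real.sqrt (distSq p q (mob p q a w)) ^ γ) fs :=
    (integrable_map_measure hm.aestronglyMeasurable hmob).mp hi
  have hJ : Integrable (fun w : ℂ => a ^ γ * (γ * ‖w‖ + (1 - γ))) fs :=
    ((hn.const_mul γ).add (integrable_const _)).const_mul _
  have hae : (fun w => Real.sqrt (distSq p q (mob p q a w)) ^ γ) ≤ᵐ[fs]
      fun w : ℂ => a ^ γ * (γ * ‖w‖ + (1 - γ)) := by
    filter_upwards [fs_absolutelyContinuous.ae_le (ae_pole h ha)] with w hw
    have h1 : Real.sqrt (distSq p q (mob p q a w)) ≤ a * ‖w‖ := by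
      rw [distSq_mob h hw, Real.sqrt_le_left (by positivity), mul_pow]
      refine div_le_self (by positivity) ?_
      nlinarith [sq_nonneg (a * ‖w‖)]
    have h2 := Real.rpow_le_rpow (Real.sqrt_nonneg _) h1 hγ0.le
    rw [Real.mul_rpow ha.le (norm_nonneg w)] at h2
    -- The bound `‖w‖^γ ≤ γ ‖w‖ + 1 - γ` reduces every moment to the first one, which is at most
    -- `2`; the total is at most `1 + γ ≤ 2`.
    have h3 := Real.geom_mean_le_arith_mean2_weighted hγ0.le (by linarith : 0 ≤ 1 - γ)
      (norm_nonneg w) zero_le_one (by ring)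
    rw [Real.one_rpow, mul_one, mul_one] at h3
    exact h2.trans (mul_le_mul_of_nonneg_left h3 (by positivity))
  refine (integral_mono_ae hi' hJ hae).trans ?_
  rw [integral_const_mul, integral_add (hn.const_mul γ) (integrable_const _), integral_const_mul]
  simp only [integral_const, probReal_univ, smul_eq_mul, one_mul]
  rw [mul_comm]
  refine mul_le_mul_of_nonneg_right ?_ (Real.rpow_pos_of_pos ha γ).le
  nlinarith

end QuasiFekete

end

noncomputable section

namespace QuasiFekete

open Filter Topology ComplexConjugate

/-! ### The potential of a regularized point mass -/

lemma contDiff_quad (p q : ℂ) (a : ℝ) : ContDiff ℝ ∞ (quad p q a) := by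
  unfold quad
  exact ((contDiff_const.sub (contDiff_const.mul contDiff_id)).norm_sq ℝ).add
    (contDiff_const.mul (((contDiff_const.mul contDiff_id).add contDiff_const).norm_sq ℝ))

lemma pd_log {Q : ℂ → ℝ} (hQ : ContDiff ℝ ∞ Q) (h0 : ∀ z, 0 < Q z) (v z : ℂ) :
    pd v (fun t => Real.log (Q t)) z = pd v Q z / Q z := by
  unfold pd
  rw [((differentiable_of_smooth hQ z).hasFDerivAt.log (h0 z).ne').fderiv]
  simp [div_eq_inv_mul]

lemma pd_div {f g : ℂ → ℝ} (hf : ContDiff ℝ ∞ f) (hg : ContDiff ℝ ∞ g) (h0 : ∀ z, 0 < g z)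
    (v z : ℂ) :
    pd v (fun t => f t / g t) z = (pd v f z * g z - f z * pd v g z) / g z ^ 2 := by
  unfold pd
  have h1 : HasFDerivAt (fun t => (g t)⁻¹) _ z :=
    (hasDerivAt_inv (h0 z).ne').comp_hasFDerivAt z (differentiable_of_smooth hg z).hasFDerivAt
  have h2 : HasFDerivAt (fun t => f t * (g t)⁻¹) _ z :=
    (differentiable_of_smooth hf z).hasFDerivAt.mul h1
  have e : (fun t => f t / g t) = fun t => f t * (g t)⁻¹ := by
    ext t
    exact div_eq_mul_inv _ _
  rw [e, h2.fderiv]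
  have := (h0 z).ne'
  simp
  field_simp
  ring

lemma laplacian_log {Q : ℂ → ℝ} (hQ : ContDiff ℝ ∞ Q) (h0 : ∀ z, 0 < Q z) (z : ℂ) :
    Laplacian.laplacian (fun t => Real.log (Q t)) z =
      (Laplacian.laplacian Q z * Q z - (pd 1 Q z ^ 2 + pd Complex.I Q z ^ 2)) / Q z ^ 2 := by
  have hl : ContDiff ℝ ∞ (fun t => Real.log (Q t)) := hQ.log fun z => (h0 z).ne'
  have h : ∀ v, pd v (pd v (fun t => Real.log (Q t))) z =
      (pd v (pd v Q) z * Q z - pd v Q z * pd v Q z) / Q z ^ 2 := by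
    intro v
    have e : pd v (fun t => Real.log (Q t)) = fun t => pd v Q t / Q t := by
      ext t
      exact pd_log hQ h0 v t
    rw [e, pd_div (contDiff_pd hQ v) hQ h0]
  rw [laplacian_eq_pd hl, h, h, laplacian_eq_pd hQ]
  ring

/-- Coefficients of the quadratic polynomial `quad p q a`. -/
lemma quad_eq (p q : ℂ) (a : ℝ) (z : ℂ) :
    quad p q a z = (‖q‖ ^ 2 + a ^ 2 * ‖p‖ ^ 2) * (z.re ^ 2 + z.im ^ 2)
      - 2 * (1 - a ^ 2) * (p.re * q.re + p.im * q.im) * z.re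
      + 2 * (1 - a ^ 2) * (p.re * q.im - p.im * q.re) * z.im
      + (‖p‖ ^ 2 + a ^ 2 * ‖q‖ ^ 2) := by
  unfold quad
  simp only [Complex.sq_norm, Complex.normSq_apply, Complex.sub_re, Complex.sub_im, Complex.mul_re,
    Complex.mul_im, Complex.add_re, Complex.add_im, Complex.conj_re, Complex.conj_im]
  ring

lemma hasFDerivAt_quadratic (A B C D : ℝ) (z : ℂ) :
    HasFDerivAt (fun z : ℂ => A * (z.re ^ 2 + z.im ^ 2) + B * z.re + C * z.im + D)
      ((2 * A * z.re + B) • Complex.reCLM + (2 * A * z.im + C) • Complex.imCLM) z := by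
  have hr : HasFDerivAt (fun z : ℂ => z.re) Complex.reCLM z := Complex.reCLM.hasFDerivAt
  have hi : HasFDerivAt (fun z : ℂ => z.im) Complex.imCLM z := Complex.imCLM.hasFDerivAt
  have hr2 : HasFDerivAt (fun z : ℂ => z.re ^ 2) _ z := (hasDerivAt_pow 2 z.re).comp_hasFDerivAt z hr
  have hi2 : HasFDerivAt (fun z : ℂ => z.im ^ 2) _ z := (hasDerivAt_pow 2 z.im).comp_hasFDerivAt z hi
  refine HasFDerivAt.congr_fderiv ((((hr2.add hi2).const_mul A).add
    (hr.const_mul B)).add (hi.const_mul C) |>.add_const D) ?_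
  ext
  · simp
    ring

lemma laplacian_quadratic (A B C D : ℝ) (z : ℂ) :
    Laplacian.laplacian (fun z : ℂ => A * (z.re ^ 2 + z.im ^ 2) + B * z.re + C * z.im + D) z =
      4 * A ∧
    pd 1 (fun z : ℂ => A * (z.re ^ 2 + z.im ^ 2) + B * z.re + C * z.im + D) z =
      2 * A * z.re + B ∧
    pd Complex.I (fun z : ℂ => A * (z.re ^ 2 + z.im ^ 2) + B * z.re + C * z.im + D) z =
      2 * A * z.im + C := by
  have hre : ContDiff ℝ ∞ (fun z : ℂ => z.re) := Complex.reCLM.contDiff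
  have him : ContDiff ℝ ∞ (fun z : ℂ => z.im) := Complex.imCLM.contDiff
  have hs : ContDiff ℝ ∞
      (fun z : ℂ => A * (z.re ^ 2 + z.im ^ 2) + B * z.re + C * z.im + D) :=
    (((contDiff_const.mul ((hre.pow 2).add (him.pow 2))).add (contDiff_const.mul hre)).add
      (contDiff_const.mul him)).add contDiff_const
  have e1 : pd 1 (fun z : ℂ => A * (z.re ^ 2 + z.im ^ 2) + B * z.re + C * z.im + D) =
      fun z => 2 * A * z.re + B := by
    ext z
    rw [pd, (hasFDerivAt_quadratic A B C D z).fderiv]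
    simp
  have e2 : pd Complex.I (fun z : ℂ => A * (z.re ^ 2 + z.im ^ 2) + B * z.re + C * z.im + D) =
      fun z => 2 * A * z.im + C := by
    ext z
    rw [pd, (hasFDerivAt_quadratic A B C D z).fderiv]
    simp
  refine ⟨?_, congrFun e1 z, congrFun e2 z⟩
  rw [laplacian_eq_pd hs, e1, e2]
  have f1 := hasFDerivAt_quadratic 0 (2 * A) 0 B z
  have f2 := hasFDerivAt_quadratic 0 0 (2 * A) C z
  simp only [zero_mul, zero_add, add_zero, mul_zero] at f1 f2
  rw [pd, pd, f1.fderiv, f2.fderiv]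
  simp
  ring

/-- For the quadratic polynomial `Q`, the expression `Q ΔQ - |∇Q|²` is constant. It equals `4a²` for
a unit vector, so only `4a² / Q²` remains. -/
lemma laplacian_log_quad {p q : ℂ} (h : ‖p‖ ^ 2 + ‖q‖ ^ 2 = 1) {a : ℝ} (ha : 0 < a) (z : ℂ) :
    Laplacian.laplacian (fun t => Real.log (quad p q a t)) z = 4 * Real.pi * chiDensity p q a z := by
  have e : quad p q a = fun z : ℂ => (‖q‖ ^ 2 + a ^ 2 * ‖p‖ ^ 2) * (z.re ^ 2 + z.im ^ 2)
      + (-(2 * (1 - a ^ 2) * (p.re * q.re + p.im * q.im))) * z.re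
      + (2 * (1 - a ^ 2) * (p.re * q.im - p.im * q.re)) * z.im
      + (‖p‖ ^ 2 + a ^ 2 * ‖q‖ ^ 2) := by
    ext z
    rw [quad_eq]
    ring
  obtain ⟨h1, h2, h3⟩ := laplacian_quadratic (‖q‖ ^ 2 + a ^ 2 * ‖p‖ ^ 2)
    (-(2 * (1 - a ^ 2) * (p.re * q.re + p.im * q.im)))
    (2 * (1 - a ^ 2) * (p.re * q.im - p.im * q.re)) (‖p‖ ^ 2 + a ^ 2 * ‖q‖ ^ 2) z
  rw [← e] at h1 h2 h3
  rw [laplacian_log (contDiff_quad p q a) (quad_pos h ha), h1, h2, h3, chiDensity]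
  have hp := (quad_pos h ha z).ne'
  have hπ := Real.pi_ne_zero
  rw [mul_div_assoc', div_eq_div_iff (by positivity) (by positivity)]
  have key : 4 * (‖q‖ ^ 2 + a ^ 2 * ‖p‖ ^ 2) * quad p q a z
      - ((2 * (‖q‖ ^ 2 + a ^ 2 * ‖p‖ ^ 2) * z.re +
          -(2 * (1 - a ^ 2) * (p.re * q.re + p.im * q.im))) ^ 2 +
        (2 * (‖q‖ ^ 2 + a ^ 2 * ‖p‖ ^ 2) * z.im +
          2 * (1 - a ^ 2) * (p.re * q.im - p.im * q.re)) ^ 2)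
      = 4 * a ^ 2 * (‖p‖ ^ 2 + ‖q‖ ^ 2) ^ 2 := by
    rw [quad_eq]
    simp only [Complex.sq_norm, Complex.normSq_apply]
    ring
  rw [key, h]
  ring

lemma regLog_eq {p q : ℂ} (h : ‖p‖ ^ 2 + ‖q‖ ^ 2 = 1) {a : ℝ} (ha : 0 < a) :
    regLog p q a = fun z =>
      1 / 2 * (Real.log (quad p q a z) - Real.log (quad p q 1 z)) := by
  ext z
  rw [regLog, reg_eq_quad h, quad_one h, Real.log_div (quad_pos h ha z).ne' (by positivity)]

lemma contDiff_log_quad {p q : ℂ} (h : ‖p‖ ^ 2 + ‖q‖ ^ 2 = 1) {a : ℝ} (ha : 0 < a) :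
    ContDiff ℝ ∞ (fun z => Real.log (quad p q a z)) :=
  (contDiff_quad p q a).log fun z => (quad_pos h ha z).ne'

lemma contDiff_regLog {p q : ℂ} (h : ‖p‖ ^ 2 + ‖q‖ ^ 2 = 1) {a : ℝ} (ha : 0 < a) :
    ContDiff ℝ ∞ (regLog p q a) := by
  rw [regLog_eq h ha]
  exact contDiff_const.mul ((contDiff_log_quad h ha).sub (contDiff_log_quad h one_pos))

lemma laplacian_regLog {p q : ℂ} (h : ‖p‖ ^ 2 + ‖q‖ ^ 2 = 1) {a : ℝ} (ha : 0 < a) (z : ℂ) :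
    Laplacian.laplacian (regLog p q a) z =
      2 * Real.pi * (chiDensity p q a z - fsDensity z) := by
  have e0 : chiDensity p q 1 z = fsDensity z := by
    rw [chiDensity, quad_one h, fsDensity, one_pow]
  have hA := contDiff_log_quad h ha
  have hB := contDiff_log_quad h one_pos
  have e : regLog p q a = (1 / 2 : ℝ) • ((fun z => Real.log (quad p q a z)) -
      fun z => Real.log (quad p q 1 z)) := by
    rw [regLog_eq h ha]
    rfl
  have hs := (contDiff_infty.mp hA 2).contDiffAt (x := z)
  have ht := (contDiff_infty.mp hB 2).contDiffAt (x := z)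
  rw [e, InnerProductSpace.laplacian_smul (f := (fun z => Real.log (quad p q a z)) -
    fun z => Real.log (quad p q 1 z)) _ (hs.sub ht), hs.laplacian_sub ht,
    laplacian_log_quad h ha, laplacian_log_quad h one_pos, e0, smul_eq_mul]
  ring

lemma integrable_chiDensity {p q : ℂ} (h : ‖p‖ ^ 2 + ‖q‖ ^ 2 = 1) {a : ℝ} (ha : 0 < a) :
    Integrable (chiDensity p q a) := by
  -- A nonintegrable function has Bochner integral zero, so the value one already proves
  -- integrability.
  refine Integrable.of_integral_ne_zero ?_
  have := integral_fs_comp_mob h ha (fun _ => 1)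
  simp only [integral_const, probReal_univ, smul_eq_mul, mul_one] at this
  rw [← this]
  exact one_ne_zero

lemma integrable_fsDensity : Integrable fsDensity := by
  refine Integrable.of_integral_ne_zero ?_
  have := integral_fs (fun _ => 1)
  simp only [integral_const, probReal_univ, smul_eq_mul, mul_one] at this
  rw [← this]
  exact one_ne_zero

/-- Bounded measurable functions are allowed, not only test functions, so that the potential `g`,
which is merely continuous on the sphere, can be inserted for `F`. -/
lemma integral_chi_sub_fs {p q : ℂ} (h : ‖p‖ ^ 2 + ‖q‖ ^ 2 = 1) {a : ℝ} (ha : 0 < a)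
    {F : ℂ → ℝ} (hF : Measurable F) {M : ℝ} (hM : ∀ z, |F z| ≤ M) :
    1 / (2 * Real.pi) * ∫ z, F z * Laplacian.laplacian (regLog p q a) z =
      (∫ z, F z ∂chi p q a) - ∫ z, F z ∂fs := by
  have j1 : Integrable (fun z => chiDensity p q a z * F z) :=
    (integrable_chiDensity h ha).mul_bdd (c := M) hF.aestronglyMeasurable (ae_of_all _ hM)
  have j2 : Integrable (fun z => fsDensity z * F z) :=
    integrable_fsDensity.mul_bdd (c := M) hF.aestronglyMeasurable (ae_of_all _ hM)
  rw [integral_chi h ha hF, integral_fs, ← integral_sub j1 j2, ← integral_const_mul]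
  congr 1 with z
  rw [laplacian_regLog h ha]
  have := Real.pi_ne_zero
  field_simp

/-- The function `regLog p q a` is a potential of `chi p q a - fs`. -/
lemma isPlanarPotential_regLog {p q : ℂ} (h : ‖p‖ ^ 2 + ‖q‖ ^ 2 = 1) {a : ℝ} (ha : 0 < a) :
    IsPlanarPotential (chi p q a) fs (regLog p q a) := by
  intro ψ hψ hc
  obtain ⟨M, hM⟩ := hc.exists_bound_of_continuous hψ.continuous
  rw [integral_mul_laplacian_comm (contDiff_regLog h ha) hψ hc,
    integral_chi_sub_fs h ha hψ.continuous.measurable hM]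

/-! ### A mean value inequality -/

lemma integral_fs_comp_rotation (c : Circle) (F : ℂ → ℝ) :
    ∫ w, F (c * w) ∂fs = ∫ w, F w ∂fs := by
  rw [integral_fs, integral_fs]
  have h := (rotation c).measurePreserving.integral_comp
    (rotation c).toHomeomorph.measurableEmbedding (fun z => fsDensity z * F z)
  rw [← h]
  congr 1 with z
  simp [fsDensity, rotation_apply, Circle.norm_coe]

lemma integrable_fs_comp_rotation (c : Circle) {F : ℂ → ℝ} (hm : Measurable F)
    (hF : Integrable F fs) : Integrable (fun w => F (c * w)) fs := by
  have hmap : Measure.map (fun w : ℂ => (c : ℂ) * w) fs = fs := by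
    refine Measure.ext_of_lintegral _ fun f hf => ?_
    have hc : Measurable fun w : ℂ => (c : ℂ) * w := by fun_prop
    have hd := continuous_fsDensity.measurable.ennreal_ofReal
    rw [lintegral_map hf hc, fs, lintegral_withDensity_eq_lintegral_mul _ hd
      (g := fun w : ℂ => f ((c : ℂ) * w)) (hf.comp hc), lintegral_withDensity_eq_lintegral_mul _ hd hf]
    have h := (rotation c).measurePreserving.lintegral_comp_emb
      (rotation c).toHomeomorph.measurableEmbedding
      ((fun z => ENNReal.ofReal (fsDensity z)) * f)
    rw [← h]
    congr 1 with z
    simp [fsDensity, rotation_apply, Circle.norm_coe]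
  have hc : Measurable fun w : ℂ => (c : ℂ) * w := by fun_prop
  rw [← hmap] at hF
  exact (integrable_map_measure hm.aestronglyMeasurable hc.aemeasurable).mp hF

/-- Jensen's formula: for `b ≠ 0` the average over the unit circle is the larger of `log ‖b‖` and
`log ‖c‖`. -/
lemma log_norm_le_circleAverage (b c : ℂ) (hc : c ≠ 0) :
    CircleIntegrable (fun z => Real.log ‖c + b * z‖) 0 1 ∧
    Real.log ‖c‖ ≤ Real.circleAverage (fun z => Real.log ‖c + b * z‖) 0 1 := by
  have hci : CircleIntegrable (fun z => Real.log ‖c + b * z‖) 0 1 :=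
    MeromorphicOn.circleIntegrable_log_norm (fun z hz => by fun_prop)
  refine ⟨hci, ?_⟩
  rcases eq_or_ne b 0 with rfl | hb
  · simp [Real.circleAverage_const]
  have e : Real.circleAverage (fun z => Real.log ‖c + b * z‖) 0 1 =
      Real.circleAverage (fun z => Real.log ‖b‖ + Real.log ‖z + c / b‖) 0 1 := by
    -- The logarithm of the product splits except at the zero of the affine form, where `Real.log 0
    -- = 0` spoils the identity.
    apply Real.circleAverage_congr_codiscreteWithin _ one_ne_zero
    have : {z : ℂ | z + c / b ≠ 0} ∈ Filter.codiscreteWithin (Metric.sphere (0 : ℂ) |1|) := by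
      apply codiscreteWithin_iff_locallyFiniteComplementWithin.2
      intro z hz
      refine ⟨Set.univ, Filter.univ_mem, Set.Subsingleton.finite ?_⟩
      intro z₁ hz₁ z₂ hz₂
      have h1 : z₁ + c / b = 0 := not_not.mp hz₁.2.2
      have h2 : z₂ + c / b = 0 := not_not.mp hz₂.2.2
      rw [add_eq_zero_iff_eq_neg.1 h1, add_eq_zero_iff_eq_neg.1 h2]
    filter_upwards [this] with z hz
    rw [← Real.log_mul (norm_ne_zero_iff.mpr hb) (norm_ne_zero_iff.mpr hz), ← norm_mul]
    congr 2
    field_simp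
    ring
  rw [e, Real.circleAverage_fun_add (circleIntegrable_const _ 0 1)
    (MeromorphicOn.circleIntegrable_log_norm (fun _ _ => by fun_prop)), Real.circleAverage_const,
    circleAverage_log_norm_add_const_eq_posLog]
  have h1 : Real.log ‖c / b‖ ≤ Real.posLog ‖c / b‖ := le_max_right _ _
  rw [norm_div, Real.log_div (norm_ne_zero_iff.mpr hc) (norm_ne_zero_iff.mpr hb)] at h1
  rw [norm_div]
  linarith

/-- A function that dominates `log ‖c + b w‖` has average at least `log ‖c‖` for a rotation
invariant probability measure. -/
lemma log_norm_le_integral_fs {F : ℂ → ℝ} (hm : Measurable F) (hF : Integrable F fs) {b c : ℂ}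
    (hc : c ≠ 0) (hle : ∀ w, c + b * w ≠ 0 → Real.log ‖c + b * w‖ ≤ F w) :
    Real.log ‖c‖ ≤ ∫ w, F w ∂fs := by
  have hπ := Real.two_pi_pos
  set ν : Measure ℝ := volume.restrict (Set.Ioc 0 (2 * Real.pi)) with hν
  have hmeas : Measurable fun x : ℝ × ℂ => F ((Circle.exp x.1 : ℂ) * x.2) := by
    refine hm.comp ?_
    have : Continuous fun x : ℝ × ℂ => (Circle.exp x.1 : ℂ) * x.2 := by fun_prop
    exact this.measurable
  have hint : Integrable (fun x : ℝ × ℂ => F ((Circle.exp x.1 : ℂ) * x.2)) (ν.prod fs) := by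
    rw [integrable_prod_iff hmeas.aestronglyMeasurable]
    refine ⟨ae_of_all _ fun θ => integrable_fs_comp_rotation (Circle.exp θ) hm hF, ?_⟩
    have : (fun θ : ℝ => ∫ w, ‖F ((Circle.exp θ : ℂ) * w)‖ ∂fs) = fun _ => ∫ w, ‖F w‖ ∂fs := by
      ext θ
      exact integral_fs_comp_rotation (Circle.exp θ) fun w => ‖F w‖
    simp only [this]
    exact integrable_const _
  -- Averaging over rotations does not change the integral of `F`, and after Fubini each orbit is a
  -- circle centred at the origin, where Jensen applies.
  have hswap := integral_integral_swap (f := fun (θ : ℝ) (w : ℂ) => F ((Circle.exp θ : ℂ) * w)) hint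
  simp only [integral_fs_comp_rotation, integral_const, smul_eq_mul] at hswap
  have hvol : ν.real Set.univ = 2 * Real.pi := by
    rw [hν, measureReal_restrict_apply_univ, Real.volume_real_Ioc_of_le hπ.le, sub_zero]
  rw [hvol] at hswap
  have hlow : ∫ _ : ℂ, 2 * Real.pi * Real.log ‖c‖ ∂fs ≤
      ∫ w, ∫ θ, F ((Circle.exp θ : ℂ) * w) ∂ν ∂fs := by
    refine integral_mono_ae (integrable_const _) hint.integral_prod_right ?_
    filter_upwards [hint.prod_left_ae] with w hw
    obtain ⟨h1, h2⟩ := log_norm_le_circleAverage (b * w) c hc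
    rw [Real.circleAverage_def, smul_eq_mul, inv_mul_eq_div, le_div_iff₀ hπ, mul_comm] at h2
    refine h2.trans ?_
    rw [intervalIntegral.integral_of_le hπ.le]
    have h1' := h1.1
    refine integral_mono_ae h1' hw ?_
    have hcount : {z : ℂ | c + b * w * z = 0}.Countable :=
      (subsingleton_affine_zero (fun h => hc h.2)).countable
    have hnull := (hcount.preimage_circleMap 0 one_ne_zero).measure_zero volume
    have hae : ∀ᵐ θ ∂ν, circleMap 0 1 θ ∉ {z : ℂ | c + b * w * z = 0} :=
      ae_restrict_of_ae (measure_eq_zero_iff_ae_notMem.mp hnull)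
    filter_upwards [hae] with θ hθ
    have e : circleMap 0 1 θ = (Circle.exp θ : ℂ) := by simp [circleMap]
    rw [e] at hθ ⊢
    have := hle ((Circle.exp θ : ℂ) * w)
    rw [show c + b * ((Circle.exp θ : ℂ) * w) = c + b * w * (Circle.exp θ : ℂ) by ring] at this
    exact this hθ
  rw [integral_const, probReal_univ, one_smul, ← hswap] at hlow
  exact le_of_mul_le_mul_left hlow hπ

/-- The integral of the regularized logarithmic distance against a regularized point mass. -/
lemma le_integral_regLog_chi {p q p' q' : ℂ} (h : ‖p‖ ^ 2 + ‖q‖ ^ 2 = 1)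
    (h' : ‖p'‖ ^ 2 + ‖q'‖ ^ 2 = 1) {a : ℝ} (ha : 0 < a) (ha1 : a ≤ 1) (hne : p * q' - q * p' ≠ 0) :
    Real.log ‖p * q' - q * p'‖ - a ≤ ∫ z, regLog p q a z ∂chi p' q' a := by
  have hr := (continuous_regLog h ha1 ha).measurable
  have hmob := measurable_mob p' q' a
  obtain ⟨i1, i2⟩ := integral_log_one_add_le ha.le
  have i0 : Integrable (fun w => regLog p q a (mob p' q' a w)) fs :=
    (integrable_map_measure hr.aestronglyMeasurable hmob.aemeasurable).mp
      (integrable_regLog h ha1 ha (chi p' q' a))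
  rw [chi, integral_map hmob.aemeasurable hr.aestronglyMeasurable]
  -- Along the second Möbius map, `p - q z` becomes `(c + b w)` over the denominator of the map, and
  -- `‖c‖` is the spherical distance between the two centres.
  set b : ℂ := a * (p * conj p' + q * conj q') with hb
  set c : ℂ := p * q' - q * p' with hcdef
  classical
  -- The value at the pole is patched so that the domination holds wherever `c + b w ≠ 0`; this does
  -- not affect the integral. The extra logarithm compensates the denominator of `distSq` and costs
  -- at most `a` on average.
  set F : ℂ → ℝ := fun w => if q' + a * conj p' * w = 0 then Real.log ‖c + b * w‖ else
    regLog p q a (mob p' q' a w) + 1 / 2 * Real.log (1 + a ^ 2 * ‖w‖ ^ 2) with hFdef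
  have hpole : ∀ᵐ w ∂fs, q' + a * conj p' * w ≠ 0 :=
    fs_absolutelyContinuous.ae_le (ae_pole h' ha)
  have hFe : F =ᵐ[fs] fun w => regLog p q a (mob p' q' a w)
      + 1 / 2 * Real.log (1 + a ^ 2 * ‖w‖ ^ 2) := by
    filter_upwards [hpole] with w hw
    simp [hFdef, hw]
  have hFm : Measurable F := by
    refine Measurable.ite (measurableSet_eq_fun (by fun_prop) (by fun_prop)) (by fun_prop) ?_
    exact (hr.comp hmob).add (by fun_prop)
  have key := log_norm_le_integral_fs hFm ((i0.add i1).congr hFe.symm) (b := b) hne ?_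
  · rw [integral_congr_ae hFe, integral_add i0 i1] at key
    linarith
  intro w hw
  by_cases hS : q' + a * conj p' * w = 0
  · simp [hFdef, hS]
  simp only [hFdef, hS, if_false]
  have hS' : ‖q' + a * conj p' * w‖ ≠ 0 := norm_ne_zero_iff.mpr hS
  have hnum : p - q * mob p' q' a w = (c + b * w) / (q' + a * conj p' * w) := by
    have hm : mob p' q' a w * (q' + a * conj p' * w) = p' - a * conj q' * w :=
      div_mul_cancel₀ _ hS
    rw [eq_div_iff hS, hb, hcdef]
    linear_combination -q * hm
  have hd : distSq p q (mob p' q' a w) = ‖c + b * w‖ ^ 2 / (1 + a ^ 2 * ‖w‖ ^ 2) := by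
    rw [distSq, one_add_norm_mob_sq h' hS, hnum, norm_div, div_pow, div_div_div_cancel_right₀
      (pow_ne_zero 2 hS')]
  have hpos : 0 < ‖c + b * w‖ := norm_pos_iff.mpr hw
  have hpos' : 0 < 1 + a ^ 2 * ‖w‖ ^ 2 := by positivity
  have := log_distSq_le_regLog h ha1 ha (z := mob p' q' a w) (by rw [hd]; positivity)
  rw [hd, Real.log_div (by positivity) hpos'.ne', Real.log_pow] at this
  push_cast at this
  linarith

end QuasiFekete

end

noncomputable section

namespace QuasiFekete

open Filter Topology ComplexConjugate

/-! ### Topology of the projective line -/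

lemma exists_unit_rep (x : P1) : ∃ p q : ℂ, ∃ h : (!₂[p, q] : EuclideanSpace ℂ (Fin 2)) ≠ 0,
    ‖p‖ ^ 2 + ‖q‖ ^ 2 = 1 ∧ x = Projectivization.mk ℂ !₂[p, q] h := by
  have h0 : ‖x.rep‖ ≠ 0 := norm_ne_zero_iff.mpr x.rep_nonzero
  set c : ℂ := ((‖x.rep‖⁻¹ : ℝ) : ℂ) with hc
  have hc0 : c ≠ 0 := by
    rw [hc]
    exact_mod_cast inv_ne_zero h0
  have e : (!₂[c * x.rep 0, c * x.rep 1] : EuclideanSpace ℂ (Fin 2)) = c • x.rep := by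
    ext i
    fin_cases i <;> simp
  have hn : ‖c • x.rep‖ = 1 := by
    rw [norm_smul, hc, Complex.norm_real, norm_inv, norm_norm, inv_mul_cancel₀ h0]
  have hne : (!₂[c * x.rep 0, c * x.rep 1] : EuclideanSpace ℂ (Fin 2)) ≠ 0 := by
    rw [e]
    exact smul_ne_zero hc0 x.rep_nonzero
  refine ⟨c * x.rep 0, c * x.rep 1, hne, ?_, ?_⟩
  · rw [← e, EuclideanSpace.norm_eq, Real.sqrt_eq_one] at hn
    simpa [Fin.sum_univ_two] using hn
  · conv_lhs => rw [← Projectivization.mk_rep x]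
    rw [Projectivization.mk_eq_mk_iff']
    refine ⟨c⁻¹, ?_⟩
    rw [e, smul_smul, inv_mul_cancel₀ hc0, one_smul]

lemma norm_vec (p q : ℂ) : ‖(!₂[p, q] : EuclideanSpace ℂ (Fin 2))‖ = Real.sqrt (‖p‖ ^ 2 + ‖q‖ ^ 2) := by
  simp [EuclideanSpace.norm_eq, Fin.sum_univ_two]

lemma sphDist_mk_mk {p q r s : ℂ} (h : (!₂[p, q] : EuclideanSpace ℂ (Fin 2)) ≠ 0)
    (h' : (!₂[r, s] : EuclideanSpace ℂ (Fin 2)) ≠ 0) :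
    sphDist (Projectivization.mk ℂ _ h) (Projectivization.mk ℂ _ h') =
      ‖p * s - q * r‖ / (Real.sqrt (‖p‖ ^ 2 + ‖q‖ ^ 2) * Real.sqrt (‖r‖ ^ 2 + ‖s‖ ^ 2)) := by
  rw [sphDist_mk, chordal, norm_vec, norm_vec]
  simp

lemma sphDist_mk_affine {p q : ℂ} (h : (!₂[p, q] : EuclideanSpace ℂ (Fin 2)) ≠ 0)
    (hu : ‖p‖ ^ 2 + ‖q‖ ^ 2 = 1) (z : ℂ) :
    sphDist (Projectivization.mk ℂ _ h) (affine z) = Real.sqrt (distSq p q z) := by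
  rw [affine, sphDist_mk_mk, hu, distSq, Real.sqrt_div (sq_nonneg _), Real.sqrt_sq (norm_nonneg _)]
  simp [add_comm]

lemma sphDist_nonneg (x y : P1) : 0 ≤ sphDist x y := by
  unfold sphDist chordal
  positivity

lemma sphDist_comm (x y : P1) : sphDist x y = sphDist y x := by
  unfold sphDist chordal
  rw [← norm_neg, mul_comm ‖x.rep‖]
  congr 2
  ring

lemma sphDist_le_one (x y : P1) : sphDist x y ≤ 1 := by
  obtain ⟨p, q, h, hu, rfl⟩ := exists_unit_rep x
  obtain ⟨r, s, h', hu', rfl⟩ := exists_unit_rep y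
  rw [sphDist_mk_mk, hu, hu', Real.sqrt_one, mul_one, div_one]
  have h1 : ‖p * s - q * r‖ ≤ ‖p‖ * ‖s‖ + ‖q‖ * ‖r‖ := by
    refine (norm_sub_le _ _).trans ?_
    rw [norm_mul, norm_mul]
  nlinarith [sq_nonneg (‖p‖ - ‖s‖), sq_nonneg (‖q‖ - ‖r‖)]

lemma sphDist_self (x : P1) : sphDist x x = 0 := by
  unfold sphDist chordal
  simp [mul_comm]

lemma eq_of_sphDist_eq_zero {x y : P1} (hxy : sphDist x y = 0) : x = y := by
  obtain ⟨p, q, h, hu, rfl⟩ := exists_unit_rep x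
  obtain ⟨r, s, h', hu', rfl⟩ := exists_unit_rep y
  rw [sphDist_mk_mk, hu, hu', Real.sqrt_one, mul_one, div_one, norm_eq_zero] at hxy
  rw [Projectivization.mk_eq_mk_iff']
  have e1 := conj_mul_add_mul_conj hu'
  -- The scalar is the Hermitian product with the unit vector `(r, s)`, that is, the coefficient of
  -- the orthogonal projection.
  refine ⟨p * conj r + q * conj s, ?_⟩
  ext i
  fin_cases i
  · simp
    linear_combination p * e1 - conj s * hxy
  · simp
    linear_combination q * e1 + conj r * hxy

lemma sphDist_pos {x y : P1} (hxy : x ≠ y) : 0 < sphDist x y :=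
  (sphDist_nonneg x y).lt_of_ne' fun h => hxy (eq_of_sphDist_eq_zero h)

lemma continuous_mk : Continuous
    (fun v : {v : EuclideanSpace ℂ (Fin 2) // v ≠ 0} => Projectivization.mk ℂ v.1 v.2) :=
  continuous_coinduced_rng

lemma continuous_affine : Continuous affine := by
  have : Continuous fun z : ℂ => (⟨!₂[z, (1 : ℂ)], vec_snd_ne_zero z⟩ :
      {v : EuclideanSpace ℂ (Fin 2) // v ≠ 0}) := by
    refine Continuous.subtype_mk ?_ _
    fun_prop
  exact continuous_mk.comp this

lemma continuous_atInfty : Continuous atInfty := by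
  have : Continuous fun z : ℂ => (⟨!₂[(1 : ℂ), z], vec_fst_ne_zero z⟩ :
      {v : EuclideanSpace ℂ (Fin 2) // v ≠ 0}) := by
    refine Continuous.subtype_mk ?_ _
    fun_prop
  exact continuous_mk.comp this

lemma continuous_sphDist_left (x : P1) : Continuous (sphDist x) := by
  refine continuous_coinduced_dom.mpr ?_
  have : (sphDist x) ∘ (fun v : {v : EuclideanSpace ℂ (Fin 2) // v ≠ 0} =>
      Projectivization.mk ℂ v.1 v.2) = fun v => chordal x.rep v.1 := by
    ext v
    simp only [Function.comp_apply]
    conv_lhs => rw [← Projectivization.mk_rep x]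
    exact sphDist_mk _ _ _ _
  rw [this]
  unfold chordal
  refine Continuous.div (by fun_prop) (by fun_prop) fun v => ?_
  exact mul_ne_zero (norm_ne_zero_iff.mpr x.rep_nonzero) (norm_ne_zero_iff.mpr v.2)

/-- Points are separated by the continuous function `sphDist x`. The Hausdorff property lets the
continuous injection `affine` be a measurable embedding. -/
instance : T2Space P1 := by
  refine ⟨fun x y hxy => ?_⟩
  have hd := sphDist_pos hxy
  have hc := continuous_sphDist_left x
  refine ⟨{z | sphDist x z < sphDist x y / 2}, {z | sphDist x y / 2 < sphDist x z},
    isOpen_lt hc continuous_const, isOpen_lt continuous_const hc, ?_, ?_, ?_⟩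
  · simpa [sphDist_self] using hd
  · simpa using hd
  · refine Set.disjoint_left.mpr fun z h1 h2 => ?_
    exact lt_asymm (Set.mem_ofPred_eq.mp h1) h2

lemma affine_injective : Function.Injective affine := by
  intro z w hzw
  rw [affine, affine, Projectivization.mk_eq_mk_iff'] at hzw
  obtain ⟨a, ha⟩ := hzw
  have h1 : a = 1 := by simpa using congrArg (fun v : EuclideanSpace ℂ (Fin 2) => v 1) ha
  have h0 : a * w = z := by simpa using congrArg (fun v : EuclideanSpace ℂ (Fin 2) => v 0) ha
  rw [← h0, h1, one_mul]

lemma affine_eq_atInfty {z : ℂ} (hz : z ≠ 0) : affine z = atInfty z⁻¹ := by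
  rw [affine, atInfty, Projectivization.mk_eq_mk_iff']
  refine ⟨z, ?_⟩
  ext i
  fin_cases i <;> simp [hz]

lemma eq_affine_or_eq_atInfty_zero (x : P1) : (∃ z, x = affine z) ∨ x = atInfty 0 := by
  obtain ⟨p, q, h, hu, rfl⟩ := exists_unit_rep x
  by_cases hq : q = 0
  · right
    have hp : p ≠ 0 := by
      rintro rfl
      simp [hq] at hu
    rw [atInfty, Projectivization.mk_eq_mk_iff']
    refine ⟨p, ?_⟩
    ext i
    fin_cases i <;> simp [hq]
  · left
    refine ⟨p / q, ?_⟩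
    rw [affine, Projectivization.mk_eq_mk_iff']
    refine ⟨q, ?_⟩
    ext i
    fin_cases i
    · simp
      field_simp
    · simp

lemma affine_ne_atInfty_zero (z : ℂ) : affine z ≠ atInfty 0 := by
  intro h
  rw [affine, atInfty, Projectivization.mk_eq_mk_iff'] at h
  obtain ⟨a, ha⟩ := h
  simpa using congrArg (fun v : EuclideanSpace ℂ (Fin 2) => v 1) ha

lemma tendsto_comp_affine {f : P1 → ℝ} (hf : Continuous f) :
    Tendsto (fun z => f (affine z)) (cocompact ℂ) (𝓝 (f (atInfty 0))) := by
  have h1 : Tendsto (fun z : ℂ => f (atInfty z⁻¹)) (cocompact ℂ) (𝓝 (f (atInfty 0))) :=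
    ((hf.comp continuous_atInfty).tendsto 0).comp
      ((tendsto_inv₀_cobounded'.mono_left
        (Metric.cobounded_eq_cocompact (α := ℂ)).ge).mono_right nhdsWithin_le_nhds)
  refine h1.congr' ?_
  have : {(0 : ℂ)}ᶜ ∈ cocompact ℂ := isCompact_singleton.compl_mem_cocompact
  filter_upwards [this] with z hz
  rw [affine_eq_atInfty hz]

lemma measurableEmbedding_affine : MeasurableEmbedding affine :=
  continuous_affine.measurableEmbedding affine_injective

lemma fubiniStudy_eq_map : fubiniStudy = Measure.map affine fs := rfl

/-- A measure on the projective line that does not charge the point at infinity lives on the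
plane. -/
lemma exists_eq_map_affine (μ : Measure P1) [IsProbabilityMeasure μ] (h : μ {atInfty 0} = 0) :
    ∃ m : Measure ℂ, IsProbabilityMeasure m ∧ μ = Measure.map affine m := by
  have hr : (Set.range affine)ᶜ = {atInfty 0} := by
    ext x
    simp only [Set.mem_compl_iff, Set.mem_range, not_exists, Set.mem_singleton_iff]
    refine ⟨fun hx => (eq_affine_or_eq_atInfty_zero x).resolve_left
      fun ⟨z, hz⟩ => hx z hz.symm, ?_⟩
    rintro rfl z
    exact affine_ne_atInfty_zero z
  have hmap : Measure.map affine (μ.comap affine) = μ := by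
    rw [measurableEmbedding_affine.map_comap]
    refine Measure.restrict_eq_self_of_ae_mem ?_
    rw [ae_iff]
    change μ (Set.range affine)ᶜ = 0
    rwa [hr]
  refine ⟨μ.comap affine, ⟨?_⟩, hmap.symm⟩
  have := congrArg (fun ν : Measure P1 => ν Set.univ) hmap
  simpa [Measure.map_apply continuous_affine.measurable MeasurableSet.univ] using this

lemma integral_map_affine (m : Measure ℂ) (f : P1 → ℝ) :
    ∫ x, f x ∂(Measure.map affine m) = ∫ z, f (affine z) ∂m :=
  measurableEmbedding_affine.integral_map f

end QuasiFekete

end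

noncomputable section

namespace QuasiFekete

open Filter Topology ComplexConjugate

/-! ### Hölder functions -/

lemma IsHolder.le_holderSeminorm {γ : ℝ} (hγ : 0 < γ) {f : P1 → ℝ} (hf : IsHolder γ f)
    (x y : P1) : |f x - f y| ≤ holderSeminorm γ f * sphDist x y ^ γ := by
  rcases eq_or_ne x y with rfl | hxy
  · simp [sphDist_self, Real.zero_rpow hγ.ne']
  obtain ⟨C, -, hC⟩ := hf
  have hd : 0 < sphDist x y ^ γ := Real.rpow_pos_of_pos (sphDist_pos hxy) γ
  rw [← div_le_iff₀ hd]
  refine le_csSup ⟨C, ?_⟩ ⟨x, y, hxy, rfl⟩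
  rintro t ⟨z, w, hzw, rfl⟩
  rw [div_le_iff₀ (Real.rpow_pos_of_pos (sphDist_pos hzw) γ)]
  exact hC z w

lemma holderSeminorm_nonneg (γ : ℝ) (f : P1 → ℝ) : 0 ≤ holderSeminorm γ f := by
  refine Real.sSup_nonneg ?_
  rintro t ⟨x, y, -, rfl⟩
  have := Real.rpow_nonneg (sphDist_nonneg x y) γ
  positivity

lemma IsHolder.continuous {γ : ℝ} (hγ : 0 < γ) {f : P1 → ℝ} (hf : IsHolder γ f) :
    Continuous f := by
  obtain ⟨C, -, hC⟩ := hf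
  refine continuous_iff_continuousAt.mpr fun x => ?_
  rw [ContinuousAt, tendsto_iff_dist_tendsto_zero]
  have h1 : Tendsto (fun y => C * sphDist x y ^ γ) (𝓝 x) (𝓝 0) := by
    have := (((continuous_sphDist_left x).rpow_const fun _ => Or.inr hγ.le).const_mul C).tendsto x
    simpa [sphDist_self, Real.zero_rpow hγ.ne'] using this
  refine squeeze_zero (fun _ => dist_nonneg) (fun y => ?_) h1
  rw [dist_comm, Real.dist_eq]
  exact hC x y

lemma exists_bound_affine {f : P1 → ℝ} (hf : Continuous f) : ∃ M, ∀ z, |f (affine z)| ≤ M :=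
  exists_bound_of_tendsto_cocompact (hf.comp continuous_affine) (tendsto_comp_affine hf)

lemma integrable_comp_affine {f : P1 → ℝ} (hf : Continuous f) (ν : Measure ℂ)
    [IsProbabilityMeasure ν] : Integrable (fun z => f (affine z)) ν := by
  obtain ⟨M, hM⟩ := exists_bound_affine hf
  exact (integrable_const M).mono' (hf.comp continuous_affine).aestronglyMeasurable
    (ae_of_all _ hM)

/-! ### Regularized logarithmic kernels and point masses on the projective line -/

/-- The first coordinate of a unit representative. -/
def unitFst (x : P1) : ℂ := (exists_unit_rep x).choose

/-- The second coordinate of a unit representative. -/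
def unitSnd (x : P1) : ℂ := (exists_unit_rep x).choose_spec.choose

lemma norm_unit (x : P1) : ‖unitFst x‖ ^ 2 + ‖unitSnd x‖ ^ 2 = 1 :=
  (exists_unit_rep x).choose_spec.choose_spec.choose_spec.1

lemma unit_ne_zero (x : P1) : (!₂[unitFst x, unitSnd x] : EuclideanSpace ℂ (Fin 2)) ≠ 0 :=
  (exists_unit_rep x).choose_spec.choose_spec.choose

lemma eq_mk_unit (x : P1) : x = Projectivization.mk ℂ _ (unit_ne_zero x) :=
  (exists_unit_rep x).choose_spec.choose_spec.choose_spec.2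

lemma sphDist_affine (x : P1) (z : ℂ) :
    sphDist x (affine z) = Real.sqrt (distSq (unitFst x) (unitSnd x) z) := by
  conv_lhs => rw [eq_mk_unit x]
  exact sphDist_mk_affine _ (norm_unit x) z

lemma sphDist_atInfty (x : P1) (z : ℂ) :
    sphDist x (atInfty z) = Real.sqrt (distSq (unitSnd x) (unitFst x) z) := by
  conv_lhs => rw [eq_mk_unit x]
  rw [atInfty, sphDist_mk_mk, norm_unit, distSq, Real.sqrt_div (sq_nonneg _),
    Real.sqrt_sq (norm_nonneg _), norm_sub_rev]
  simp

lemma sphDist_eq_norm (x y : P1) :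
    sphDist x y = ‖unitFst x * unitSnd y - unitSnd x * unitFst y‖ := by
  conv_lhs => rw [eq_mk_unit x, eq_mk_unit y]
  rw [sphDist_mk_mk, norm_unit, norm_unit]
  simp

/-- The regularized logarithm of the spherical distance. -/
def logKernel (a : ℝ) (x y : P1) : ℝ := 1 / 2 * Real.log ((1 - a ^ 2) * sphDist x y ^ 2 + a ^ 2)

/-- The regularized point mass at `x`, on the plane. -/
def blob (a : ℝ) (x : P1) : Measure ℂ := chi (unitFst x) (unitSnd x) a

instance (a : ℝ) (x : P1) : IsProbabilityMeasure (blob a x) := by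
  unfold blob
  infer_instance

lemma logKernel_affine (a : ℝ) (x : P1) :
    (fun z => logKernel a x (affine z)) = regLog (unitFst x) (unitSnd x) a := by
  ext z
  rw [logKernel, sphDist_affine, Real.sq_sqrt (distSq_nonneg _ _ _), regLog]

lemma logKernel_atInfty (a : ℝ) (x : P1) :
    (fun z => logKernel a x (atInfty z)) = regLog (unitSnd x) (unitFst x) a := by
  ext z
  rw [logKernel, sphDist_atInfty, Real.sq_sqrt (distSq_nonneg _ _ _), regLog]

lemma isSmooth_logKernel {a : ℝ} (ha : 0 < a) (x : P1) : IsSmooth (logKernel a x) := by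
  refine ⟨?_, ?_⟩
  · rw [logKernel_affine]
    exact contDiff_regLog (norm_unit x) ha
  · rw [logKernel_atInfty]
    exact contDiff_regLog (by rw [add_comm]; exact norm_unit x) ha

lemma logKernel_arg_mem {a : ℝ} (ha : 0 < a) (ha1 : a ≤ 1) (x y : P1) :
    a ^ 2 ≤ (1 - a ^ 2) * sphDist x y ^ 2 + a ^ 2 ∧
      sphDist x y ^ 2 ≤ (1 - a ^ 2) * sphDist x y ^ 2 + a ^ 2 ∧
      (1 - a ^ 2) * sphDist x y ^ 2 + a ^ 2 ≤ 1 := by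
  have h0 := sphDist_nonneg x y
  have h1 := sphDist_le_one x y
  have h2 : sphDist x y ^ 2 ≤ 1 := by nlinarith
  have h3 : a ^ 2 ≤ 1 := by nlinarith
  refine ⟨by nlinarith [sq_nonneg (sphDist x y)], by nlinarith, by nlinarith⟩

lemma continuous_logKernel {a : ℝ} (ha : 0 < a) (ha1 : a ≤ 1) (x : P1) :
    Continuous (logKernel a x) := by
  unfold logKernel
  refine continuous_const.mul (Continuous.log ?_ fun y => ?_)
  · exact (continuous_const.mul ((continuous_sphDist_left x).pow 2)).add continuous_const
  · exact ((sq_pos_of_pos ha).trans_le (logKernel_arg_mem ha ha1 x y).1).ne'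

lemma log_le_logKernel {a : ℝ} (ha : 0 < a) (ha1 : a ≤ 1) (x y : P1) :
    Real.log a ≤ logKernel a x y := by
  have := Real.log_le_log (by positivity) (logKernel_arg_mem ha ha1 x y).1
  rw [Real.log_pow] at this
  unfold logKernel
  push_cast at this
  linarith

lemma logKernel_nonpos {a : ℝ} (ha : 0 < a) (ha1 : a ≤ 1) (x y : P1) : logKernel a x y ≤ 0 := by
  have h1 := logKernel_arg_mem ha ha1 x y
  have := Real.log_nonpos ((sq_nonneg a).trans h1.1) h1.2.2
  unfold logKernel
  linarith

lemma log_sphDist_le_logKernel {a : ℝ} (ha : 0 < a) (ha1 : a ≤ 1) {x y : P1} (hxy : x ≠ y) :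
    Real.log (sphDist x y) ≤ logKernel a x y := by
  have := Real.log_le_log (pow_pos (sphDist_pos hxy) 2) (logKernel_arg_mem ha ha1 x y).2.1
  rw [Real.log_pow] at this
  unfold logKernel
  push_cast at this
  linarith

lemma integral_logKernel_fs {a : ℝ} (ha : 0 ≤ a) (ha1 : a ≤ 1) (x : P1) :
    -(1 / 2) ≤ ∫ z, logKernel a x (affine z) ∂fs ∧
      ∫ z, logKernel a x (affine z) ∂fs ≤ -(1 / 2) + a := by
  rw [logKernel_affine, integral_regLog_fs (norm_unit x)]
  exact integral_half_log_bounds ha ha1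

lemma integral_logKernel_fs_eq (a : ℝ) (x y : P1) :
    ∫ z, logKernel a x (affine z) ∂fs = ∫ z, logKernel a y (affine z) ∂fs := by
  rw [logKernel_affine, logKernel_affine, integral_regLog_fs (norm_unit x),
    integral_regLog_fs (norm_unit y)]

lemma isPlanarPotential_logKernel {a : ℝ} (ha : 0 < a) (x : P1) :
    IsPlanarPotential (blob a x) fs fun z => logKernel a x (affine z) := by
  rw [logKernel_affine]
  exact isPlanarPotential_regLog (norm_unit x) ha

lemma integral_mul_laplacian_logKernel {a : ℝ} (ha : 0 < a) (x : P1) {f : P1 → ℝ}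
    (hf : Continuous f) :
    1 / (2 * Real.pi) * ∫ z, f (affine z) *
        Laplacian.laplacian (fun t => logKernel a x (affine t)) z =
      (∫ z, f (affine z) ∂blob a x) - ∫ z, f (affine z) ∂fs := by
  obtain ⟨M, hM⟩ := exists_bound_affine hf
  rw [logKernel_affine]
  exact integral_chi_sub_fs (norm_unit x) ha (hf.comp continuous_affine).measurable hM

lemma le_integral_logKernel_blob {a : ℝ} (ha : 0 < a) (ha1 : a ≤ 1) {x y : P1} (hxy : x ≠ y) :
    Real.log (sphDist x y) - a ≤ ∫ z, logKernel a x (affine z) ∂blob a y := by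
  rw [logKernel_affine, sphDist_eq_norm]
  refine le_integral_regLog_chi (norm_unit x) (norm_unit y) ha ha1 ?_
  rw [← norm_pos_iff, ← sphDist_eq_norm]
  exact sphDist_pos hxy

lemma integral_logKernel_blob_ge_log {a : ℝ} (ha : 0 < a) (ha1 : a ≤ 1) (x y : P1) :
    Real.log a ≤ ∫ z, logKernel a x (affine z) ∂blob a y := by
  have := integral_mono (μ := blob a y) (integrable_const (Real.log a))
    (integrable_comp_affine (continuous_logKernel ha ha1 x) _)
    fun z => log_le_logKernel ha ha1 x (affine z)
  simpa using this

/-- Integrate the Hölder bound and use the `γ`-moment of the distance to the centre of the smeared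
point. -/
lemma IsHolder.abs_integral_blob_sub_le {γ : ℝ} (hγ : 0 < γ) (hγ1 : γ ≤ 1) {f : P1 → ℝ}
    (hf : IsHolder γ f) {a : ℝ} (ha : 0 < a) (x : P1) :
    |(∫ z, f (affine z) ∂blob a x) - f x| ≤ holderSeminorm γ f * (2 * a ^ γ) := by
  obtain ⟨hi, hb⟩ := integral_chi_rpow_le (norm_unit x) ha hγ hγ1
  have i1 := integrable_comp_affine (hf.continuous hγ) (blob a x)
  have e : (∫ z, f (affine z) ∂blob a x) - f x = ∫ z, (f (affine z) - f x) ∂blob a x := by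
    rw [integral_sub i1 (integrable_const _)]
    simp
  rw [e]
  calc |∫ z, (f (affine z) - f x) ∂blob a x| ≤ ∫ z, |f (affine z) - f x| ∂blob a x :=
        abs_integral_le_integral_abs
    _ ≤ ∫ z, holderSeminorm γ f *
          Real.sqrt (distSq (unitFst x) (unitSnd x) z) ^ γ ∂blob a x := by
        refine integral_mono (i1.sub (integrable_const _)).abs (hi.const_mul _) fun z => ?_
        have := hf.le_holderSeminorm hγ x (affine z)
        rw [abs_sub_comm, sphDist_affine] at this
        exact this
    _ = holderSeminorm γ f *
          ∫ z, Real.sqrt (distSq (unitFst x) (unitSnd x) z) ^ γ ∂blob a x :=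
        integral_const_mul _ _
    _ ≤ _ := mul_le_mul_of_nonneg_left hb (holderSeminorm_nonneg γ f)

/-! ### Potentials on the plane and on the projective line -/

/-- Extension by zero at infinity. -/
def extendZero (ψ : ℂ → ℝ) : P1 → ℝ := Function.extend affine ψ 0

lemma extendZero_affine (ψ : ℂ → ℝ) (z : ℂ) : extendZero ψ (affine z) = ψ z :=
  affine_injective.extend_apply _ _ _

lemma extendZero_atInfty_zero (ψ : ℂ → ℝ) : extendZero ψ (atInfty 0) = 0 :=
  Function.extend_apply' _ _ _ fun ⟨z, hz⟩ => affine_ne_atInfty_zero z hz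

lemma extendZero_atInfty (ψ : ℂ → ℝ) {w : ℂ} (hw : w ≠ 0) : extendZero ψ (atInfty w) = ψ w⁻¹ := by
  rw [← extendZero_affine ψ w⁻¹, affine_eq_atInfty (inv_ne_zero hw), inv_inv]

/-- Compact support makes the extension vanish identically near infinity, so planar test functions
are admissible on the sphere. -/
lemma isSmooth_extendZero {ψ : ℂ → ℝ} (hψ : ContDiff ℝ ∞ ψ) (hc : HasCompactSupport ψ) :
    IsSmooth (extendZero ψ) := by
  refine ⟨by simpa only [extendZero_affine] using hψ, contDiff_iff_contDiffAt.mpr fun w => ?_⟩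
  rcases eq_or_ne w 0 with rfl | hw
  · have h1 : ∀ᶠ w : ℂ in 𝓝 0, extendZero ψ (atInfty w) = 0 := by
      have h2 : ∀ᶠ w : ℂ in 𝓝[≠] 0, ψ w⁻¹ = 0 := by
        have h3 : Tendsto (fun w : ℂ => w⁻¹) (𝓝[≠] 0) (cocompact ℂ) := by
          rw [← Metric.cobounded_eq_cocompact]
          exact tendsto_inv₀_nhdsNE_zero
        have h4 : ∀ᶠ z in cocompact ℂ, ψ z = 0 := by
          filter_upwards [hc.isCompact.compl_mem_cocompact] with z hz
          exact image_eq_zero_of_notMem_tsupport hz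
        exact h3.eventually h4
      rw [eventually_nhdsWithin_iff] at h2
      filter_upwards [h2] with w hw
      rcases eq_or_ne w 0 with rfl | h0
      · exact extendZero_atInfty_zero ψ
      · rw [extendZero_atInfty ψ h0, hw h0]
    exact (contDiffAt_const (c := (0 : ℝ))).congr_of_eventuallyEq h1
  · have h1 : (fun w => extendZero ψ (atInfty w)) =ᶠ[𝓝 w] fun w => ψ w⁻¹ := by
      filter_upwards [isOpen_ne.mem_nhds hw] with u hu
      exact extendZero_atInfty ψ hu
    refine ContDiffAt.congr_of_eventuallyEq ?_ h1
    exact hψ.contDiffAt.comp w (contDiffAt_inv ℝ hw)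

lemma HasPotential.isPlanarPotential {m : Measure ℂ} {g : P1 → ℝ}
    (hg : HasPotential (Measure.map affine m) g) :
    IsPlanarPotential m fs fun z => g (affine z) := by
  intro ψ hψ hc
  have h := hg _ (isSmooth_extendZero hψ hc)
  rw [fubiniStudy_eq_map, integral_map_affine, integral_map_affine] at h
  simp only [extendZero_affine] at h
  rw [h]
  ring

lemma IsPlanarPotential.sub {χ m ν : Measure ℂ} {h k : ℂ → ℝ} (H : IsPlanarPotential χ ν h)
    (K : IsPlanarPotential m ν k) (hh : Continuous h) (hk : Continuous k) :
    IsPlanarPotential χ m fun z => h z - k z := by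
  intro ψ hψ hc
  have i1 := integrable_mul_of_hasCompactSupport hh.locallyIntegrable
    (continuous_laplacian hψ) (hasCompactSupport_laplacian hψ hc)
  have i2 := integrable_mul_of_hasCompactSupport hk.locallyIntegrable
    (continuous_laplacian hψ) (hasCompactSupport_laplacian hψ hc)
  simp only [sub_mul]
  rw [integral_sub i1 i2, mul_sub, ← H ψ hψ hc, ← K ψ hψ hc]
  ring

end QuasiFekete

end

noncomputable section

namespace QuasiFekete

open Filter Topology

/-! ### Good potentials -/

lemma hsia_self (g : P1 → ℝ) (x : P1) : hsia g x x = ⊥ := by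
  simp [hsia, sphDist_self, ENNReal.log_zero]

lemma hsia_of_ne (g : P1 → ℝ) {x y : P1} (hxy : x ≠ y) :
    hsia g x y = ((Real.log (sphDist x y) - g x - g y : ℝ) : EReal) := by
  rw [hsia, ENNReal.log_ofReal_of_pos (sphDist_pos hxy)]
  push_cast
  rfl

lemma continuous_sphDist_affine_affine :
    Continuous fun p : ℂ × ℂ => sphDist (affine p.1) (affine p.2) := by
  have : (fun p : ℂ × ℂ => sphDist (affine p.1) (affine p.2)) = fun p : ℂ × ℂ =>
      ‖p.1 * 1 - 1 * p.2‖ / (Real.sqrt (‖p.1‖ ^ 2 + ‖(1 : ℂ)‖ ^ 2) *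
        Real.sqrt (‖p.2‖ ^ 2 + ‖(1 : ℂ)‖ ^ 2)) := by
    ext p
    exact sphDist_mk_mk _ _
  rw [this]
  refine Continuous.div (by fun_prop) (by fun_prop) fun p => ?_
  rw [norm_one]
  positivity

lemma IsGoodPotential.ae_ne {μ : Measure P1} {g : P1 → ℝ} (hg : IsGoodPotential μ g) :
    ∀ᵐ p ∂μ.prod μ, p.1 ≠ p.2 := by
  filter_upwards [hg.finite_ae] with p hp h
  rw [h] at hp
  exact hp (hsia_self g _)

/-- An atom would give positive mass to a point of the diagonal for the product measure, where the
kernel is `-∞`. -/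
lemma IsGoodPotential.measure_singleton {μ : Measure P1} [IsProbabilityMeasure μ] {g : P1 → ℝ}
    (hg : IsGoodPotential μ g) (x : P1) : μ {x} = 0 := by
  have h : (μ.prod μ) ({x} ×ˢ {x}) = 0 := by
    refine measure_mono_null ?_ (ae_iff.mp hg.ae_ne)
    rintro ⟨y, z⟩ ⟨hy, hz⟩
    simp only [Set.mem_singleton_iff] at hy hz
    simp [hy, hz]
  rw [Measure.prod_prod] at h
  exact mul_self_eq_zero.mp h

lemma IsGoodPotential.integral_log {m : Measure ℂ} [IsProbabilityMeasure m] {g : P1 → ℝ}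
    (hg : IsGoodPotential (Measure.map affine m) g) :
    (∀ᵐ p ∂m.prod m, 0 < sphDist (affine p.1) (affine p.2)) ∧
    Integrable (fun p : ℂ × ℂ => Real.log (sphDist (affine p.1) (affine p.2))) (m.prod m) ∧
    ∫ p : ℂ × ℂ, Real.log (sphDist (affine p.1) (affine p.2)) ∂m.prod m =
      2 * ∫ z, g (affine z) ∂m := by
  have hmap : (Measure.map affine m).prod (Measure.map affine m) =
      Measure.map (Prod.map affine affine) (m.prod m) :=
    Measure.map_prod_map m m continuous_affine.measurable continuous_affine.measurable
  have hme : MeasurableEmbedding (Prod.map affine affine) :=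
    measurableEmbedding_affine.prodMap measurableEmbedding_affine
  have h1 := hg.ae_ne
  have h2 := hg.integrable
  have h3 := hg.energy_eq_zero
  rw [hmap] at h1 h2 h3
  rw [hme.ae_map_iff] at h1
  rw [hme.integrable_map_iff] at h2
  rw [hme.integral_map] at h3
  have hpos : ∀ᵐ p ∂m.prod m, 0 < sphDist (affine p.1) (affine p.2) := by
    filter_upwards [h1] with p hp using sphDist_pos hp
  have he : ((fun p : P1 × P1 => (hsia g p.1 p.2).toReal) ∘ Prod.map affine affine)
      =ᵐ[m.prod m] fun p => Real.log (sphDist (affine p.1) (affine p.2)) -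
        (g (affine p.1) + g (affine p.2)) := by
    filter_upwards [h1] with p hp
    simp only [Function.comp_apply, Prod.map_fst, Prod.map_snd] at hp ⊢
    rw [hsia_of_ne g hp, EReal.toReal_coe]
    ring
  have hgi := integrable_comp_affine hg.continuous m
  have i1 : Integrable (fun p : ℂ × ℂ => g (affine p.1)) (m.prod m) := hgi.comp_fst m
  have i2 : Integrable (fun p : ℂ × ℂ => g (affine p.2)) (m.prod m) := hgi.comp_snd m
  have i3 := h2.congr he
  have i4 : Integrable (fun p : ℂ × ℂ => Real.log (sphDist (affine p.1) (affine p.2)))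
      (m.prod m) := by
    refine (i3.add (i1.add i2)).congr (ae_of_all _ fun p => ?_)
    simp
  refine ⟨hpos, i4, ?_⟩
  have h4 := (integral_congr_ae he).symm.trans h3
  have i5 : Integrable (fun p : ℂ × ℂ => g (affine p.1) + g (affine p.2)) (m.prod m) := i1.add i2
  rw [integral_sub i4 i5, integral_add i1 i2, integral_fun_fst (fun z => g (affine z)),
    integral_fun_snd (fun z => g (affine z))] at h4
  simp only [probReal_univ, one_smul] at h4
  linarith

/-- The kernel is itself a smooth test function, and its `ddᶜ` is the smeared point minus
Fubini–Study; the distributional equation thus exchanges the roles of kernel and potential. -/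
lemma HasPotential.integral_logKernel {m : Measure ℂ} {g : P1 → ℝ}
    (hg : HasPotential (Measure.map affine m) g) (hc : Continuous g) {a : ℝ} (ha : 0 < a)
    (x : P1) :
    ∫ z, logKernel a x (affine z) ∂m = (∫ z, logKernel a x (affine z) ∂fs) +
      (∫ z, g (affine z) ∂blob a x) - ∫ z, g (affine z) ∂fs := by
  have h := hg _ (isSmooth_logKernel ha x)
  rw [fubiniStudy_eq_map, integral_map_affine, integral_map_affine,
    integral_mul_laplacian_logKernel ha x hc] at h
  rw [h]
  ring

lemma tendsto_logKernel {x y : P1} (hxy : 0 < sphDist x y) :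
    Tendsto (fun a => logKernel a x y) (𝓝[>] 0) (𝓝 (Real.log (sphDist x y))) := by
  have hc : ContinuousAt (fun a => logKernel a x y) 0 := by
    unfold logKernel
    refine continuousAt_const.mul (ContinuousAt.log (by fun_prop) ?_)
    simpa using hxy.ne'
  have h := hc.tendsto.mono_left (nhdsWithin_le_nhds (s := Set.Ioi 0))
  have e : logKernel 0 x y = Real.log (sphDist x y) := by
    rw [logKernel]
    simp only [ne_eq, OfNat.ofNat_ne_zero, not_false_eq_true, zero_pow, sub_zero, one_mul, add_zero,
      Real.log_pow]
    push_cast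
    ring
  rwa [e] at h

/-- Dominated convergence, since the regularized kernel lies between `log d` and zero. -/
lemma tendsto_integral_logKernel {m : Measure ℂ} [IsProbabilityMeasure m]
    (hpos : ∀ᵐ p ∂m.prod m, 0 < sphDist (affine p.1) (affine p.2))
    (hi : Integrable (fun p : ℂ × ℂ => Real.log (sphDist (affine p.1) (affine p.2))) (m.prod m)) :
    Tendsto (fun a => ∫ p : ℂ × ℂ, logKernel a (affine p.1) (affine p.2) ∂m.prod m) (𝓝[>] 0)
      (𝓝 (∫ p : ℂ × ℂ, Real.log (sphDist (affine p.1) (affine p.2)) ∂m.prod m)) := by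
  refine tendsto_integral_filter_of_dominated_convergence
    (fun p => |Real.log (sphDist (affine p.1) (affine p.2))|) ?_ ?_ hi.abs ?_
  · filter_upwards with a
    unfold logKernel
    have := continuous_sphDist_affine_affine.measurable
    exact (Measurable.const_mul (Real.measurable_log.comp
      (((this.pow_const 2).const_mul _).add_const _)) _).aestronglyMeasurable
  · filter_upwards [Ioc_mem_nhdsGT (zero_lt_one (α := ℝ))] with a ha
    filter_upwards [hpos] with p hp
    have hne : affine p.1 ≠ affine p.2 := fun h => by simp [h, sphDist_self] at hp
    have h1 := log_sphDist_le_logKernel ha.1 ha.2 hne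
    have h2 := logKernel_nonpos ha.1 ha.2 (affine p.1) (affine p.2)
    rw [Real.norm_eq_abs, abs_of_nonpos h2, abs_of_nonpos (h1.trans h2)]
    linarith
  · filter_upwards [hpos] with p hp using tendsto_logKernel hp

lemma integrable_logKernel_prod {a : ℝ} (ha : 0 < a) (ha1 : a ≤ 1) (m : Measure ℂ)
    [IsProbabilityMeasure m] :
    Integrable (fun p : ℂ × ℂ => logKernel a (affine p.1) (affine p.2)) (m.prod m) := by
  have hm : Measurable fun p : ℂ × ℂ => logKernel a (affine p.1) (affine p.2) := by
    unfold logKernel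
    have := continuous_sphDist_affine_affine.measurable
    exact Measurable.const_mul (Real.measurable_log.comp
      (((this.pow_const 2).const_mul _).add_const _)) _
  refine (integrable_const (-Real.log a)).mono' hm.aestronglyMeasurable (ae_of_all _ fun p => ?_)
  rw [Real.norm_eq_abs, abs_of_nonpos (logKernel_nonpos ha ha1 _ _)]
  linarith [log_le_logKernel ha ha1 (affine p.1) (affine p.2)]

/-- The mean of a Hölder continuous good potential. -/
lemma IsGoodPotential.integral_eq {m : Measure ℂ} [IsProbabilityMeasure m] {g : P1 → ℝ}
    (hg : IsGoodPotential (Measure.map affine m) g) {α : ℝ} (hα0 : 0 < α) (hα1 : α ≤ 1)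
    (hgα : IsHolder α g) :
    ∫ z, g (affine z) ∂m = -(1 / 2) - ∫ z, g (affine z) ∂fs := by
  obtain ⟨hpos, hi, he⟩ := hg.integral_log
  have hlim := tendsto_integral_logKernel hpos hi
  rw [he] at hlim
  have hgi := integrable_comp_affine hg.continuous m
  -- The inner integral of the kernel is `g` at the centre, up to the smearing error, plus the
  -- kernel's mean `I` minus the mean of `g` for Fubini–Study; and `I` is `-1/2` up to `a`.
  have hbound : ∀ a : ℝ, 0 < a → a ≤ 1 →
      |(∫ p : ℂ × ℂ, logKernel a (affine p.1) (affine p.2) ∂m.prod m) -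
        ((∫ z, g (affine z) ∂m) - 1 / 2 - ∫ z, g (affine z) ∂fs)| ≤
        holderSeminorm α g * (2 * a ^ α) + a := by
    intro a ha ha1
    have hK := integrable_logKernel_prod ha ha1 m
    set I : ℝ := ∫ z, logKernel a (affine 0) (affine z) ∂fs with hI
    have e1 : (∫ p : ℂ × ℂ, logKernel a (affine p.1) (affine p.2) ∂m.prod m) -
        ((∫ z, g (affine z) ∂m) - 1 / 2 - ∫ z, g (affine z) ∂fs) =
        (∫ z, ((∫ w, logKernel a (affine z) (affine w) ∂m) - g (affine z) - I +
          ∫ w, g (affine w) ∂fs) ∂m) + (I + 1 / 2) := by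
      have d0 : Integrable (fun z => ∫ w, logKernel a (affine z) (affine w) ∂m) m :=
        hK.integral_prod_left
      have d1 : Integrable (fun z => (∫ w, logKernel a (affine z) (affine w) ∂m) -
        g (affine z)) m := d0.sub hgi
      have d2 : Integrable (fun z => (∫ w, logKernel a (affine z) (affine w) ∂m) -
        g (affine z) - I) m := d1.sub (integrable_const _)
      rw [integral_prod _ hK, integral_add d2 (integrable_const _),
        integral_sub d1 (integrable_const _), integral_sub d0 hgi]
      simp only [integral_const, probReal_univ, one_smul]
      ring
    have e2 : ∀ z : ℂ, |(∫ w, logKernel a (affine z) (affine w) ∂m) - g (affine z) - I +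
        ∫ w, g (affine w) ∂fs| ≤ holderSeminorm α g * (2 * a ^ α) := by
      intro z
      rw [hg.hasPotential.integral_logKernel hg.continuous ha, hI,
        integral_logKernel_fs_eq a (affine z) (affine 0)]
      refine le_trans (le_of_eq ?_) (hgα.abs_integral_blob_sub_le hα0 hα1 ha (affine z))
      congr 1
      ring
    have e3 := norm_integral_le_of_norm_le_const (μ := m)
      (ae_of_all _ fun z => (Real.norm_eq_abs _).trans_le (e2 z))
    rw [probReal_univ, mul_one, Real.norm_eq_abs] at e3
    have e4 := integral_logKernel_fs ha.le ha1 (affine 0)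
    have e5 : |I + 1 / 2| ≤ a := abs_le.mpr ⟨by linarith, by linarith⟩
    rw [e1]
    exact (abs_add_le _ _).trans (add_le_add e3 e5)
  have hlim2 : Tendsto (fun a => ∫ p : ℂ × ℂ, logKernel a (affine p.1) (affine p.2) ∂m.prod m)
      (𝓝[>] 0) (𝓝 ((∫ z, g (affine z) ∂m) - 1 / 2 - ∫ z, g (affine z) ∂fs)) := by
    rw [tendsto_iff_dist_tendsto_zero]
    have hz : Tendsto (fun a : ℝ => holderSeminorm α g * (2 * a ^ α) + a) (𝓝[>] 0) (𝓝 0) := by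
      have hc : Continuous fun a : ℝ => holderSeminorm α g * (2 * a ^ α) + a :=
        (continuous_const.mul (continuous_const.mul
          (continuous_id.rpow_const fun _ => Or.inr hα0.le))).add continuous_id
      have := hc.tendsto 0
      simp only [Real.zero_rpow hα0.ne', mul_zero, add_zero] at this
      exact this.mono_left nhdsWithin_le_nhds
    refine squeeze_zero' (Eventually.of_forall fun _ => dist_nonneg) ?_ hz
    filter_upwards [Ioc_mem_nhdsGT (zero_lt_one (α := ℝ))] with a ha
    exact hbound a ha.1 ha.2
  -- The same limit is `2 ∫ g dm` by the normalization of the good potential, so one copy of `∫ g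
  -- dm` cancels.
  have := tendsto_nhds_unique hlim hlim2
  linarith

lemma IsGoodPotential.integral_nonpos {m : Measure ℂ} [IsProbabilityMeasure m] {g : P1 → ℝ}
    (hg : IsGoodPotential (Measure.map affine m) g) : ∫ z, g (affine z) ∂m ≤ 0 := by
  obtain ⟨hpos, hi, he⟩ := hg.integral_log
  have : ∫ p : ℂ × ℂ, Real.log (sphDist (affine p.1) (affine p.2)) ∂m.prod m ≤ 0 :=
    MeasureTheory.integral_nonpos fun p =>
      Real.log_nonpos (sphDist_nonneg _ _) (sphDist_le_one _ _)
  linarith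

/-- The mean of `g` is nonpositive, and `g` oscillates by at most its seminorm because the sphere
has diameter at most one. -/
lemma IsGoodPotential.le_holderSeminorm {m : Measure ℂ} [IsProbabilityMeasure m] {g : P1 → ℝ}
    (hg : IsGoodPotential (Measure.map affine m) g) {α : ℝ} (hα0 : 0 < α)
    (hgα : IsHolder α g) (x : P1) : g x ≤ holderSeminorm α g := by
  have hgi := integrable_comp_affine hg.continuous m
  have h : ∫ _ : ℂ, g x - holderSeminorm α g ∂m ≤ ∫ z, g (affine z) ∂m := by
    refine integral_mono (integrable_const _) hgi fun z => ?_
    have h1 := (abs_le.mp (hgα.le_holderSeminorm hα0 x (affine z))).2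
    have h2 : sphDist x (affine z) ^ α ≤ 1 :=
      Real.rpow_le_one (sphDist_nonneg _ _) (sphDist_le_one _ _) hα0.le
    have h3 := mul_le_mul_of_nonneg_left h2 (holderSeminorm_nonneg α g)
    simp only
    linarith
  rw [integral_const, probReal_univ, one_smul] at h
  linarith [hg.integral_nonpos]

end QuasiFekete

end

noncomputable section

namespace QuasiFekete

open Filter Topology
open scoped ENNReal

/-! ### Regularized empirical measures -/

/-- The average of the regularized point masses at the points of `F`. -/
def blobs (a : ℝ) (F : Finset P1) : Measure ℂ := (F.card : ℝ≥0∞)⁻¹ • ∑ x ∈ F, blob a x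

lemma isProbabilityMeasure_blobs (a : ℝ) {F : Finset P1} (hF : F.Nonempty) :
    IsProbabilityMeasure (blobs a F) := by
  refine ⟨?_⟩
  simp only [blobs, Measure.smul_apply, Measure.coe_finsetSum, Finset.sum_apply, measure_univ,
    Finset.sum_const, smul_eq_mul, nsmul_eq_mul, mul_one]
  exact ENNReal.inv_mul_cancel (by simpa using hF.ne_empty) (ENNReal.natCast_ne_top _)

lemma integral_blobs (a : ℝ) (F : Finset P1) {f : ℂ → ℝ}
    (hf : ∀ x ∈ F, Integrable f (blob a x)) :
    ∫ z, f z ∂blobs a F = 1 / (F.card : ℝ) * ∑ x ∈ F, ∫ z, f z ∂blob a x := by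
  rw [blobs, integral_smul_measure, integral_finsetSum_measure hf]
  simp

/-- The average of the regularized kernels at the points of `F`. -/
def logKernels (a : ℝ) (F : Finset P1) (y : P1) : ℝ :=
  1 / (F.card : ℝ) * ∑ x ∈ F, logKernel a x y

lemma continuous_logKernels {a : ℝ} (ha : 0 < a) (ha1 : a ≤ 1) (F : Finset P1) :
    Continuous (logKernels a F) :=
  continuous_const.mul (continuous_finsetSum _ fun x _ => continuous_logKernel ha ha1 x)

lemma isPlanarPotential_logKernels {a : ℝ} (ha : 0 < a) (ha1 : a ≤ 1) {F : Finset P1}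
    (hF : F.Nonempty) :
    IsPlanarPotential (blobs a F) fs fun z => logKernels a F (affine z) := by
  intro ψ hψ hc
  have hcard : (F.card : ℝ) ≠ 0 := by exact_mod_cast hF.card_pos.ne'
  have i1 : ∀ x ∈ F, Integrable (fun z => logKernel a x (affine z) * Laplacian.laplacian ψ z) :=
    fun x _ => integrable_mul_of_hasCompactSupport
      ((continuous_logKernel ha ha1 x).comp continuous_affine).locallyIntegrable
      (continuous_laplacian hψ) (hasCompactSupport_laplacian hψ hc)
  have i2 : ∀ x ∈ F, Integrable ψ (blob a x) := fun x _ =>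
    hψ.continuous.integrable_of_hasCompactSupport hc
  rw [integral_blobs a F i2]
  simp only [logKernels, mul_assoc, Finset.sum_mul]
  rw [integral_const_mul, integral_finsetSum _ i1, Finset.mul_sum, Finset.mul_sum, Finset.mul_sum,
    ← sub_eq_zero]
  have e : ∀ x ∈ F, ∫ z, ψ z ∂blob a x = (∫ z, ψ z ∂fs) +
      1 / (2 * Real.pi) * ∫ z, logKernel a x (affine z) * Laplacian.laplacian ψ z := by
    intro x _
    have := isPlanarPotential_logKernel ha x ψ hψ hc
    linarith
  rw [← Finset.mul_sum, Finset.sum_congr rfl e, Finset.sum_add_distrib, Finset.sum_const,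
    nsmul_eq_mul, mul_add, ← mul_assoc, one_div_mul_cancel hcard, ← Finset.mul_sum,
    ← Finset.mul_sum, ← Finset.mul_sum]
  ring

lemma IsHolder.abs_integral_blobs_sub_le {γ : ℝ} (hγ : 0 < γ) (hγ1 : γ ≤ 1) {f : P1 → ℝ}
    (hf : IsHolder γ f) {a : ℝ} (ha : 0 < a) {F : Finset P1} (hF : F.Nonempty) :
    |(∫ z, f (affine z) ∂blobs a F) - 1 / (F.card : ℝ) * ∑ x ∈ F, f x| ≤
      holderSeminorm γ f * (2 * a ^ γ) := by
  have hcard : (0 : ℝ) < F.card := by exact_mod_cast hF.card_pos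
  rw [integral_blobs a F fun x _ => integrable_comp_affine (hf.continuous hγ) _, ← mul_sub,
    ← Finset.sum_sub_distrib, abs_mul, abs_of_pos (by positivity : 0 < 1 / (F.card : ℝ)),
    one_div, inv_mul_le_iff₀ hcard]
  refine (Finset.abs_sum_le_sum_abs _ _).trans ?_
  have := Finset.sum_le_card_nsmul F _ _ fun x _ => hf.abs_integral_blob_sub_le hγ hγ1 ha x
  rwa [nsmul_eq_mul] at this

/-! ### The energy of a regularized quasi-Fekete configuration -/

lemma coe_finsetSum_ereal {ι : Type*} (s : Finset ι) (f : ι → ℝ) :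
    ((∑ i ∈ s, f i : ℝ) : EReal) = ∑ i ∈ s, (f i : EReal) :=
  map_sum (⟨⟨Real.toEReal, EReal.coe_zero⟩, EReal.coe_add⟩ : ℝ →+ EReal) f s

open Classical in
lemma sum_product_eq_diag_add_offDiag (F : Finset P1) (f : P1 × P1 → ℝ) :
    ∑ x ∈ F, ∑ y ∈ F, f (x, y) = ∑ x ∈ F, f (x, x) + ∑ p ∈ F.offDiag, f p := by
  rw [← Finset.sum_product, ← Finset.diag_union_offDiag,
    Finset.sum_union (Finset.disjoint_diag_offDiag F), Finset.sum_diag]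

-- In the sum over ordered pairs each point occurs `n - 1` times in each coordinate, hence the
-- factor `2 (n - 1)`.
open Classical in
lemma IsQuasiFekete.sum_log_ge {g : P1 → ℝ} {C : ℝ} {F : Finset P1} (hF : IsQuasiFekete g C F) :
    -C * F.card * Real.log F.card + 2 * ((F.card : ℝ) - 1) * ∑ x ∈ F, g x ≤
      ∑ p ∈ F.offDiag, Real.log (sphDist p.1 p.2) := by
  have h := hF.2
  have e : ∀ p ∈ F.offDiag, hsia g p.1 p.2 =
      ((Real.log (sphDist p.1 p.2) - (g p.1 + g p.2) : ℝ) : EReal) := by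
    intro p hp
    rw [hsia_of_ne g (Finset.mem_offDiag.mp hp).2.2, sub_sub]
  rw [Finset.sum_congr rfl e, ← coe_finsetSum_ereal, EReal.coe_le_coe_iff,
    Finset.sum_sub_distrib] at h
  have h2 := sum_product_eq_diag_add_offDiag F fun p => g p.1 + g p.2
  simp only [Finset.sum_add_distrib, Finset.sum_const, nsmul_eq_mul, ← Finset.mul_sum] at h2 h
  linarith

-- The `n` diagonal terms are at least `log a` each. The at most `n²` off-diagonal terms lose at
-- most `a` each against `log d`, whose sum the quasi-Fekete condition controls.
open Classical in
lemma IsQuasiFekete.integral_logKernels_ge {g : P1 → ℝ} {C : ℝ} {F : Finset P1}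
    (hF : IsQuasiFekete g C F) {a : ℝ} (ha : 0 < a) (ha1 : a ≤ 1) :
    (Real.log a - C * Real.log F.card) / F.card - a +
      2 * (1 - 1 / (F.card : ℝ)) * (1 / (F.card : ℝ) * ∑ x ∈ F, g x) ≤
      ∫ z, logKernels a F (affine z) ∂blobs a F := by
  have hn : (0 : ℝ) < F.card := by
    have := hF.1
    exact_mod_cast (by omega : 0 < F.card)
  set n : ℝ := (F.card : ℝ) with hndef
  have e : ∫ z, logKernels a F (affine z) ∂blobs a F =
      1 / n ^ 2 * ∑ y ∈ F, ∑ x ∈ F, ∫ z, logKernel a x (affine z) ∂blob a y := by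
    rw [integral_blobs a F fun x _ => integrable_comp_affine (continuous_logKernels ha ha1 F) _]
    have : ∀ y ∈ F, ∫ z, logKernels a F (affine z) ∂blob a y =
        1 / n * ∑ x ∈ F, ∫ z, logKernel a x (affine z) ∂blob a y := by
      intro y _
      simp only [logKernels]
      rw [integral_const_mul, integral_finsetSum _ fun x _ =>
        integrable_comp_affine (continuous_logKernel ha ha1 x) _]
    rw [Finset.sum_congr rfl this, ← Finset.mul_sum, ← mul_assoc, ← hndef]
    congr 1
    field_simp
  have h1 : n * Real.log a + (-C * n * Real.log n + 2 * (n - 1) * ∑ x ∈ F, g x) - n ^ 2 * a ≤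
      ∑ y ∈ F, ∑ x ∈ F, ∫ z, logKernel a x (affine z) ∂blob a y := by
    rw [sum_product_eq_diag_add_offDiag F fun p => ∫ z, logKernel a p.2 (affine z) ∂blob a p.1]
    have d1 := Finset.card_nsmul_le_sum F (fun x => ∫ z, logKernel a x (affine z) ∂blob a x)
      (Real.log a) fun x _ => integral_logKernel_blob_ge_log ha ha1 x x
    have d2 : ∑ p ∈ F.offDiag, (Real.log (sphDist p.1 p.2) - a) ≤
        ∑ p ∈ F.offDiag, ∫ z, logKernel a p.2 (affine z) ∂blob a p.1 := by
      refine Finset.sum_le_sum fun p hp => ?_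
      rw [sphDist_comm]
      exact le_integral_logKernel_blob ha ha1 (Finset.mem_offDiag.mp hp).2.2.symm
    rw [Finset.sum_sub_distrib, Finset.sum_const, nsmul_eq_mul] at d2
    have d3 : (F.offDiag.card : ℝ) ≤ n ^ 2 := by
      rw [Finset.offDiag_card, hndef]
      exact_mod_cast (Nat.sub_le _ _).trans_eq (sq _).symm
    have d4 := hF.sum_log_ge
    have d5 := mul_le_mul_of_nonneg_right d3 ha.le
    rw [nsmul_eq_mul] at d1
    rw [← hndef] at d1 d4
    linarith
  rw [e]
  refine le_trans (le_of_eq ?_) (mul_le_mul_of_nonneg_left h1 (by positivity))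
  field_simp
  ring

/-- The energy of the difference between a good measure and a regularized quasi-Fekete
configuration. -/
lemma IsQuasiFekete.energy_le {m : Measure ℂ} [IsProbabilityMeasure m] {g : P1 → ℝ}
    (hg : IsGoodPotential (Measure.map affine m) g) {α : ℝ} (hα0 : 0 < α) (hα1 : α ≤ 1)
    (hgα : IsHolder α g) {C : ℝ} {F : Finset P1} (hF : IsQuasiFekete g C F) {a : ℝ} (ha : 0 < a)
    (ha1 : a ≤ 1) :
    -((∫ z, (logKernels a F (affine z) - g (affine z)) ∂blobs a F) -
        ∫ z, (logKernels a F (affine z) - g (affine z)) ∂m) ≤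
      (C * Real.log F.card - Real.log a) / F.card +
        holderSeminorm α g * (2 / F.card + 4 * a ^ α) + 2 * a := by
  have hcard := hF.1
  have hne : F.Nonempty := Finset.card_pos.mp (by omega)
  have hn : (0 : ℝ) < F.card := by exact_mod_cast hne.card_pos
  have := isProbabilityMeasure_blobs a hne
  have hc := continuous_logKernels ha ha1 F
  rw [integral_sub (integrable_comp_affine hc _) (integrable_comp_affine hg.continuous _),
    integral_sub (integrable_comp_affine hc _) (integrable_comp_affine hg.continuous _)]
  have h1 := hF.integral_logKernels_ge ha ha1
  have h2 := abs_le.mp (hgα.abs_integral_blobs_sub_le hα0 hα1 ha hne)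
  have h3 : ∫ z, logKernels a F (affine z) ∂m ≤
      -(1 / 2) + a + (∫ z, g (affine z) ∂blobs a F) - ∫ z, g (affine z) ∂fs := by
    simp only [logKernels]
    rw [integral_const_mul, integral_finsetSum _ fun x _ =>
      integrable_comp_affine (continuous_logKernel ha ha1 x) _,
      integral_blobs a F fun x _ => integrable_comp_affine hg.continuous _]
    have : ∀ x ∈ F, ∫ z, logKernel a x (affine z) ∂m ≤
        (-(1 / 2) + a - ∫ z, g (affine z) ∂fs) + ∫ z, g (affine z) ∂blob a x := by
      intro x _
      rw [hg.hasPotential.integral_logKernel hg.continuous ha]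
      linarith [(integral_logKernel_fs ha.le ha1 x).2]
    have h4 := mul_le_mul_of_nonneg_left (Finset.sum_le_sum this)
      (by positivity : 0 ≤ 1 / (F.card : ℝ))
    rw [Finset.sum_add_distrib, Finset.sum_const, nsmul_eq_mul, mul_add, ← mul_assoc,
      one_div_mul_cancel hn.ne', one_mul] at h4
    linarith
  -- The constant `-1/2 - ∫ g dω` now cancels between `∫ K dm` and `∫ g dm`. What remains is twice
  -- the difference between smeared and empirical means of `g`, plus `2/n` times the empirical mean.
  have h4 := hg.integral_eq hα0 hα1 hgα
  have h5 : 1 / (F.card : ℝ) * ∑ x ∈ F, g x ≤ holderSeminorm α g := by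
    rw [one_div, inv_mul_le_iff₀ hn]
    have := Finset.sum_le_card_nsmul F g _ fun x _ => hg.le_holderSeminorm hα0 hgα x
    rwa [nsmul_eq_mul] at this
  have h6 := mul_le_mul_of_nonneg_left h5 (by positivity : 0 ≤ 2 / (F.card : ℝ))
  have h7 : 2 * (1 - 1 / (F.card : ℝ)) * (1 / (F.card : ℝ) * ∑ x ∈ F, g x) =
      2 * (1 / (F.card : ℝ) * ∑ x ∈ F, g x) -
        2 / (F.card : ℝ) * (1 / (F.card : ℝ) * ∑ x ∈ F, g x) := by
    ring
  have h8 : (C * Real.log F.card - Real.log a) / F.card =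
      -((Real.log a - C * Real.log F.card) / F.card) := by
    ring
  rw [h7] at h1
  rw [h8]
  linarith

/-! ### Numerical inequalities -/

lemma natCast_div_le_log (j k : ℕ) {x : ℝ} (hx : 0 < x) (hk : 0 < k)
    (h : (2.7182818286 : ℝ) ^ j ≤ x ^ k) : (j : ℝ) / k ≤ Real.log x := by
  have hk' : (0 : ℝ) < k := by exact_mod_cast hk
  rw [div_le_iff₀ hk', mul_comm, ← Real.log_pow, Real.le_log_iff_exp_le (by positivity)]
  calc Real.exp j = Real.exp 1 ^ j := by rw [← Real.exp_nat_mul, mul_one]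
    _ ≤ 2.7182818286 ^ j := pow_le_pow_left₀ (Real.exp_pos 1).le Real.exp_one_lt_d9.le j
    _ ≤ x ^ k := h

/-- With `G` twice the seminorm of the potential, this absorbs every error of order `1/n` into the
terms `2‖g‖ + 1` of the constant. It is delicate only when `log n < 3`, that is for `n` up to `20`;
there the hypothesis also bounds `G`. -/
lemma error_le_log {n : ℕ} (hn : 2 ≤ n) {G : ℝ} (hG : 0 ≤ G)
    (h : (G + 3) * Real.log n < n) :
    4 / 3 ≤ Real.log n ∧ G * (3 - Real.log n) + 2 / n ≤ Real.log n := by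
  have hlog : ∀ {k : ℕ} {l : ℝ}, 0 < k → k ≤ n → l ≤ Real.log k → l ≤ Real.log n :=
    fun hk hkn hl => hl.trans (Real.log_le_log (by exact_mod_cast hk) (by exact_mod_cast hkn))
  have l3 : 1 ≤ Real.log (3 : ℕ) := by
    simpa using natCast_div_le_log 1 1 (x := (3 : ℕ)) (by norm_num) (by norm_num) (by norm_num)
  have l5 : 1.6 ≤ Real.log (5 : ℕ) := by
    have := natCast_div_le_log 8 5 (x := (5 : ℕ)) (by norm_num) (by norm_num) (by norm_num)
    norm_num at this ⊢
    exact this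
  have l7 : 1.75 ≤ Real.log (7 : ℕ) := by
    have := natCast_div_le_log 7 4 (x := (7 : ℕ)) (by norm_num) (by norm_num) (by norm_num)
    norm_num at this ⊢
    exact this
  have l8 : 2.07 ≤ Real.log (8 : ℕ) := by
    have := Real.log_two_gt_d9
    have e : Real.log (8 : ℕ) = 3 * Real.log 2 := by
      rw [show ((8 : ℕ) : ℝ) = 2 ^ 3 by norm_num, Real.log_pow]
      norm_num
    rw [e]
    linarith
  have l10 : 2.3 ≤ Real.log (10 : ℕ) := by
    have := natCast_div_le_log 23 10 (x := (10 : ℕ)) (by norm_num) (by norm_num) (by norm_num)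
    norm_num at this ⊢
    exact this
  have l14 : 2.6 ≤ Real.log (14 : ℕ) := by
    have := natCast_div_le_log 13 5 (x := (14 : ℕ)) (by norm_num) (by norm_num) (by norm_num)
    norm_num at this ⊢
    exact this
  have l21 : 3 ≤ Real.log (21 : ℕ) := by
    simpa using natCast_div_le_log 3 1 (x := (21 : ℕ)) (by norm_num) (by norm_num) (by norm_num)
  -- The hypothesis contains `3 log n < n`, which fails for `n = 2, 3, 4`.
  have hn5 : 5 ≤ n := by
    by_contra hlt
    have h3 : 3 * Real.log n < n := by
      have : 0 ≤ Real.log n := Real.log_natCast_nonneg n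
      nlinarith
    have l2' := Real.log_two_gt_d9
    interval_cases n
    · norm_num at h3
      linarith
    · norm_num at h3 l3
      linarith
    · have e : Real.log (4 : ℕ) = 2 * Real.log 2 := by
        rw [show ((4 : ℕ) : ℝ) = 2 ^ 2 by norm_num, Real.log_pow]
        norm_num
      rw [e] at h3
      norm_num at h3
      linarith
  set L := Real.log n with hL
  have hL5 : 1.6 ≤ L := hlog (by norm_num) hn5 l5
  have hn5' : (5 : ℝ) ≤ n := by exact_mod_cast hn5
  have h2n : 2 / (n : ℝ) ≤ 0.4 := by
    rw [div_le_iff₀ (by linarith)]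
    linarith
  refine ⟨by linarith, ?_⟩
  rcases le_or_gt 3 L with h3 | h3
  · nlinarith
  -- On a range of `n`, `l` bounds the logarithm below and `b` bounds `n` above, whence `G ≤ b / l -
  -- 3`; the constant `0.4` bounds `2 / n` for `n ≥ 5`.
  have key : ∀ l b : ℝ, 0 < l → l ≤ L → (n : ℝ) ≤ b → (b - 3 * l) * (3 - l) ≤ l ^ 2 - 0.4 * l →
      G * (3 - L) + 2 / n ≤ L := by
    intro l b hl hlL hb hlb
    have h1 : G * l ≤ b - 3 * l := by nlinarith
    have h2 : G * l * (3 - l) ≤ (b - 3 * l) * (3 - l) :=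
      mul_le_mul_of_nonneg_right h1 (by linarith)
    have h3 : l * (G * (3 - l)) ≤ l * (l - 0.4) := by nlinarith
    have h4 := le_of_mul_le_mul_left h3 hl
    nlinarith
  have hn21 : n < 21 := by
    by_contra hge
    exact absurd (hlog (by norm_num) (not_lt.mp hge) l21) (not_le.mpr h3)
  rcases le_or_gt 14 n with c | c
  · exact key 2.6 20 (by norm_num) (hlog (by norm_num) c l14)
      (by exact_mod_cast Nat.lt_succ_iff.mp hn21) (by norm_num)
  rcases le_or_gt 10 n with c' | c'
  · exact key 2.3 13 (by norm_num) (hlog (by norm_num) c' l10)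
      (by exact_mod_cast Nat.lt_succ_iff.mp c) (by norm_num)
  rcases le_or_gt 8 n with d | d
  · exact key 2.07 9 (by norm_num) (hlog (by norm_num) d l8)
      (by exact_mod_cast Nat.lt_succ_iff.mp c') (by norm_num)
  rcases le_or_gt 7 n with d' | d'
  · exact key 1.75 7 (by norm_num) (hlog (by norm_num) d' l7)
      (by exact_mod_cast Nat.lt_succ_iff.mp d) (by norm_num)
  · exact key 1.6 6 (by norm_num) hL5 (by exact_mod_cast Nat.lt_succ_iff.mp d') (by norm_num)

/-! ### The gradient norm -/

/-- The chosen weak gradient agrees almost everywhere with the square-integrable one, by uniqueness.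
-/
lemma MemW12.weakGradient {φ : P1 → ℝ} (hφ : MemW12 φ) :
    IsWeakGradient (fun z => φ (affine z)) (weakGradient fun z => φ (affine z)) ∧
      Integrable (fun z => ‖QuasiFekete.weakGradient (fun t => φ (affine t)) z‖ ^ 2) := by
  obtain ⟨-, ⟨G, hG, hG2⟩, -⟩ := hφ
  have hex : ∃ G : ℂ → ℂ, IsWeakGradient (fun z => φ (affine z)) G := ⟨G, hG⟩
  have hW : IsWeakGradient (fun z => φ (affine z))
      (QuasiFekete.weakGradient fun z => φ (affine z)) := by
    rw [QuasiFekete.weakGradient, dif_pos hex]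
    exact hex.choose_spec
  have hW2 : MemLp (QuasiFekete.weakGradient fun z => φ (affine z)) 2 volume :=
    hG2.ae_eq (hG.ae_eq hW)
  exact ⟨hW, hW2.integrable_norm_pow (by norm_num)⟩

lemma gradNorm_nonneg (φ : P1 → ℝ) : 0 ≤ gradNorm φ := Real.sqrt_nonneg _

lemma gradNorm_sq (φ : P1 → ℝ) : gradNorm φ ^ 2 =
    1 / (2 * Real.pi) * ∫ z : ℂ, ‖weakGradient (fun t => φ (affine t)) z‖ ^ 2 := by
  refine Real.sq_sqrt (mul_nonneg (by positivity) (integral_nonneg fun z => by positivity))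

end QuasiFekete

end

/-! ### From the energy estimate to the equidistribution bound -/

noncomputable section

namespace QuasiFekete

/-- The comparison for a measure on the plane, with a regularization parameter. -/
lemma IsQuasiFekete.abs_integral_sub_le {m : Measure ℂ} [IsProbabilityMeasure m] {g : P1 → ℝ}
    (hg : IsGoodPotential (Measure.map affine m) g) {α : ℝ} (hα0 : 0 < α) (hα1 : α ≤ 1)
    (hgα : IsHolder α g) {C : ℝ} {F : Finset P1} (hF : IsQuasiFekete g C F) {γ : ℝ} (hγ0 : 0 < γ)
    (hγ1 : γ ≤ 1) {φ : P1 → ℝ} (hφW : MemW12 φ) (hφγ : IsHolder γ φ) {a R : ℝ} (ha : 0 < a)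
    (ha1 : a ≤ 1) (hR : 0 ≤ R) (hE : (C * Real.log F.card - Real.log a) / F.card +
      holderSeminorm α g * (2 / F.card + 4 * a ^ α) + 2 * a ≤ R ^ 2) (haR : 2 * a ^ γ ≤ R) :
    |(∫ z, φ (affine z) ∂m) - (1 / (F.card : ℝ)) * ∑ z ∈ F, φ z| ≤ R * seminormW γ φ := by
  have hcard := hF.1
  have hne : F.Nonempty := Finset.card_pos.mp (by omega)
  have := isProbabilityMeasure_blobs a hne
  have hφc := hφγ.continuous hγ0
  have hcont : Continuous fun x => logKernels a F x - g x :=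
    (continuous_logKernels ha ha1 F).sub hg.continuous
  have hpot : IsPlanarPotential (blobs a F) m fun z => logKernels a F (affine z) - g (affine z) :=
    (isPlanarPotential_logKernels ha ha1 hne).sub hg.hasPotential.isPlanarPotential
      ((continuous_logKernels ha ha1 F).comp continuous_affine)
      (hg.continuous.comp continuous_affine)
  obtain ⟨M, hM⟩ := exists_bound_affine hφc
  obtain ⟨hW, hW2⟩ := hφW.weakGradient
  have henergy := hpot.energy_inequality (hcont.comp continuous_affine)
    (hφc.comp continuous_affine) (tendsto_comp_affine hcont) hM hW hW2
  rw [← gradNorm_sq] at henergy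
  have h1 := hF.energy_le hg hα0 hα1 hgα ha ha1
  have h2 : |(∫ z, φ (affine z) ∂blobs a F) - ∫ z, φ (affine z) ∂m| ≤ gradNorm φ * R := by
    refine abs_le_of_sq_le_sq ?_ (mul_nonneg (gradNorm_nonneg φ) hR)
    rw [mul_pow]
    exact henergy.trans (mul_le_mul_of_nonneg_left (h1.trans hE) (sq_nonneg _))
  have h3 := hφγ.abs_integral_blobs_sub_le hγ0 hγ1 ha hne
  have h4 := mul_le_mul_of_nonneg_left haR (holderSeminorm_nonneg γ φ)
  rw [abs_sub_comm] at h2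
  have h5 := abs_sub_le (∫ z, φ (affine z) ∂m) (∫ z, φ (affine z) ∂blobs a F)
    ((1 / (F.card : ℝ)) * ∑ z ∈ F, φ z)
  unfold seminormW
  linarith

/-- The difference of two means of a Hölder continuous function. -/
lemma IsHolder.abs_integral_sub_average_le {γ : ℝ} (hγ : 0 < γ) {φ : P1 → ℝ} (hφ : IsHolder γ φ)
    (m : Measure ℂ) [IsProbabilityMeasure m] {F : Finset P1} (hF : F.Nonempty) :
    |(∫ z, φ (affine z) ∂m) - (1 / (F.card : ℝ)) * ∑ z ∈ F, φ z| ≤ holderSeminorm γ φ := by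
  have hcard : (0 : ℝ) < F.card := by exact_mod_cast hF.card_pos
  have hi := integrable_comp_affine (hφ.continuous hγ) m
  have h1 : ∀ x y, |φ x - φ y| ≤ holderSeminorm γ φ := fun x y =>
    (hφ.le_holderSeminorm hγ x y).trans (mul_le_of_le_one_right (holderSeminorm_nonneg γ φ)
      (Real.rpow_le_one (sphDist_nonneg _ _) (sphDist_le_one _ _) hγ.le))
  have h2 : ∀ y, |(∫ z, φ (affine z) ∂m) - φ y| ≤ holderSeminorm γ φ := by
    intro y
    have e : (∫ z, φ (affine z) ∂m) - φ y = ∫ z, (φ (affine z) - φ y) ∂m := by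
      rw [integral_sub hi (integrable_const _)]
      simp
    have := norm_integral_le_of_norm_le_const (μ := m) (f := fun z => φ (affine z) - φ y)
      (ae_of_all _ fun z => (Real.norm_eq_abs _).trans_le (h1 (affine z) y))
    rwa [probReal_univ, mul_one, Real.norm_eq_abs, ← e] at this
  have e : (∫ z, φ (affine z) ∂m) - (1 / (F.card : ℝ)) * ∑ z ∈ F, φ z =
      1 / (F.card : ℝ) * ∑ y ∈ F, ((∫ z, φ (affine z) ∂m) - φ y) := by
    rw [Finset.sum_sub_distrib, Finset.sum_const, nsmul_eq_mul, mul_sub, ← mul_assoc,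
      one_div_mul_cancel hcard.ne', one_mul]
  rw [e, abs_mul, abs_of_pos (by positivity : 0 < 1 / (F.card : ℝ)), one_div,
    inv_mul_le_iff₀ hcard]
  refine (Finset.abs_sum_le_sum_abs _ _).trans ?_
  have := Finset.sum_le_card_nsmul F _ _ fun y _ => h2 y
  rwa [nsmul_eq_mul] at this

lemma rpow_neg_mul_le {n : ℝ} (hn : 1 ≤ n) {M s t : ℝ} (h : t ≤ M * s) :
    (n ^ (-M)) ^ s ≤ n ^ (-t) := by
  rw [← Real.rpow_mul (zero_le_one.trans hn)]
  exact Real.rpow_le_rpow_of_exponent_le hn (by linarith)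

end QuasiFekete

end

theorem mainTheorem4
    (μ : MeasureTheory.Measure QuasiFekete.P1) [MeasureTheory.IsProbabilityMeasure μ]
    (α : ℝ) (hα0 : 0 < α) (hα1 : α ≤ 1)
    (g : QuasiFekete.P1 → ℝ)
    (hg : QuasiFekete.IsGoodPotential μ g) (hgα : QuasiFekete.IsHolder α g)
    (C' : ℝ) (hC' : 0 < C')
    (γ : ℝ) (hγ : min (1 / 4) (2 * α) ≤ γ) (hγ1 : γ ≤ 1)
    (φ : QuasiFekete.P1 → ℝ)
    (hφW : QuasiFekete.MemW12 φ) (hφγ : QuasiFekete.IsHolder γ φ)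
    (F : Finset QuasiFekete.P1) (hF : QuasiFekete.IsQuasiFekete g C' F) :
    |(∫ x, φ x ∂μ) - (1 / (F.card : ℝ)) * ∑ z ∈ F, φ z| ≤
      Real.sqrt (2 * QuasiFekete.holderSeminorm α g + 1 + C' + max 2 (1 / α)) *
        (Real.log (F.card : ℝ) / (F.card : ℝ)) ^ (1 / 2 : ℝ) * QuasiFekete.seminormW γ φ := by
  obtain ⟨m, hm, rfl⟩ := QuasiFekete.exists_eq_map_affine μ (hg.measure_singleton _)
  rw [QuasiFekete.integral_map_affine]
  have hγ0 : 0 < γ := (lt_min (by norm_num) (by linarith)).trans_le hγ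
  have hcard := hF.1
  have hne : F.Nonempty := Finset.card_pos.mp (by omega)
  have hn2 : (2 : ℝ) ≤ F.card := by exact_mod_cast hcard
  have hS := QuasiFekete.holderSeminorm_nonneg α g
  set S := QuasiFekete.holderSeminorm α g
  set M : ℝ := max 2 (1 / α) with hM
  have hM2 : 2 ≤ M := le_max_left _ _
  have hMα : 1 ≤ M * α := by
    have := mul_le_mul_of_nonneg_right (le_max_right 2 (1 / α)) hα0.le
    rwa [one_div_mul_cancel hα0.ne'] at this
  set n : ℝ := (F.card : ℝ) with hn
  have hn0 : 0 < n := by linarith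
  set L := Real.log n with hL
  have hL0 : 0 < L := Real.log_pos (by linarith)
  set K : ℝ := 2 * S + 1 + C' + M with hK
  have hK0 : 0 ≤ K := by linarith
  set R : ℝ := Real.sqrt K * (L / n) ^ (1 / 2 : ℝ) with hRdef
  have hR0 : 0 ≤ R := by positivity
  have hR2 : R ^ 2 = K * (L / n) := by
    rw [hRdef, mul_pow, Real.sq_sqrt hK0, ← Real.sqrt_eq_rpow, Real.sq_sqrt (by positivity)]
  -- As `M ≥ 2`, one has `K ≥ 2S + 3 + C'`. In the first case therefore `R ≥ 1`, and the oscillation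
  -- of `φ` is enough.
  rcases le_or_gt n ((2 * S + 3 + C') * L) with htriv | hlt
  · have hR1 : 1 ≤ R := by
      rw [← one_le_sq_iff₀ hR0, hR2, ← mul_div_assoc, one_le_div hn0]
      nlinarith
    have h1 := hφγ.abs_integral_sub_average_le hγ0 m hne
    have h2 := QuasiFekete.gradNorm_nonneg φ
    have h3 := QuasiFekete.holderSeminorm_nonneg γ φ
    have h4 : QuasiFekete.holderSeminorm γ φ ≤ QuasiFekete.seminormW γ φ := by
      unfold QuasiFekete.seminormW
      linarith
    exact h1.trans (h4.trans (le_mul_of_one_le_left (h3.trans h4) hR1))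
  obtain ⟨hL43, herr⟩ := QuasiFekete.error_le_log hcard (G := 2 * S) (by linarith)
    (by nlinarith)
  have hn1 : 1 ≤ n := by linarith
  -- The scale is `a = n^(-M)`: `M ≥ 2` makes `2a` at most `2/n²`, and `M α ≥ 1` makes `a^α` at most
  -- `1/n`.
  have ha0 : 0 < n ^ (-M) := Real.rpow_pos_of_pos hn0 _
  have ha2 : n ^ (-M) ≤ 1 / n ^ 2 := by
    have := Real.rpow_le_rpow_of_exponent_le hn1 (neg_le_neg hM2)
    rwa [Real.rpow_neg hn0.le 2, Real.rpow_two, ← one_div] at this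
  have ha1 : n ^ (-M) ≤ 1 := ha2.trans ((div_le_one (by positivity)).mpr (by nlinarith))
  have haα : (n ^ (-M)) ^ α ≤ 1 / n := by
    have := QuasiFekete.rpow_neg_mul_le hn1 hMα
    rwa [Real.rpow_neg_one, ← one_div] at this
  -- If `γ ≥ 1/4`, use `M ≥ 2`; if `γ ≥ 2α`, use `M α ≥ 1`. Hence the smearing error on `φ` is of
  -- order at most `n^(-1/2)`.
  have hMγ : 1 / 2 ≤ M * γ := by
    rcases min_le_iff.mp hγ with h | h <;> nlinarith
  refine hF.abs_integral_sub_le hg hα0 hα1 hgα hγ0 hγ1 hφW hφγ ha0 ha1 hR0 ?_ ?_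
  · rw [hR2, Real.log_rpow hn0]
    have h1 : S * (2 / n + 4 * (n ^ (-M)) ^ α) ≤ S * (6 / n) := by
      refine mul_le_mul_of_nonneg_left ?_ hS
      have : 6 / n = 2 / n + 4 * (1 / n) := by ring
      rw [this]
      linarith
    -- The errors `6S/n + 2/n²` must fit in `(2S + 1) L / n`, which is the inequality supplied by
    -- `error_le_log`.
    have h2 : (2 * S * (3 - L) + 2 / n) / n ≤ L / n := div_le_div_of_nonneg_right herr hn0.le
    have h3 : K * (L / n) - (C' * L - -M * L) / n - S * (6 / n) - 2 * (1 / n ^ 2) =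
        L / n - (2 * S * (3 - L) + 2 / n) / n := by
      rw [hK]
      field_simp
      ring
    linarith
  · have h1 := QuasiFekete.rpow_neg_mul_le hn1 hMγ
    -- After squaring this reads `4 ≤ K L`, true since `K ≥ 3` and `L ≥ 4/3`.
    have h2 : 2 * (n ^ (-(1 / 2 : ℝ))) ≤ R := by
      refine abs_le_of_sq_le_sq' ?_ hR0 |>.2
      rw [hR2, mul_pow, ← Real.rpow_natCast (n ^ (-(1 / 2 : ℝ))), ← Real.rpow_mul hn0.le]
      norm_num
      rw [Real.rpow_neg_one, mul_div_assoc', ← div_eq_mul_inv]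
      refine div_le_div_of_nonneg_right ?_ hn0.le
      nlinarith
    linarith
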